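/- Let $n\ge 3$. The group $S(U(n)\times U(n))=\{(u_L,u_R)\in U(n)\times U(n):\det u_L=\det u_R\}$ (which contains $SU(n)\times SU(n)$) acts on $SU(n)$ by $(u_L,u_R)\cdot g=u_L\,g\,u_R^{-1}$. For a subgroup $T\subset S(U(n)\times U(n))$ we say that - $T$ *acts freely* (modulo its ineffective kernel) if, whenever $(u_L,u_R)\in T$ and $u_L=g u_R g^{-1}$ for some $g\in SU(n)$, then $u_L=u_R$ is central in $U(n)$; - $T$ *acts on one side* if all its elements act on $SU(n)$ as left translations, or all of them act as right translations; - $T$ is *conjugate* to $S$ if a map $F:SU(n)\to SU(n)$ of the form $g\mapsto agb$ or $g\mapsto ag^{-1}b$ with $a,b\in SU(n)$ (conjugation in $SU(n)\times SU(n)$, possibly after interchanging the two sides) conjugates the group of transformations of $SU(n)$ defined by $T$ onto the one defined by $S$; - the actions of $T$ and $S$ are *equivalent* if some isometry $F$ of $SU(n)$ with its bi-invariant metric (equivalently, a bijection preserving the distance given by the Frobenius norm) conjugates the group of transformations defined by $T$ onto the one defined by $S$. For $1\le\ell\le n/2$ let, with $z,w_1,\dots,w_{n-2}$ ranging over the unit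 circle, $$S_{1,\ell}=\Big\{\big(\operatorname{diag}(\underbrace{z^2,\dots,z^2}_{\ell},1,\dots,1),\ \operatorname{diag}(z\bar w_1\cdots\bar w_{n-2},\,z^2w_1,\dots,z^2w_{\ell-1},\,w_\ell,\dots,w_{n-2},\,z)\big)\Big\},$$ $$S_{2,\ell}=\Big\{\big(\operatorname{diag}(1,\dots,1,z^2),\ \operatorname{diag}(z\bar w_1\cdots\bar w_{\ell-1},\,w_1,\dots,w_{n-2},\,z\bar w_\ell\cdots\bar w_{n-2})\big)\Big\}.$$ **Theorem.** (a) Let $T\subset S(U(n)\times U(n))$ be an $(n-1)$-dimensional torus (a subgroup isomorphic as a topological group to $(S^1)^{n-1}$) such that only finitely many elements of $T$ act trivially on $SU(n)$. Then $T$ acts freely on $SU(n)$ if and only if $T$ acts on one side, or $T$ is conjugate to $S_{1,\ell}$ or to $S_{2,\ell}$ for some integer $1\le\ell\le n/2$. (b) For every integer $1\le\ell\le n/2$, the actions of $S_{1,\ell}$ and $S_{2,\ell}$ on $SU(n)$ are equivalent if and only if $\ell=1$. -/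

import Mathlib

noncomputable section

namespace TorusBiquotient

/-- The unitary group `U(n)`. -/
abbrev U (n : ℕ) := Matrix.unitaryGroup (Fin n) ℂ

/-- The special unitary group `SU(n)`. -/
abbrev SU (n : ℕ) := Matrix.specialUnitaryGroup (Fin n) ℂ

/-- `S(U(n) × U(n))`: pairs `(u_L, u_R)` of unitary matrices with `det u_L = det u_R`. -/
def equalDet (n : ℕ) : Subgroup (U n × U n) where
  carrier := {u | (u.1 : Matrix (Fin n) (Fin n) ℂ).det = (u.2 : Matrix (Fin n) (Fin n) ℂ).det}
  mul_mem' := by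
    intro a b ha hb
    simp only [Set.mem_ofPred_eq, Prod.fst_mul, Prod.snd_mul, Submonoid.coe_mul,
      Matrix.det_mul] at *
    rw [ha, hb]
  one_mem' := by simp
  inv_mem' := by
    intro a ha
    simp only [Set.mem_ofPred_eq, Prod.fst_inv, Prod.snd_inv, Matrix.UnitaryGroup.inv_val,
      Matrix.star_eq_conjTranspose, Matrix.det_conjTranspose] at *
    rw [ha]

theorem act_mem {n : ℕ} (u : equalDet n) (g : SU n) :
    ((u.1.1 : U n) : Matrix (Fin n) (Fin n) ℂ) * (g : Matrix (Fin n) (Fin n) ℂ) *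
      (((u.1.2)⁻¹ : U n) : Matrix (Fin n) (Fin n) ℂ) ∈
        Matrix.specialUnitaryGroup (Fin n) ℂ := by
  have hg := Matrix.mem_specialUnitaryGroup_iff.1 g.2
  refine Matrix.mem_specialUnitaryGroup_iff.2
    ⟨mul_mem (mul_mem u.1.1.2 hg.1) (u.1.2⁻¹).2, ?_⟩
  have hu : (u.1.1 : Matrix (Fin n) (Fin n) ℂ).det = (u.1.2 : Matrix (Fin n) (Fin n) ℂ).det :=
    u.2
  rw [Matrix.det_mul, Matrix.det_mul, hg.2, mul_one, hu, ← Matrix.det_mul, ← Submonoid.coe_mul,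
    mul_inv_cancel, Submonoid.coe_one, Matrix.det_one]

/-- The biquotient action of `S(U(n) × U(n))` on `SU(n)`: `(u_L, u_R) · g = u_L g u_R⁻¹`. -/
def act (n : ℕ) : equalDet n →* Equiv.Perm (SU n) :=
  MonoidHom.toHomPerm
    { toFun := fun u g =>
        ⟨((u.1.1 : U n) : Matrix (Fin n) (Fin n) ℂ) * (g : Matrix (Fin n) (Fin n) ℂ) *
          (((u.1.2)⁻¹ : U n) : Matrix (Fin n) (Fin n) ℂ), act_mem u g⟩
      map_one' := by
        funext g
        apply Subtype.ext
        simp only [OneMemClass.coe_one, Prod.fst_one, Prod.snd_one, inv_one, one_mul, mul_one]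
        rfl
      map_mul' := by
        intro u v
        funext g
        apply Subtype.ext
        change _ = ((u.1.1 : U n) : Matrix (Fin n) (Fin n) ℂ) *
          (((v.1.1 : U n) : Matrix (Fin n) (Fin n) ℂ) * (g : Matrix (Fin n) (Fin n) ℂ) *
          (((v.1.2)⁻¹ : U n) : Matrix (Fin n) (Fin n) ℂ)) *
          (((u.1.2)⁻¹ : U n) : Matrix (Fin n) (Fin n) ℂ)
        simp only [Subgroup.coe_mul, Prod.fst_mul, Prod.snd_mul, mul_inv_rev, Submonoid.coe_mul,
          mul_assoc] }

/-- `T` is a `k`-dimensional torus: isomorphic, as a topological group, to `(S¹)^k`. -/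
def IsTorus {n : ℕ} (k : ℕ) (T : Subgroup (equalDet n)) : Prop :=
  Nonempty (T ≃ₜ* (Fin k → Circle))

/-- Only finitely many elements of `T` act trivially on `SU(n)`. -/
def HasFiniteKernel {n : ℕ} (T : Subgroup (equalDet n)) : Prop :=
  {u : equalDet n | u ∈ T ∧ act n u = 1}.Finite

/-- The action of `T` on `SU(n)` is free modulo its ineffective kernel: if `u_L = g u_R g⁻¹`
for some `g ∈ SU(n)`, i.e. `u` fixes some `g`, then `u_L = u_R` is central. -/
def ActsFreely {n : ℕ} (T : Subgroup (equalDet n)) : Prop :=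
  ∀ u ∈ T, (∃ g : SU n, act n u g = g) → u.1.1 = u.1.2 ∧ u.1.1 ∈ Subgroup.center (U n)

/-- `T` acts on one side: either all its elements act by left translations of `SU(n)`,
or all of them act by right translations. -/
def ActsOnOneSide {n : ℕ} (T : Subgroup (equalDet n)) : Prop :=
  (∀ u ∈ T, ∃ a : SU n, ∀ g : SU n, act n u g = a * g) ∨
    (∀ u ∈ T, ∃ b : SU n, ∀ g : SU n, act n u g = g * b)

/-- `F` carries the transformation group on `SU(n)` given by `T` to the one given by `S`. -/
def Intertwines {n : ℕ} (F : Equiv.Perm (SU n)) (T S : Subgroup (equalDet n)) : Prop :=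
  (T.map (act n)).map (MulAut.conj F).toMonoidHom = S.map (act n)

/-- `T` and `S` are conjugate as groups of transformations of `SU(n)`: conjugate by an element
of `SU(n) × SU(n)`, possibly after interchanging the two sides by `g ↦ g⁻¹`. -/
def IsConjugate {n : ℕ} (T S : Subgroup (equalDet n)) : Prop :=
  ∃ (a b : SU n) (F : Equiv.Perm (SU n)),
    ((∀ g, F g = a * g * b) ∨ (∀ g, F g = a * g⁻¹ * b)) ∧ Intertwines F T S

/-- `F` preserves the distance on `SU(n)` coming from the Frobenius norm on matrices;
these are the isometries of a bi-invariant metric on `SU(n)`. -/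
def IsFrobeniusIsometry {n : ℕ} (F : Equiv.Perm (SU n)) : Prop :=
  ∀ g h : SU n, ∑ i, ∑ j, ‖(F g).1 i j - (F h).1 i j‖ ^ 2 = ∑ i, ∑ j, ‖g.1 i j - h.1 i j‖ ^ 2

/-- The actions of `T` and `S` on `SU(n)` are equivalent: an isometry of the bi-invariant metric
carries one to the other. -/
def AreEquivalentActions {n : ℕ} (T S : Subgroup (equalDet n)) : Prop :=
  ∃ F : Equiv.Perm (SU n), IsFrobeniusIsometry F ∧ Intertwines F T S

/-- The unitary diagonal matrix with diagonal entries `d 0, …, d (n - 1)`. -/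
def diag {n : ℕ} : (Fin n → Circle) →* U n where
  toFun d := ⟨Matrix.diagonal fun i => (d i : ℂ), by
    rw [Matrix.mem_unitaryGroup_iff, Matrix.star_eq_conjTranspose, Matrix.diagonal_conjTranspose,
      Matrix.diagonal_mul_diagonal, ← Matrix.diagonal_one]
    congr 1
    funext i
    simp [Complex.mul_conj]⟩
  map_one' := by
    apply Subtype.ext
    simp
  map_mul' := by
    intro d e
    apply Subtype.ext
    simp

/-- `(z², …, z², 1, …, 1)` with `ℓ` entries `z²`. -/
def left₁ (n ℓ : ℕ) (z : Circle) : Fin n → Circle :=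
  fun i => if (i : ℕ) < ℓ then z ^ 2 else 1

/-- `(z w̄₁ ⋯ w̄ₙ₋₂, z² w₁, …, z² w_{ℓ-1}, w_ℓ, …, wₙ₋₂, z)`; only `w 1, …, w (n - 2)` matter. -/
def right₁ (n ℓ : ℕ) (z : Circle) (w : ℕ → Circle) : Fin n → Circle := fun i =>
  if (i : ℕ) = 0 then z * ∏ j ∈ Finset.Ico 1 (n - 1), (w j)⁻¹
  else if (i : ℕ) + 1 = n then z
  else if (i : ℕ) < ℓ then z ^ 2 * w i
  else w i

/-- `(1, …, 1, z²)`. -/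
def left₂ (n : ℕ) (z : Circle) : Fin n → Circle :=
  fun i => if (i : ℕ) + 1 = n then z ^ 2 else 1

/-- `(z w̄₁ ⋯ w̄_{ℓ-1}, w₁, …, wₙ₋₂, z w̄_ℓ ⋯ w̄ₙ₋₂)`; only `w 1, …, w (n - 2)` matter. -/
def right₂ (n ℓ : ℕ) (z : Circle) (w : ℕ → Circle) : Fin n → Circle := fun i =>
  if (i : ℕ) = 0 then z * ∏ j ∈ Finset.Ico 1 ℓ, (w j)⁻¹
  else if (i : ℕ) + 1 = n then z * ∏ j ∈ Finset.Ico ℓ (n - 1), (w j)⁻¹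
  else w i

theorem left₁_mul (n ℓ : ℕ) (z z' : Circle) :
    left₁ n ℓ (z * z') = left₁ n ℓ z * left₁ n ℓ z' := by
  funext i
  simp only [left₁, Pi.mul_apply]
  split_ifs <;> simp [mul_pow]

theorem right₁_mul (n ℓ : ℕ) (z z' : Circle) (w w' : ℕ → Circle) :
    right₁ n ℓ (z * z') (w * w') = right₁ n ℓ z w * right₁ n ℓ z' w' := by
  funext i
  simp only [right₁, Pi.mul_apply, mul_inv, Finset.prod_mul_distrib]
  split_ifs
  · exact mul_mul_mul_comm _ _ _ _
  · rfl
  · rw [mul_pow]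
    exact mul_mul_mul_comm _ _ _ _
  · rfl

theorem left₂_mul (n : ℕ) (z z' : Circle) : left₂ n (z * z') = left₂ n z * left₂ n z' := by
  funext i
  simp only [left₂, Pi.mul_apply]
  split_ifs <;> simp [mul_pow]

theorem right₂_mul (n ℓ : ℕ) (z z' : Circle) (w w' : ℕ → Circle) :
    right₂ n ℓ (z * z') (w * w') = right₂ n ℓ z w * right₂ n ℓ z' w' := by
  funext i
  simp only [right₂, Pi.mul_apply, mul_inv, Finset.prod_mul_distrib]
  split_ifs
  · exact mul_mul_mul_comm _ _ _ _
  · exact mul_mul_mul_comm _ _ _ _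
  · rfl

/-- The homomorphism `(z, w) ↦ (diag left₁, diag right₁)`. -/
def torusHom₁ (n ℓ : ℕ) : Circle × (ℕ → Circle) →* U n × U n :=
  MonoidHom.mk' (fun p => (diag (left₁ n ℓ p.1), diag (right₁ n ℓ p.1 p.2))) (by
    intro p q
    simp only [Prod.fst_mul, Prod.snd_mul, left₁_mul, right₁_mul, map_mul, Prod.mk_mul_mk])

/-- The homomorphism `(z, w) ↦ (diag left₂, diag right₂)`. -/
def torusHom₂ (n ℓ : ℕ) : Circle × (ℕ → Circle) →* U n × U n :=
  MonoidHom.mk' (fun p => (diag (left₂ n p.1), diag (right₂ n ℓ p.1 p.2))) (by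
    intro p q
    simp only [Prod.fst_mul, Prod.snd_mul, left₂_mul, right₂_mul, map_mul, Prod.mk_mul_mk])

/-- The torus `S_{1,ℓ}`. For `1 ≤ ℓ ≤ n / 2` and `3 ≤ n` the whole range lies in `equalDet n`,
see `torusHom₁_mem`. -/
def S₁ (n ℓ : ℕ) : Subgroup (equalDet n) := (torusHom₁ n ℓ).range.subgroupOf (equalDet n)

/-- The torus `S_{2,ℓ}`. For `1 ≤ ℓ ≤ n / 2` and `3 ≤ n` the whole range lies in `equalDet n`,
see `torusHom₂_mem`. -/
def S₂ (n ℓ : ℕ) : Subgroup (equalDet n) := (torusHom₂ n ℓ).range.subgroupOf (equalDet n)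

theorem mem_equalDet_diag {n : ℕ} (d e : Fin n → Circle) (h : ∏ i, d i = ∏ i, e i) :
    ((diag d, diag e) : U n × U n) ∈ equalDet n := by
  have h' := congrArg (fun x : Circle => (x : ℂ)) h
  change (Matrix.diagonal fun i => (d i : ℂ)).det = (Matrix.diagonal fun i => (e i : ℂ)).det
  rw [Matrix.det_diagonal, Matrix.det_diagonal]
  have key : ∀ f : Fin n → Circle, ((∏ i, f i : Circle) : ℂ) = ∏ i, (f i : ℂ) :=
    fun f => map_prod Circle.coeHom f Finset.univ
  rw [← key, ← key]
  exact h'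

theorem prod_Ico_inv (k : ℕ) (w : ℕ → Circle) :
    ∏ j ∈ Finset.Ico 1 (k + 1), (w j)⁻¹ = (∏ i : Fin k, w (i + 1))⁻¹ := by
  rw [Finset.prod_Ico_eq_prod_range, Nat.add_sub_cancel, Finset.prod_range, Finset.prod_inv_distrib]
  simp only [add_comm 1]

theorem torusHom₁_mem {n ℓ : ℕ} (hn : 3 ≤ n) (h1 : 1 ≤ ℓ) (h2 : 2 * ℓ ≤ n)
    (p : Circle × (ℕ → Circle)) : torusHom₁ n ℓ p ∈ equalDet n := by
  obtain ⟨z, w⟩ := p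
  obtain ⟨k, rfl⟩ : ∃ k, n = k + 2 := ⟨n - 2, by omega⟩
  obtain ⟨l, rfl⟩ : ∃ l, ℓ = l + 1 := ⟨ℓ - 1, by omega⟩
  apply mem_equalDet_diag
  have hl : ¬ k + 1 < l + 1 := by omega
  have hk : ∀ i : Fin k, ¬ ((i : ℕ) = k) := fun i => by omega
  have hm : ∀ i : Fin k, (if (i : ℕ) < l then z ^ 2 * w (i + 1) else w (i + 1)) =
      (if (i : ℕ) < l then z ^ 2 else 1) * w (i + 1) := fun i => by split_ifs <;> simp
  rw [Fin.prod_univ_succ, Fin.prod_univ_castSucc, Fin.prod_univ_succ (n := k + 1),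
    Fin.prod_univ_castSucc]
  simp [left₁, right₁, hl, hk, prod_Ico_inv, -Finset.prod_inv_distrib]
  simp only [hm, Finset.prod_mul_distrib]
  generalize (∏ i : Fin k, w (i + 1)) = P
  generalize (∏ i : Fin k, (if (i : ℕ) < l then z ^ 2 else 1)) = Q
  apply Circle.ext
  have hP : (P : ℂ) ≠ 0 := P.coe_ne_zero
  push_cast
  field_simp

theorem torusHom₂_mem {n ℓ : ℕ} (hn : 3 ≤ n) (h1 : 1 ≤ ℓ) (h2 : 2 * ℓ ≤ n)
    (p : Circle × (ℕ → Circle)) : torusHom₂ n ℓ p ∈ equalDet n := by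
  obtain ⟨z, w⟩ := p
  obtain ⟨k, rfl⟩ : ∃ k, n = k + 2 := ⟨n - 2, by omega⟩
  apply mem_equalDet_diag
  have hk : ∀ i : Fin k, ¬ ((i : ℕ) = k) := fun i => by omega
  have hc := Finset.prod_Ico_consecutive (fun j => (w j)⁻¹) h1 (show ℓ ≤ k + 1 by omega)
  rw [prod_Ico_inv] at hc
  rw [Fin.prod_univ_succ, Fin.prod_univ_castSucc, Fin.prod_univ_succ (n := k + 1),
    Fin.prod_univ_castSucc]
  simp [left₂, right₂, hk, -Finset.prod_inv_distrib]
  generalize (∏ i : Fin k, w (i + 1)) = P at *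
  generalize (∏ j ∈ Finset.Ico 1 ℓ, (w j)⁻¹) = A at *
  generalize (∏ j ∈ Finset.Ico ℓ (k + 1), (w j)⁻¹) = B at *
  have hP : P = A⁻¹ * B⁻¹ := by rw [← mul_inv, hc, inv_inv]
  subst hP
  apply Circle.ext
  have hA : (A : ℂ) ≠ 0 := A.coe_ne_zero
  have hB : (B : ℂ) ≠ 0 := B.coe_ne_zero
  push_cast
  field_simp

end TorusBiquotient

end

/-! ### Matching bases of a lattice, and their reduction modulo 2 -/

namespace TorusBiquotient

/-! Diagonalize both factors of the torus: `T` is then described by weights `A i` on the left and `B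
j` on the right in `ℤ^(n-1)`, with equal sums. An element `t` fixes a point exactly when its left
and right eigenvalues agree after some permutation `σ`, and it acts trivially exactly when all these
eigenvalues coincide. By duality between subgroups of the weight lattice and closed subgroups of the
torus, freeness says that for every `σ` the `n` vectors `A i - B (σ i)` span the lattice `L` of all
differences. Since the kernel is finite, `L` has rank `n - 1`, so the only relation among these
vectors is that their sum vanishes. This is `IsMatchingBasis`, established in
`isMatchingBasis_weights`; from there on part (a) is combinatorics of lattices.

Dividing `L` by one difference `a i - b j` and deleting `i` and `j` gives the same structure with
one index fewer, so inductions are available. Three facts are proved. Modulo 2 one of the families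
is constant (`left_eq_or_right_eq`); up to exchanging sides, let it be `a`. Then `a` takes at most
two values (`two_values`): for three indices this is a computation with determinants in the plane,
and for more indices one can divide without merging three given values. After a translation, `a` is
`2z` on a set `I` of at most half of the indices and `0` elsewhere. Finally (`exists_relation`),
expanding `z` in the bases attached to all matchings gives a set `M` with `∑ j ∈ M, b j = s • z`,
where `s` differs by one from `2 |M ∩ J|` for every `J` of size `|I|`. This forces `I`, `M` or the
complement of `M` to be a singleton. Either some `b j = z`, which is the family `S₁`, or `|I| = 1`
and a subset of the `b j` sums to `z`, which is the family `S₂`. The converse in (a) is a direct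
comparison of eigenvalues.

For (b), an isometry preserves the number of transformations of order dividing 3 that move every
point by the same distance. Those of squared displacement 6 include right multiplications by
diagonal matrices with two nontrivial entries `ω`, `ω⁻¹`. The torus `S₁` has at least `(n-1)(n-2)`
of them, while `S₂` has at most `ℓ(ℓ-1) + (n-ℓ)(n-ℓ-1)`, which is smaller by `2(ℓ-1)(n-ℓ-1)`. For `ℓ
= 1` the two tori differ by a transposition of coordinates. -/

/-- A pair of families `a`, `b` with the same sum such that, for every matching `σ`, the differences
`a i - b (σ i)` generate `L` and satisfy, modulo `N`, only the relation that their sum vanishes. -/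
structure IsMatchingBasis {ι κ L : Type*} [Fintype ι] [Fintype κ] [AddCommGroup L] (N : ℕ)
    (a : ι → L) (b : κ → L) : Prop where
  sum_eq : ∑ i, a i = ∑ j, b j
  span : ∀ (σ : ι ≃ κ) (v : L), ∃ c : ι → ℤ, v = ∑ i, c i • (a i - b (σ i))
  indep : ∀ (σ : ι ≃ κ) (c : ι → ℤ), ∑ i, c i • (a i - b (σ i)) = 0 → ∀ i k, (N : ℤ) ∣ c i - c k

theorem exists_equiv_apply_eq {ι κ : Type*} [Fintype ι] [Fintype κ]
    (hc : Fintype.card ι = Fintype.card κ) (i : ι) (j : κ) : ∃ σ : ι ≃ κ, σ i = j := by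
  classical
  let e := Fintype.equivOfCardEq hc
  exact ⟨e.trans (Equiv.swap (e i) j), by simp⟩

theorem exists_equiv_apply_eq₂ {ι κ : Type*} [Fintype ι] [Fintype κ]
    (hc : Fintype.card ι = Fintype.card κ) {i k : ι} {j l : κ} (hik : i ≠ k) (hjl : j ≠ l) :
    ∃ σ : ι ≃ κ, σ i = j ∧ σ k = l := by
  classical
  obtain ⟨e, he⟩ := exists_equiv_apply_eq hc i j
  refine ⟨e.trans (Equiv.swap (e k) l), ?_, by simp⟩
  have h1 : e i ≠ e k := fun h => hik (e.injective h)
  simp only [Equiv.trans_apply]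
  rw [Equiv.swap_apply_of_ne_of_ne h1 (by rw [he]; exact hjl), he]

/-- Extend an equivalence of complements of points by matching the points. -/
def extendMatching {ι κ : Type*} [DecidableEq ι] [DecidableEq κ] (i : ι) (j : κ)
    (σ : {k // k ≠ i} ≃ {l // l ≠ j}) : ι ≃ κ :=
  ((Equiv.optionSubtypeNe i).symm.trans σ.optionCongr).trans (Equiv.optionSubtypeNe j)

theorem extendMatching_self {ι κ : Type*} [DecidableEq ι] [DecidableEq κ] (i : ι) (j : κ)
    (σ : {k // k ≠ i} ≃ {l // l ≠ j}) : extendMatching i j σ i = j := by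
  simp [extendMatching]

theorem extendMatching_of_ne {ι κ : Type*} [DecidableEq ι] [DecidableEq κ] (i : ι) (j : κ)
    (σ : {k // k ≠ i} ≃ {l // l ≠ j}) (k : {k // k ≠ i}) :
    extendMatching i j σ k = σ k := by
  simp [extendMatching, Equiv.optionSubtypeNe_symm_of_ne k.2]

theorem exists_ne_ne {ι : Type*} [Fintype ι] (h : 3 ≤ Fintype.card ι) (i k : ι) :
    ∃ m, m ≠ i ∧ m ≠ k := by
  classical
  by_contra! hc
  have : Fintype.card ι ≤ ({i, k} : Finset ι).card := by
    rw [← Finset.card_univ]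
    refine Finset.card_le_card fun m _ => ?_
    by_cases hm : m = i
    · simp [hm]
    · simp [hc m hm]
  have := Finset.card_le_two (a := i) (b := k)
  omega

theorem card_ne {ι : Type*} [Fintype ι] [DecidableEq ι] (i : ι) :
    Fintype.card {k // k ≠ i} = Fintype.card ι - 1 := by
  simp

namespace IsMatchingBasis

variable {ι κ L : Type*} [Fintype ι] [Fintype κ] [AddCommGroup L] {N : ℕ} {a : ι → L} {b : κ → L}

theorem symm (h : IsMatchingBasis N a b) : IsMatchingBasis N b a where
  sum_eq := h.sum_eq.symm
  span σ v := by
    obtain ⟨c, rfl⟩ := h.span σ.symm v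
    refine ⟨fun j => - c (σ j), ?_⟩
    rw [← Equiv.sum_comp σ]
    exact Finset.sum_congr rfl fun j _ => by
      rw [Equiv.symm_apply_apply, neg_smul, ← smul_neg, neg_sub]
  indep σ c hc := by
    have := h.indep σ.symm (fun i => - c (σ.symm i)) (by
      rw [← hc, ← Equiv.sum_comp σ]
      exact Finset.sum_congr rfl fun j _ => by
        rw [Equiv.symm_apply_apply, neg_smul, ← smul_neg, neg_sub])
    intro i k
    have h2 := this (σ k) (σ i)
    simpa [add_comm, sub_eq_add_neg] using h2

theorem sum_sub (h : IsMatchingBasis N a b) (σ : ι ≃ κ) : ∑ i, (a i - b (σ i)) = 0 := by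
  rw [Finset.sum_sub_distrib, Equiv.sum_comp σ, h.sum_eq, sub_self]

theorem translate (h : IsMatchingBasis N a b) (hc : Fintype.card ι = Fintype.card κ) (p : L) :
    IsMatchingBasis N (fun i => a i - p) (fun j => b j - p) where
  sum_eq := by simp [Finset.sum_sub_distrib, h.sum_eq, hc]
  span σ v := by simpa using h.span σ v
  indep σ c hc := by simpa using h.indep σ c (by simpa using hc)

/-- The step behind all inductions on the number of indices. A matching of the complements extends
by `i ↦ j`, and the extra difference `a i - b j` is exactly what is divided out. -/
theorem quotient [DecidableEq ι] [DecidableEq κ] (h : IsMatchingBasis N a b) (i : ι) (j : κ) :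
    IsMatchingBasis N
      (fun k : {k // k ≠ i} => (a k : L ⧸ AddSubgroup.zmultiples (a i - b j)))
      (fun l : {l // l ≠ j} => (b l : L ⧸ AddSubgroup.zmultiples (a i - b j))) where
  sum_eq := by
    have h1 := h.sum_eq
    rw [Fintype.sum_eq_add_sum_subtype_ne _ i, Fintype.sum_eq_add_sum_subtype_ne _ j] at h1
    rw [← QuotientAddGroup.mk_sum, ← QuotientAddGroup.mk_sum, QuotientAddGroup.eq,
      AddSubgroup.mem_zmultiples_iff]
    refine ⟨1, ?_⟩
    rw [one_smul, neg_add_eq_sub, sub_eq_sub_iff_add_eq_add, h1, add_comm]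
  span σ v := by
    obtain ⟨v, rfl⟩ := QuotientAddGroup.mk_surjective v
    obtain ⟨c, hc⟩ := h.span (extendMatching i j σ) v
    refine ⟨fun k => c k, ?_⟩
    rw [Fintype.sum_eq_add_sum_subtype_ne _ i, extendMatching_self] at hc
    simp only [extendMatching_of_ne] at hc
    have : ∑ k : {k // k ≠ i}, c k • ((a k : L ⧸ AddSubgroup.zmultiples (a i - b j)) - (b (σ k) : L))
        = ((∑ k : {k // k ≠ i}, c k • (a k - b (σ k)) : L) : L ⧸ AddSubgroup.zmultiples (a i - b j)) := by
      rw [QuotientAddGroup.mk_sum]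
      rfl
    rw [this, QuotientAddGroup.eq, AddSubgroup.mem_zmultiples_iff]
    refine ⟨- c i, ?_⟩
    rw [hc]
    simp
  indep σ c hc := by
    have : ∑ k : {k // k ≠ i}, c k • ((a k : L ⧸ AddSubgroup.zmultiples (a i - b j)) - (b (σ k) : L))
        = ((∑ k : {k // k ≠ i}, c k • (a k - b (σ k)) : L) : L ⧸ AddSubgroup.zmultiples (a i - b j)) := by
      rw [QuotientAddGroup.mk_sum]
      rfl
    rw [this, QuotientAddGroup.eq_zero_iff, AddSubgroup.mem_zmultiples_iff] at hc
    obtain ⟨t, ht⟩ := hc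
    have h1 := h.indep (extendMatching i j σ) (fun k => if hk : k = i then -t else c ⟨k, hk⟩) (by
      rw [Fintype.sum_eq_add_sum_subtype_ne _ i, extendMatching_self]
      simp only [extendMatching_of_ne, dif_pos]
      rw [Finset.sum_congr rfl (g := fun k : {k // k ≠ i} => c k • (a k - b (σ k)))
        (fun k _ => by rw [dif_neg k.2]), ← ht]
      simp)
    intro k l
    have := h1 k l
    simpa [k.2, l.2] using this

theorem sub_ne_zero (h : IsMatchingBasis 2 a b) (hc : Fintype.card ι = Fintype.card κ)
    (h2 : 2 ≤ Fintype.card ι) (i : ι) (j : κ) : a i - b j ≠ 0 := by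
  classical
  intro h0
  obtain ⟨σ, rfl⟩ := exists_equiv_apply_eq hc i j
  obtain ⟨k, hk⟩ : ∃ k, k ≠ i := by
    have : Nontrivial ι := Fintype.one_lt_card_iff_nontrivial.1 (by omega)
    exact exists_ne i
  have := h.indep σ (Pi.single i 1) (by
    rw [Finset.sum_eq_single i]
    · simpa using h0
    · intro m _ hm
      simp [hm]
    · simp) i k
  simp [hk] at this

/-- Equality would be a relation with coefficients `1`, `-1` and zeros elsewhere. Since `1` and `-1`
agree modulo 2, a third index is needed for a contradiction. -/
theorem sub_ne_sub (h : IsMatchingBasis 2 a b) (hc : Fintype.card ι = Fintype.card κ)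
    (h3 : 3 ≤ Fintype.card ι) {i k : ι} {j l : κ} (hik : i ≠ k) (hjl : j ≠ l) :
    a i - b j ≠ a k - b l := by
  classical
  intro h0
  obtain ⟨σ, rfl, rfl⟩ := exists_equiv_apply_eq₂ hc hik hjl
  obtain ⟨m, hmi, hmk⟩ := exists_ne_ne h3 i k
  have := h.indep σ (Pi.single i 1 - Pi.single k 1) (by
    simp only [Pi.sub_apply, sub_smul, Finset.sum_sub_distrib, Pi.single_apply, ite_smul, one_smul,
      zero_smul, Finset.sum_ite_eq', Finset.mem_univ, if_true]
    rw [h0, sub_self]) i m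
  simp [hmi, hmk, hik] at this

theorem mem_zmultiples_iff_of_two (h2 : ∀ v : L, v + v = 0) (d v : L) :
    v ∈ AddSubgroup.zmultiples d ↔ v = 0 ∨ v = d := by
  rw [AddSubgroup.mem_zmultiples_iff]
  constructor
  · rintro ⟨t, rfl⟩
    rcases Int.even_or_odd' t with ⟨s, rfl | rfl⟩
    · left
      rw [mul_smul, two_zsmul, h2]
    · right
      rw [add_smul, mul_smul, two_zsmul, h2]
      simp
  · rintro (rfl | rfl)
    · exact ⟨0, by simp⟩
    · exact ⟨1, by simp⟩

theorem mk_eq_mk_iff_of_two (h2 : ∀ v : L, v + v = 0) (d v w : L) :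
    (v : L ⧸ AddSubgroup.zmultiples d) = w ↔ w - v = 0 ∨ w - v = d := by
  rw [QuotientAddGroup.eq, mem_zmultiples_iff_of_two h2, neg_add_eq_sub]

theorem quotient_add_self (h2 : ∀ v : L, v + v = 0) (d : L) (v : L ⧸ AddSubgroup.zmultiples d) :
    v + v = 0 := by
  obtain ⟨v, rfl⟩ := QuotientAddGroup.mk_surjective v
  rw [← QuotientAddGroup.mk_add, h2]
  rfl

/-- With two indices the group is `{0, d}` for any one difference `d`, and no difference vanishes.
Hence all differences are equal. -/
theorem right_eq_of_card_two (h : IsMatchingBasis 2 a b) (h2 : ∀ v : L, v + v = 0)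
    (hc : Fintype.card ι = Fintype.card κ) (hn : Fintype.card ι = 2) (j l : κ) : b j = b l := by
  classical
  by_contra hjl
  have hjl' : j ≠ l := fun h => hjl (by rw [h])
  obtain ⟨i, k, hik, hu⟩ := (Finset.card_eq_two.1 (Finset.card_univ.trans hn) :
    ∃ x y : ι, x ≠ y ∧ Finset.univ = {x, y})
  obtain ⟨σ, rfl, rfl⟩ := exists_equiv_apply_eq₂ hc hik hjl'
  obtain ⟨c, hc'⟩ := h.span σ (a i - b (σ k))
  have hs := h.sum_sub σ
  rw [hu, Finset.sum_pair hik] at hs hc'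
  have h3 : a i - b (σ k) ∈ AddSubgroup.zmultiples (a i - b (σ i)) := by
    rw [AddSubgroup.mem_zmultiples_iff]
    refine ⟨c i - c k, ?_⟩
    rw [hc', eq_neg_of_add_eq_zero_right hs, sub_smul, smul_neg, sub_eq_add_neg]
  rw [mem_zmultiples_iff_of_two h2] at h3
  rcases h3 with h3 | h3
  · exact h.sub_ne_zero hc (by omega) _ _ h3
  · exact hjl (sub_right_injective h3).symm

/-- One repetition on the left makes the right family injective, by `sub_ne_sub`. Three distinct
right values cannot have all their differences in `{0, d}`, so the first alternative of `H` holds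
for every `i` and `j`. -/
theorem left_eq_of_pair_eq (h : IsMatchingBasis 2 a b) (hc : Fintype.card ι = Fintype.card κ)
    (hn : 4 ≤ Fintype.card ι)
    (H : ∀ i j, (∀ k l, k ≠ i → l ≠ i → a k - a l = 0 ∨ a k - a l = a i - b j) ∨
      (∀ k l, k ≠ j → l ≠ j → b k - b l = 0 ∨ b k - b l = a i - b j))
    {i k : ι} (hik : i ≠ k) (e : a i = a k) (p q : ι) : a p = a q := by
  classical
  have hb : ∀ j l, b j = b l → j = l := by
    intro j l hjl
    by_contra hne
    exact h.sub_ne_sub hc (by omega) hik hne (by rw [e, hjl])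
  have key : ∀ i j, ∀ k l, k ≠ i → l ≠ i → a k - a l = 0 ∨ a k - a l = a i - b j := by
    intro i j
    rcases H i j with H | H
    · exact H
    · exfalso
      have hcard : 3 ≤ Fintype.card {l // l ≠ j} := by rw [card_ne]; omega
      have : Nonempty {l // l ≠ j} := Fintype.card_pos_iff.1 (by omega)
      obtain ⟨x⟩ := this
      have : Nontrivial {l // l ≠ j} := Fintype.one_lt_card_iff_nontrivial.1 (by omega)
      obtain ⟨y, hy⟩ := exists_ne x
      obtain ⟨w, hwx, hwy⟩ := exists_ne_ne hcard x y
      have h1 := (H x y x.2 y.2).resolve_left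
        (fun h0 => hy (Subtype.ext (hb _ _ (sub_eq_zero.1 h0)).symm))
      have h2 := (H x w x.2 w.2).resolve_left
        (fun h0 => hwx (Subtype.ext (hb _ _ (sub_eq_zero.1 h0)).symm))
      exact hwy (Subtype.ext (hb _ _ (sub_right_injective (h2.trans h1.symm))))
  -- Deleting `m` together with `j` or with `l` places `a p - a q` in `{0, a m - b j}` and in `{0, a
  -- m - b l}`; these meet only in `0`.
  obtain ⟨m, hmp, hmq⟩ := exists_ne_ne (by omega) p q
  have : Nontrivial κ := Fintype.one_lt_card_iff_nontrivial.1 (by omega)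
  obtain ⟨j, l, hjl⟩ := exists_pair_ne κ
  rcases key m j p q hmp.symm hmq.symm with h1 | h1
  · exact sub_eq_zero.1 h1
  rcases key m l p q hmp.symm hmq.symm with h2 | h2
  · exact sub_eq_zero.1 h2
  · exact absurd (hb _ _ (sub_right_injective (h1.symm.trans h2))) hjl

theorem exists_pair_eq {d : L} (hn : 3 ≤ Fintype.card ι)
    (H : ∀ k l : ι, a k - a l = 0 ∨ a k - a l = d) : ∃ k l, k ≠ l ∧ a k = a l := by
  have : Nontrivial ι := Fintype.one_lt_card_iff_nontrivial.1 (by omega)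
  obtain ⟨x, y, hxy⟩ := exists_pair_ne ι
  obtain ⟨w, hwx, hwy⟩ := exists_ne_ne hn x y
  rcases H x y with h1 | h1
  · exact ⟨x, y, hxy, sub_eq_zero.1 h1⟩
  rcases H x w with h2 | h2
  · exact ⟨x, w, hwx.symm, sub_eq_zero.1 h2⟩
  · exact ⟨y, w, hwy.symm, sub_right_injective (h1.trans h2.symm)⟩

/-- Over `𝔽₂`, one of the two families is constant. -/
theorem left_eq_or_right_eq (n : ℕ) : ∀ {ι κ L : Type*} [Fintype ι] [Fintype κ] [AddCommGroup L]
    {a : ι → L} {b : κ → L}, IsMatchingBasis 2 a b → (∀ v : L, v + v = 0) →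
    Fintype.card ι = n + 3 → Fintype.card κ = n + 3 →
    (∀ i k, a i = a k) ∨ (∀ j l, b j = b l) := by
  induction n with
  | zero =>
    intro ι κ L _ _ _ a b h h2 hι hκ
    classical
    by_contra! hcon
    obtain ⟨⟨i, k, hik⟩, j, l, hjl⟩ := hcon
    have hik' : i ≠ k := fun h => hik (by rw [h])
    obtain ⟨m, hmi, hmk⟩ := exists_ne_ne (by omega) i k
    -- Modulo `a m - b j` two indices remain on each side, so `a i` and `a k` become equal. As they
    -- differ beforehand, their difference is `a m - b j`, whatever `j` is, and `b` is constant.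
    have key : ∀ j, a i - a k = a m - b j := by
      intro j
      have hq := (h.quotient m j).symm.right_eq_of_card_two (quotient_add_self h2 _)
        (by rw [card_ne, card_ne]; omega) (by rw [card_ne]; omega) ⟨k, hmk.symm⟩ ⟨i, hmi.symm⟩
      rw [mk_eq_mk_iff_of_two h2] at hq
      exact hq.resolve_left (fun h0 => hik (sub_eq_zero.1 h0))
    exact hjl (sub_right_injective ((key j).symm.trans (key l)))
  | succ n ih =>
    intro ι κ L _ _ _ a b h h2 hι hκ
    classical
    have H : ∀ i j, (∀ k l, k ≠ i → l ≠ i → a k - a l = 0 ∨ a k - a l = a i - b j) ∨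
        (∀ k l, k ≠ j → l ≠ j → b k - b l = 0 ∨ b k - b l = a i - b j) := by
      intro i j
      rcases ih (h.quotient i j) (quotient_add_self h2 _) (by rw [card_ne]; omega)
        (by rw [card_ne]; omega) with hq | hq
      · left
        intro k l hk hl
        have := hq ⟨l, hl⟩ ⟨k, hk⟩
        rwa [mk_eq_mk_iff_of_two h2] at this
      · right
        intro k l hk hl
        have := hq ⟨l, hl⟩ ⟨k, hk⟩
        rwa [mk_eq_mk_iff_of_two h2] at this
    have hneg : ∀ v : L, -v = v := fun v => neg_eq_of_add_eq_zero_left (h2 v)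
    have H' : ∀ j i, (∀ k l, k ≠ j → l ≠ j → b k - b l = 0 ∨ b k - b l = b j - a i) ∨
        (∀ k l, k ≠ i → l ≠ i → a k - a l = 0 ∨ a k - a l = b j - a i) := by
      intro j i
      rw [← hneg (b j - a i), neg_sub]
      exact (H i j).symm
    obtain ⟨i⟩ : Nonempty ι := Fintype.card_pos_iff.1 (by omega)
    obtain ⟨j⟩ : Nonempty κ := Fintype.card_pos_iff.1 (by omega)
    -- At least three entries remain, with pairwise differences in a two-element set. Two of them
    -- coincide, and one coincidence propagates to the whole family.
    rcases H i j with h1 | h1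
    · left
      obtain ⟨k, l, hkl, e⟩ := exists_pair_eq (ι := {k // k ≠ i}) (a := fun k => a k)
        (by rw [card_ne]; omega) (fun k l => h1 k l k.2 l.2)
      exact h.left_eq_of_pair_eq (by omega) (by omega) H (fun h => hkl (Subtype.ext h)) e
    · right
      obtain ⟨k, l, hkl, e⟩ := exists_pair_eq (ι := {k // k ≠ j}) (a := fun k => b k)
        (by rw [card_ne]; omega) (fun k l => h1 k l k.2 l.2)
      exact h.symm.left_eq_of_pair_eq (by omega) (by omega) H' (fun h => hkl (Subtype.ext h)) e

/-- A relation modulo `2L` reads `∑ c = 2 ∑ e` in `L`. So `c - 2e` is constant, and `c` has constant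
parity. -/
theorem quotient_two (h : IsMatchingBasis 0 a b) :
    IsMatchingBasis 2 (fun i => (a i : L ⧸ (zsmulAddGroupHom (α := L) 2).range))
      (fun j => (b j : L ⧸ (zsmulAddGroupHom (α := L) 2).range)) where
  sum_eq := by
    rw [← QuotientAddGroup.mk_sum, ← QuotientAddGroup.mk_sum, h.sum_eq]
  span σ v := by
    obtain ⟨v, rfl⟩ := QuotientAddGroup.mk_surjective v
    obtain ⟨c, rfl⟩ := h.span σ v
    refine ⟨c, ?_⟩
    rw [QuotientAddGroup.mk_sum]
    rfl
  indep σ c hc i k := by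
    have : ∑ i, c i • ((a i : L ⧸ (zsmulAddGroupHom (α := L) 2).range) - (b (σ i) : L)) =
        ((∑ i, c i • (a i - b (σ i)) : L) : L ⧸ (zsmulAddGroupHom (α := L) 2).range) := by
      rw [QuotientAddGroup.mk_sum]
      rfl
    rw [this, QuotientAddGroup.eq_zero_iff] at hc
    obtain ⟨w, hw⟩ := hc
    obtain ⟨e, rfl⟩ := h.span σ w
    have := h.indep σ (fun i => c i - 2 * e i) (by
      simp only [sub_smul, Finset.sum_sub_distrib, ← hw, mul_smul]
      rw [← Finset.smul_sum]
      exact sub_self _) i k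
    simp only [Nat.cast_zero, zero_dvd_iff] at this
    exact ⟨e i - e k, by push_cast; linarith⟩

/-- One of the two families is constant modulo `2`. -/
theorem even_left_or_even_right (h : IsMatchingBasis 0 a b)
    (hc : Fintype.card ι = Fintype.card κ) (hn : 3 ≤ Fintype.card ι) :
    (∀ i k, ∃ w, a i - a k = 2 • w) ∨ (∀ j l, ∃ w, b j - b l = 2 • w) := by
  have key : ∀ v w : L, (v : L ⧸ (zsmulAddGroupHom (α := L) 2).range) = w → ∃ u, w - v = 2 • u := by
    intro v w hvw
    rw [QuotientAddGroup.eq] at hvw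
    obtain ⟨u, hu⟩ := hvw
    refine ⟨u, ?_⟩
    rw [neg_add_eq_sub] at hu
    rw [← hu]
    exact two_zsmul u |>.trans (two_nsmul u).symm
  refine (left_eq_or_right_eq (Fintype.card ι - 3) h.quotient_two ?_ (by omega) (by omega)).imp
    (fun H i k => key _ _ (H k i)) (fun H i k => key _ _ (H k i))
  intro v
  obtain ⟨v, rfl⟩ := QuotientAddGroup.mk_surjective v
  rw [← QuotientAddGroup.mk_add, QuotientAddGroup.eq_zero_iff]
  exact ⟨v, two_zsmul v⟩

end IsMatchingBasis

end TorusBiquotient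

/-! ### A family constant modulo 2 takes at most two values -/

namespace TorusBiquotient

namespace IsMatchingBasis

variable {ι κ L : Type*} [Fintype ι] [Fintype κ] [AddCommGroup L] {N : ℕ} {a : ι → L} {b : κ → L}

/-- The difference of two coordinates with respect to a matching. -/
theorem exists_coord (h : IsMatchingBasis 0 a b) (σ : ι ≃ κ) (i k : ι) :
    ∃ φ : L →+ ℤ, ∀ c : ι → ℤ, φ (∑ m, c m • (a m - b (σ m))) = c i - c k := by
  choose c hc using h.span σ
  have key : ∀ (v : L) (e : ι → ℤ), v = ∑ m, e m • (a m - b (σ m)) → c v i - c v k = e i - e k := by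
    intro v e he
    have := h.indep σ (c v - e) (by
      simp only [Pi.sub_apply, sub_smul, Finset.sum_sub_distrib]
      rw [← hc v, ← he, sub_self]) i k
    simp only [Nat.cast_zero, zero_dvd_iff, Pi.sub_apply] at this
    linarith
  refine ⟨AddMonoidHom.mk' (fun v => c v i - c v k) ?_, fun e => key _ e rfl⟩
  intro v w
  rw [key (v + w) (c v + c w)]
  · simp only [Pi.add_apply]
    ring
  · simp only [Pi.add_apply, add_smul, Finset.sum_add_distrib]
    rw [← hc v, ← hc w]

theorem coord_sub [DecidableEq ι] {σ : ι ≃ κ} {i k : ι} {φ : L →+ ℤ}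
    (hφ : ∀ c : ι → ℤ, φ (∑ m, c m • (a m - b (σ m))) = c i - c k) (m : ι) :
    φ (a m - b (σ m)) = (if m = i then 1 else 0) - (if m = k then 1 else 0) := by
  have := hφ (Pi.single m 1)
  simpa [Pi.single_apply, ite_smul, eq_comm] using this

/-- Differences `a i - b j` and `a i - b l` with `j ≠ l` are not parallel. Match `i` with `j` and
another index `k` with `l`: since `a i ≡ a k` modulo 2, the second vector has odd `k`-coordinate and
the first has none. -/
theorem not_eq_zero_of_smul_eq (h : IsMatchingBasis 0 a b) (hc : Fintype.card ι = Fintype.card κ)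
    (hn : 3 ≤ Fintype.card ι) (ha : ∀ i k, ∃ w, a i - a k = 2 • w) (i : ι) {j l : κ} (hjl : j ≠ l)
    {x y : ℤ} (e : x • (a i - b j) = y • (a i - b l)) : x = 0 := by
  classical
  have : Nontrivial ι := Fintype.one_lt_card_iff_nontrivial.1 (by omega)
  obtain ⟨k, hk⟩ := exists_ne i
  obtain ⟨m, hmi, hmk⟩ := exists_ne_ne hn i k
  obtain ⟨σ, rfl, rfl⟩ := exists_equiv_apply_eq₂ hc hk.symm hjl
  obtain ⟨φ, hφ⟩ := h.exists_coord σ k m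
  obtain ⟨ψ, hψ⟩ := h.exists_coord σ i m
  obtain ⟨w, hw⟩ := ha i k
  have e1 : a i - b (σ k) = (a k - b (σ k)) + 2 • w := by rw [← hw]; abel
  rw [e1] at e
  have h1 := congrArg φ e
  have h2 := congrArg ψ e
  simp only [map_zsmul, map_add, map_nsmul, coord_sub hφ, coord_sub hψ] at h1 h2
  simp [hk, hk.symm, hmi.symm, hmk.symm] at h1 h2
  have hy : y = 0 := h1.resolve_right (by omega)
  rw [h2, hy, zero_mul]

theorem eq_zero_of_parallel {s t s' t' f g h : ℤ} (hp : s * t' = t * s')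
    (h0 : s * g - t * f = 0) (h1 : s' * g - t' * f = h) (hh : h ≠ 0) : s = 0 ∧ t = 0 := by
  constructor
  · refine (mul_eq_zero.1 (?_ : h * s = 0)).resolve_left hh
    rw [← h1]
    linear_combination s' * h0 - f * hp
  · refine (mul_eq_zero.1 (?_ : h * t = 0)).resolve_left hh
    rw [← h1]
    linear_combination t' * h0 - g * hp

/-- Planar version of the statement that a family constant modulo `2` takes at most two values. -/
theorem planar_two_values (x y p q : Fin 3 → ℤ)
    (hx : x 0 + x 1 + x 2 = p 0 + p 1 + p 2) (hy : y 0 + y 1 + y 2 = q 0 + q 1 + q 2)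
    (hD : ∀ σ : Equiv.Perm (Fin 3), IsUnit ((x 0 - p (σ 0)) * (y 1 - q (σ 1)) -
      (x 1 - p (σ 1)) * (y 0 - q (σ 0))))
    (hx2 : ∀ i k, (2 : ℤ) ∣ x i - x k) (hy2 : ∀ i k, (2 : ℤ) ∣ y i - y k) :
    (x 0 = x 1 ∧ y 0 = y 1) ∨ (x 1 = x 2 ∧ y 1 = y 2) ∨ (x 2 = x 0 ∧ y 2 = y 0) := by
  obtain ⟨D, eD⟩ : ∃ D : Fin 3 → Fin 3 → ℤ, ∀ j k,
      D j k = (x 0 - p j) * (y 1 - q k) - (x 1 - p k) * (y 0 - q j) := ⟨_, fun _ _ => rfl⟩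
  have hD' : ∀ j k, j ≠ k → -1 ≤ D j k ∧ D j k ≤ 1 := by
    intro j k hjk
    obtain ⟨σ, rfl, rfl⟩ := exists_equiv_apply_eq₂ (ι := Fin 3) (κ := Fin 3) rfl
      (show (0 : Fin 3) ≠ 1 by decide) hjk
    rw [eD]
    rcases Int.isUnit_iff.1 (hD σ) with h | h <;> rw [h] <;> simp
  -- The vectors `(s, t)` and `(s', t')` are half of `a 0 - a 1` and half of `a 1 - a 2`. Below, `u
  -- l` and `u' l` are their determinants against `a 2 - b l`, and `e` is their determinant against
  -- each other.
  obtain ⟨s, hs⟩ := hx2 0 1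
  obtain ⟨t, ht⟩ := hy2 0 1
  obtain ⟨s', hs'⟩ := hx2 1 2
  obtain ⟨t', ht'⟩ := hy2 1 2
  have D01 := hD' 0 1 (by decide)
  have D10 := hD' 1 0 (by decide)
  have D02 := hD' 0 2 (by decide)
  have D20 := hD' 2 0 (by decide)
  have D12 := hD' 1 2 (by decide)
  have D21 := hD' 2 1 (by decide)
  obtain ⟨u, hu⟩ : ∃ u : Fin 3 → ℤ, ∀ l, u l = s * (y 2 - q l) - t * (x 2 - p l) :=
    ⟨_, fun _ => rfl⟩
  obtain ⟨u', hu'⟩ : ∃ u : Fin 3 → ℤ, ∀ l, u l = s' * (y 2 - q l) - t' * (x 2 - p l) :=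
    ⟨_, fun _ => rfl⟩
  obtain ⟨e, he⟩ : ∃ e : ℤ, e = s * t' - t * s' := ⟨_, rfl⟩
  have R : ∀ j k l, p j + p k + p l = p 0 + p 1 + p 2 → q j + q k + q l = q 0 + q 1 + q 2 →
      2 * u l = -(D j k + D k j) ∧ 2 * u' l - 4 * e = -(D l j + D l k) ∧
      -2 * u l - 2 * u' l - 4 * e = -(D k l + D j l) := by
    intro j k l h1 h2
    have hpj : p j = x 0 + x 1 + x 2 - p k - p l := by linarith
    have hqj : q j = y 0 + y 1 + y 2 - q k - q l := by linarith
    have hx1 : x 1 = x 2 + 2 * s' := by linarith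
    have hx0 : x 0 = x 2 + 2 * s' + 2 * s := by linarith
    have hy1 : y 1 = y 2 + 2 * t' := by linarith
    have hy0 : y 0 = y 2 + 2 * t' + 2 * t := by linarith
    simp only [eD, hu, hu', he, hpj, hqj, hx0, hx1, hy0, hy1]
    refine ⟨by ring, by ring, by ring⟩
  have R0 := R 1 2 0 (by ring) (by ring)
  have R1 := R 2 0 1 (by ring) (by ring)
  have R2 := R 0 1 2 rfl rfl
  -- Each `2 * u l` is minus a sum of two determinants `±1`, so `|u l| ≤ 1`. The three `u l` add up
  -- to `-4 * e`, a multiple of 4 of absolute value at most 3.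
  have hpar : e = 0 := by
    have : u 0 + u 1 + u 2 = -4 * e := by
      rw [hu, hu, hu, he]
      linear_combination s * (hy - 2 * ht' - ht) - t * (hx - 2 * hs' - hs)
    omega
  rw [hpar] at R0 R1 R2 he
  by_contra! hcon
  have n1 : ¬ (s = 0 ∧ t = 0) := fun h => hcon.1 (by omega) (by omega)
  have n2 : ¬ (s' = 0 ∧ t' = 0) := fun h => hcon.2.1 (by omega) (by omega)
  have n3 : ¬ (s + s' = 0 ∧ t + t' = 0) := fun h => hcon.2.2 (by omega) (by omega)
  -- The halved differences are parallel and, the three values being distinct, nonzero, as is their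
  -- sum. If one of them has determinant zero against `a 2 - b l`, all do. One always has, because
  -- `u l`, `u' l` and their sum all lie in `{-1, 0, 1}`.
  have key : ∀ l, (u l = 0 ∨ u' l = 0 ∨ u l + u' l = 0) → u l = 0 := by
    intro l h
    by_contra hne
    rcases h with h | h | h
    · exact hne h
    · exact n2 (eq_zero_of_parallel (by linarith) (by rw [← hu', h]) (hu l).symm hne)
    · exact n3 (eq_zero_of_parallel (s := s + s') (t := t + t') (s' := s) (t' := t)
        (g := y 2 - q l) (f := x 2 - p l) (by linear_combination he)
        (by rw [hu, hu'] at h; linear_combination h) (hu l).symm hne)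
  have k0 := key 0 (by omega)
  have k1 := key 1 (by omega)
  -- Now `a 0 - b 0` and `a 1 - b 1` are both parallel to `(s, t)`, against the determinant `±1` of
  -- this pair.
  have hne : D 0 1 ≠ 0 := by
    rw [eD]
    exact (hD 1).ne_zero
  rw [hu] at k0 k1
  have e0 : s * (y 0 - q 0) - t * (x 0 - p 0) = 0 := by
    linear_combination k0 + s * (ht + ht') - t * (hs + hs') - 2 * he
  have e1 : s * (y 1 - q 1) - t * (x 1 - p 1) = 0 := by
    linear_combination k1 + s * ht' - t * hs' - 2 * he
  refine n1 ⟨(mul_eq_zero.1 ?_).resolve_left hne, (mul_eq_zero.1 ?_).resolve_left hne⟩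
  · rw [eD]
    linear_combination (x 0 - p 0) * e1 - (x 1 - p 1) * e0
  · rw [eD]
    linear_combination (y 0 - q 0) * e1 - (y 1 - q 1) * e0

/-- Two differences of coordinates along one matching identify `L` with `ℤ²`. Any other matching
also provides a basis, so the change of basis is unimodular, as `planar_two_values` requires. -/
theorem two_values_of_card_three (h : IsMatchingBasis 0 a b)
    (hc : Fintype.card ι = Fintype.card κ) (hn : Fintype.card ι = 3)
    (ha : ∀ i k, ∃ w, a i - a k = 2 • w) (i₁ i₂ i₃ : ι) :
    a i₁ = a i₂ ∨ a i₂ = a i₃ ∨ a i₃ = a i₁ := by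
  classical
  by_cases h12 : i₁ = i₂
  · simp [h12]
  by_cases h23 : i₂ = i₃
  · simp [h23]
  by_cases h31 : i₃ = i₁
  · simp [h31]
  have h13 : i₁ ≠ i₃ := Ne.symm h31
  let f : Fin 3 → ι := ![i₁, i₂, i₃]
  have hf : Function.Bijective f := by
    rw [Fintype.bijective_iff_injective_and_card]
    refine ⟨?_, by simp [hn]⟩
    intro s t hst
    fin_cases s <;> fin_cases t <;> simp_all [f]
  let F : Fin 3 ≃ ι := Equiv.ofBijective f hf
  let τ : ι ≃ κ := Fintype.equivOfCardEq hc
  obtain ⟨X, hX⟩ := h.exists_coord τ i₁ i₃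
  obtain ⟨Y, hY⟩ := h.exists_coord τ i₂ i₃
  have hsum : ∀ {M : Type _} [AddCommMonoid M] (g : ι → M), ∑ i, g i = g i₁ + g i₂ + g i₃ := by
    intro M _ g
    rw [← Equiv.sum_comp F, Fin.sum_univ_three]
    rfl
  have hsum' : ∑ j, b j = b (τ i₁) + b (τ i₂) + b (τ i₃) := by
    rw [← Equiv.sum_comp τ, hsum]
  have inj : ∀ v, X v = 0 → Y v = 0 → v = 0 := by
    intro v hv1 hv2
    obtain ⟨c, rfl⟩ := h.span τ v
    rw [hX] at hv1
    rw [hY] at hv2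
    have h0 := h.sum_sub τ
    rw [hsum] at h0 ⊢
    rw [show c i₁ = c i₃ by omega, show c i₂ = c i₃ by omega, ← smul_add, ← smul_add, h0, smul_zero]
  have hs := h.sum_eq
  rw [hsum, hsum'] at hs
  have key := planar_two_values (fun s => X (a (F s))) (fun s => Y (a (F s)))
    (fun s => X (b (τ (F s)))) (fun s => Y (b (τ (F s))))
    (by simpa [F, f] using congrArg X hs) (by simpa [F, f] using congrArg Y hs) (by
      intro σ
      let ρ : ι ≃ κ := (F.symm.trans (σ.trans F)).trans τ
      obtain ⟨c, hc1⟩ := h.span ρ (a i₁ - b (τ i₁))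
      obtain ⟨e, he1⟩ := h.span ρ (a i₂ - b (τ i₂))
      have h0 := h.sum_sub ρ
      rw [hsum] at h0 hc1 he1
      have hF0 : F 0 = i₁ := rfl
      have hF1 : F 1 = i₂ := rfl
      have hF2 : F 2 = i₃ := rfl
      have r0 : ρ i₁ = τ (F (σ 0)) := by rw [← hF0]; simp [ρ]
      have r1 : ρ i₂ = τ (F (σ 1)) := by rw [← hF1]; simp [ρ]
      rw [eq_neg_of_add_eq_zero_right h0, r0, r1] at hc1 he1
      have x1 := congrArg X hc1
      have x2 := congrArg X he1
      have y1 := congrArg Y hc1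
      have y2 := congrArg Y he1
      rw [coord_sub hX] at x1 x2
      rw [coord_sub hY] at y1 y2
      simp only [h12, h23, h13, Ne.symm h12, if_true, if_false, map_add, map_neg, map_zsmul,
        map_sub, smul_eq_mul] at x1 x2 y1 y2
      simp only [hF0, hF1]
      -- The inverse is the determinant of the matrix expressing the basis of `τ` in that of `ρ`,
      -- the third vector of `ρ` being eliminated as minus the sum of the other two.
      refine IsUnit.of_mul_eq_one ((c i₁ - c i₃) * (e i₂ - e i₃) - (c i₂ - c i₃) * (e i₁ - e i₃)) ?_
      generalize X (a i₁) = A at *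
      generalize X (a i₂) = B at *
      generalize Y (a i₁) = C at *
      generalize Y (a i₂) = D at *
      generalize X (b (τ (F (σ 0)))) = P at *
      generalize X (b (τ (F (σ 1)))) = Q at *
      generalize Y (b (τ (F (σ 0)))) = R at *
      generalize Y (b (τ (F (σ 1)))) = S at *
      have x1' : (c i₁ - c i₃) * (A - P) + (c i₂ - c i₃) * (B - Q) = 1 := by linear_combination -x1
      have x2' : (e i₁ - e i₃) * (A - P) + (e i₂ - e i₃) * (B - Q) = 0 := by linear_combination -x2
      have y1' : (c i₁ - c i₃) * (C - R) + (c i₂ - c i₃) * (D - S) = 0 := by linear_combination -y1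
      have y2' : (e i₁ - e i₃) * (C - R) + (e i₂ - e i₃) * (D - S) = 1 := by linear_combination -y2
      linear_combination ((e i₁ - e i₃) * (C - R) + (e i₂ - e i₃) * (D - S)) * x1' + y2' -
        ((c i₁ - c i₃) * (C - R) + (c i₂ - c i₃) * (D - S)) * x2')
    (by
      intro s t
      obtain ⟨w, hw⟩ := ha (F s) (F t)
      refine ⟨X w, ?_⟩
      rw [← map_sub, hw]
      simp)
    (by
      intro s t
      obtain ⟨w, hw⟩ := ha (F s) (F t)
      refine ⟨Y w, ?_⟩
      rw [← map_sub, hw]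
      simp)
  have fin : ∀ i k, X (a i) = X (a k) ∧ Y (a i) = Y (a k) → a i = a k := by
    rintro i k ⟨h1, h2⟩
    exact sub_eq_zero.1 (inj _ (by rw [map_sub, h1, sub_self]) (by rw [map_sub, h2, sub_self]))
  exact key.imp (fin _ _) (Or.imp (fin _ _) (fin _ _))

/-- A family constant modulo `2` takes at most two values. -/
theorem two_values (n : ℕ) : ∀ {ι κ L : Type*} [Fintype ι] [Fintype κ] [AddCommGroup L]
    {a : ι → L} {b : κ → L}, IsMatchingBasis 0 a b → (∀ i k, ∃ w, a i - a k = 2 • w) →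
    Fintype.card ι = n + 3 → Fintype.card κ = n + 3 →
    ∀ i₁ i₂ i₃ : ι, a i₁ = a i₂ ∨ a i₂ = a i₃ ∨ a i₃ = a i₁ := by
  induction n with
  | zero =>
    intro ι κ L _ _ _ a b h ha hι hκ
    exact h.two_values_of_card_three (by omega) (by omega) ha
  | succ n ih =>
    intro ι κ L _ _ _ a b h ha hι hκ i₁ i₂ i₃
    classical
    by_contra! hcon
    obtain ⟨h1, h2, h3⟩ := hcon
    obtain ⟨m, hm⟩ : ∃ m, m ∉ ({i₁, i₂, i₃} : Finset ι) := by
      by_contra! hall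
      have h4 := Finset.card_le_card (fun m _ => hall m : Finset.univ ⊆ ({i₁, i₂, i₃} : Finset ι))
      have h5 := Finset.card_le_three (a := i₁) (b := i₂) (c := i₃)
      rw [Finset.card_univ] at h4
      omega
    simp only [Finset.mem_insert, Finset.mem_singleton, not_or] at hm
    obtain ⟨m1, m2, m3⟩ := hm
    -- each nonzero vector is proportional to at most one of the `a m - b j`
    have bad : ∀ v : L, v ≠ 0 →
        (Finset.univ.filter fun j => v ∈ AddSubgroup.zmultiples (a m - b j)).card ≤ 1 := by
      intro v hv
      rw [Finset.card_le_one]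
      intro j hj l hl
      simp only [Finset.mem_filter, Finset.mem_univ, true_and,
        AddSubgroup.mem_zmultiples_iff] at hj hl
      obtain ⟨x, hx⟩ := hj
      obtain ⟨y, hy⟩ := hl
      by_contra hjl
      have := h.not_eq_zero_of_smul_eq (by omega) (by omega) ha m hjl (hx.trans hy.symm)
      rw [this, zero_smul] at hx
      exact hv hx.symm
    -- Each of the three differences is killed by at most one `j`, and there are at least four
    -- choices. A good `j` keeps the three values distinct in the quotient, against the induction
    -- hypothesis.
    obtain ⟨j, hj⟩ : ∃ j, a i₂ - a i₁ ∉ AddSubgroup.zmultiples (a m - b j) ∧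
        a i₃ - a i₂ ∉ AddSubgroup.zmultiples (a m - b j) ∧
        a i₁ - a i₃ ∉ AddSubgroup.zmultiples (a m - b j) := by
      by_contra! hall
      have b1 := bad (a i₂ - a i₁) (_root_.sub_ne_zero.2 h1.symm)
      have b2 := bad (a i₃ - a i₂) (_root_.sub_ne_zero.2 h2.symm)
      have b3 := bad (a i₁ - a i₃) (_root_.sub_ne_zero.2 h3.symm)
      have hsub : (Finset.univ : Finset κ) ⊆
          (Finset.univ.filter fun j => a i₂ - a i₁ ∈ AddSubgroup.zmultiples (a m - b j)) ∪
          ((Finset.univ.filter fun j => a i₃ - a i₂ ∈ AddSubgroup.zmultiples (a m - b j)) ∪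
          (Finset.univ.filter fun j => a i₁ - a i₃ ∈ AddSubgroup.zmultiples (a m - b j))) := by
        intro j _
        simp only [Finset.mem_union, Finset.mem_filter, Finset.mem_univ, true_and]
        by_contra! hno
        exact hno.2.2 (hall j hno.1 hno.2.1)
      have c1 := Finset.card_le_card hsub
      have c2 := Finset.card_union_le
        (Finset.univ.filter fun j => a i₂ - a i₁ ∈ AddSubgroup.zmultiples (a m - b j))
        ((Finset.univ.filter fun j => a i₃ - a i₂ ∈ AddSubgroup.zmultiples (a m - b j)) ∪
          (Finset.univ.filter fun j => a i₁ - a i₃ ∈ AddSubgroup.zmultiples (a m - b j)))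
      have c3 := Finset.card_union_le
        (Finset.univ.filter fun j => a i₃ - a i₂ ∈ AddSubgroup.zmultiples (a m - b j))
        (Finset.univ.filter fun j => a i₁ - a i₃ ∈ AddSubgroup.zmultiples (a m - b j))
      rw [Finset.card_univ] at c1
      omega
    have hq := ih (h.quotient m j) (by
        intro i k
        obtain ⟨w, hw⟩ := ha i k
        refine ⟨w, ?_⟩
        rw [← QuotientAddGroup.mk_sub, hw]
        rfl) (by rw [card_ne]; omega) (by rw [card_ne]; omega) ⟨i₁, fun h => m1 h.symm⟩
        ⟨i₂, fun h => m2 h.symm⟩ ⟨i₃, fun h => m3 h.symm⟩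
    simp only [QuotientAddGroup.eq, neg_add_eq_sub] at hq
    tauto

end IsMatchingBasis

end TorusBiquotient

/-! ### The second family when the first has two values -/

namespace TorusBiquotient

theorem exists_equiv_mem_iff {ι κ : Type*} [Fintype ι] [Fintype κ] [DecidableEq ι] [DecidableEq κ]
    (hc : Fintype.card ι = Fintype.card κ) (I : Finset ι) (J : Finset κ) (h : J.card = I.card) :
    ∃ σ : ι ≃ κ, ∀ i, i ∈ I ↔ σ i ∈ J := by
  let τ := Fintype.equivOfCardEq hc
  have e : {x // x ∈ I} ≃ {x // x ∈ J.map τ.symm.toEmbedding} :=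
    Finset.equivOfCardEq (by simp [h])
  refine ⟨(Equiv.extendSubtype e).trans τ, fun i => ?_⟩
  have h1 := e.extendSubtype_mem i
  have h2 := e.extendSubtype_not_mem i
  simp only [Finset.mem_map_equiv, Equiv.symm_symm] at h1 h2
  exact ⟨h1, fun h => by_contra fun h' => h2 h' h⟩

namespace IsMatchingBasis

variable {ι κ L : Type*} [Fintype ι] [Fintype κ] [AddCommGroup L] {N : ℕ} {a : ι → L} {b : κ → L}

/-- Exchanging the partners of a point of `I` and a point outside of `I` bounds the coordinates. -/
theorem coord_mem [DecidableEq ι] (h : IsMatchingBasis 0 a b) {I : Finset ι} {z : L}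
    (ha : ∀ i, a i = if i ∈ I then (2 : ℤ) • z else 0) {σ : ι ≃ κ} {c : ι → ℤ}
    (hz : z = ∑ i, c i • (a i - b (σ i))) {i k : ι} (hi : i ∈ I) (hk : k ∉ I) :
    c i - c k = 0 ∨ c i - c k = 1 := by
  have hik : i ≠ k := fun h => hk (h ▸ hi)
  obtain ⟨φ, hφ⟩ := h.exists_coord σ i k
  have hφz : φ z = c i - c k := by rw [hz, hφ]
  let τ : ι ≃ κ := (Equiv.swap i k).trans σ
  have hτi : τ i = σ k := by simp [τ]
  have hτk : τ k = σ i := by simp [τ]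
  have hτ : ∀ m, m ≠ i → m ≠ k → τ m = σ m := fun m h1 h2 => by
    simp [τ, Equiv.swap_apply_of_ne_of_ne h1 h2]
  obtain ⟨e, he⟩ := h.span τ (a i - b (σ i))
  have h1 := congrArg φ he
  have hai : φ (a i) = 2 * (c i - c k) := by rw [ha, if_pos hi, map_zsmul, hφz, smul_eq_mul]
  have hak : φ (a k) = 0 := by rw [ha, if_neg hk, map_zero]
  have hbi := coord_sub hφ i
  have hbk := coord_sub hφ k
  rw [map_sum, ← Finset.add_sum_erase _ _ (Finset.mem_univ i),
    ← Finset.add_sum_erase _ _ (Finset.mem_erase.2 ⟨hik.symm, Finset.mem_univ k⟩),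
    Finset.sum_eq_zero (s := (Finset.univ.erase i).erase k), coord_sub hφ, hτi, hτk] at h1
  · simp only [map_zsmul, map_sub, smul_eq_mul, hik, hik.symm, if_true, if_false] at h1 hbi hbk
    -- After the exchange the two altered differences have `φ`-values `±(2 φ z - 1)` and the others
    -- have value `0`. They still span `a i - b (σ i)`, whose value is `1`.
    have h2 : (e i - e k) * (2 * (c i - c k) - 1) = 1 := by
      rw [hai] at h1 hbi
      rw [hak] at h1 hbk
      rw [show φ (b (σ i)) = 2 * (c i - c k) - 1 by linarith,
        show φ (b (σ k)) = 1 by linarith] at h1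
      linarith
    rcases Int.isUnit_iff.1 (IsUnit.of_mul_eq_one_right _ h2) with h3 | h3 <;> omega
  · intro m hm
    simp only [Finset.mem_erase, Finset.mem_univ, and_true] at hm
    rw [map_zsmul, hτ m hm.2 hm.1, coord_sub hφ]
    simp [hm.1, hm.2]

/-- By `coord_mem` the coefficients of `z` take at most two consecutive values, and they matter only
up to a common constant. Hence `z` is the sum of the differences over a set `M`. Under a matching
carrying `I` to `J` that sum is `(2 |M ∩ J| - s) • z`; a sum over a proper nonempty set is
primitive, so the factor is `±1`. -/
theorem exists_subset_sum (h : IsMatchingBasis 0 a b) [DecidableEq ι] [DecidableEq κ]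
    (hc : Fintype.card ι = Fintype.card κ) {I : Finset ι} {z : L}
    (hz : z ≠ 0) (hI : I.Nonempty) (hI' : Iᶜ.Nonempty)
    (ha : ∀ i, a i = if i ∈ I then (2 : ℤ) • z else 0) :
    ∃ (M : Finset κ) (s : ℤ), M.Nonempty ∧ Mᶜ.Nonempty ∧ ∑ j ∈ M, b j = s • z ∧
      ∀ J : Finset κ, J.card = I.card →
        s = 2 * (M ∩ J).card + 1 ∨ s = 2 * (M ∩ J).card - 1 := by
  -- the sum of the differences over `M` for a matching carrying `I` to `J`
  have hM : ∀ (M : Finset κ) (J : Finset κ) (σ : ι ≃ κ), (∀ i, i ∈ I ↔ σ i ∈ J) →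
      ∑ i, (if σ i ∈ M then (1 : ℤ) else 0) • (a i - b (σ i)) =
        (2 * (M ∩ J).card : ℤ) • z - ∑ j ∈ M, b j := by
    intro M J σ hσ
    have h1 : ∀ i, (if σ i ∈ M then (1 : ℤ) else 0) • (a i - b (σ i)) =
        if σ i ∈ M then (if σ i ∈ J then (2 : ℤ) • z else 0) - b (σ i) else 0 := by
      intro i
      rw [ha]
      simp only [hσ]
      split_ifs <;> simp
    simp only [h1]
    rw [Equiv.sum_comp σ (fun j => if j ∈ M then (if j ∈ J then (2 : ℤ) • z else 0) - b j else 0),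
      Finset.sum_ite_mem, Finset.univ_inter, Finset.sum_sub_distrib, Finset.sum_ite_mem,
      Finset.sum_const, mul_comm, mul_smul, natCast_zsmul]
  let σ : ι ≃ κ := Fintype.equivOfCardEq hc
  obtain ⟨c, hcz⟩ := h.span σ z
  obtain ⟨k₀, hk₀⟩ := hI'
  obtain ⟨i₀, hi₀⟩ := hI
  rw [Finset.mem_compl] at hk₀
  have hd : ∀ i k, c i - c k ≤ 1 := by
    intro i k
    by_cases hi : i ∈ I <;> by_cases hk : k ∈ I
    · have := h.coord_mem ha hcz hi hk₀
      have := h.coord_mem ha hcz hk hk₀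
      omega
    · have := h.coord_mem ha hcz hi hk
      omega
    · have := h.coord_mem ha hcz hk hi
      omega
    · have := h.coord_mem ha hcz hi₀ hi
      have := h.coord_mem ha hcz hi₀ hk
      omega
  obtain ⟨m, -, hm⟩ := Finset.exists_min_image Finset.univ c ⟨k₀, Finset.mem_univ _⟩
  -- Subtracting the minimal coefficient `c m` turns `c` into the indicator function of `M`.
  let M : Finset κ := Finset.univ.filter fun j => c (σ.symm j) ≠ c m
  have hcM : ∀ i, c i = c m + if σ i ∈ M then 1 else 0 := by
    intro i
    have h1 := hm i (Finset.mem_univ _)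
    have h2 := hd i m
    simp only [M, Finset.mem_filter, Finset.mem_univ, true_and, Equiv.symm_apply_apply]
    split_ifs with h3 <;> omega
  have hzM : z = ∑ i, (if σ i ∈ M then (1 : ℤ) else 0) • (a i - b (σ i)) := by
    have h1 : z = ∑ i, (c m + if σ i ∈ M then 1 else 0) • (a i - b (σ i)) :=
      hcz.trans (Finset.sum_congr rfl fun i _ => by rw [← hcM])
    simpa only [add_smul, Finset.sum_add_distrib, ← Finset.smul_sum, h.sum_sub, smul_zero,
      zero_add] using h1
  have hMne : M.Nonempty := by
    by_contra hM0
    rw [Finset.not_nonempty_iff_eq_empty] at hM0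
    rw [hM0] at hzM
    exact hz (by simpa using hzM)
  have hs : ∑ j ∈ M, b j = (2 * (M ∩ I.map σ.toEmbedding).card - 1 : ℤ) • z := by
    rw [hM M (I.map σ.toEmbedding) σ (by simp)] at hzM
    rw [sub_smul, one_smul, eq_sub_iff_add_eq, add_comm, ← eq_sub_iff_add_eq]
    exact hzM
  refine ⟨M, 2 * (M ∩ I.map σ.toEmbedding).card - 1, hMne, ⟨σ m, by simp [M]⟩, hs, ?_⟩
  · intro J hJ
    obtain ⟨τ, hτ⟩ := exists_equiv_mem_iff hc I J hJ
    set s : ℤ := 2 * (M ∩ I.map σ.toEmbedding).card - 1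
    have h1 := hM M J τ hτ
    rw [hs, ← sub_smul] at h1
    obtain ⟨e, he⟩ := h.span τ z
    obtain ⟨j, hj⟩ := hMne
    have hm' : σ m ∉ M := by simp [M]
    -- Compare coefficients at a point of `M` and at a point outside it: they show that the integer
    -- factor divides `1`.
    have h2 := h.indep τ
      (fun i => (2 * (M ∩ J).card - s) * e i - (if τ i ∈ M then (1 : ℤ) else 0)) (by
        simp only [sub_smul, mul_smul, Finset.sum_sub_distrib, ← Finset.smul_sum, h1]
        rw [← he]
        simp) (τ.symm j) (τ.symm (σ m))
    simp only [Nat.cast_zero, zero_dvd_iff, Equiv.apply_symm_apply, hj, hm', if_true,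
      if_false] at h2
    have h3 : (2 * (M ∩ J).card - s) * (e (τ.symm j) - e (τ.symm (σ m))) = 1 := by linarith
    rcases Int.isUnit_iff.1 (IsUnit.of_mul_eq_one _ h3) with h4 | h4
    · right; omega
    · left; omega

/-- This supplies the test sets `J`: which sizes of `M ∩ J` occur decides the case distinction in
`exists_relation`. -/
theorem exists_card_inter_eq {κ : Type*} [Fintype κ] [DecidableEq κ] (M : Finset κ) {l r : ℕ}
    (h1 : r ≤ M.card) (h2 : r ≤ l) (h3 : l - r ≤ Fintype.card κ - M.card) :
    ∃ J : Finset κ, J.card = l ∧ (M ∩ J).card = r := by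
  obtain ⟨A, hA, hAc⟩ := Finset.exists_subset_card_eq h1
  obtain ⟨B, hB, hBc⟩ := Finset.exists_subset_card_eq (s := Mᶜ) (n := l - r)
    (by rw [Finset.card_compl]; exact h3)
  have hMB : Disjoint M B := Finset.disjoint_of_subset_right hB disjoint_compl_right
  refine ⟨A ∪ B, ?_, ?_⟩
  · rw [Finset.card_union_of_disjoint (Finset.disjoint_of_subset_left hA hMB), hAc, hBc]
    omega
  · rw [Finset.inter_union_distrib_left, Finset.disjoint_iff_inter_eq_empty.1 hMB,
      Finset.union_empty, Finset.inter_eq_right.2 hA, hAc]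

/-- The classification for a family with exactly two values. -/
theorem exists_relation (h : IsMatchingBasis 0 a b) [DecidableEq ι] [DecidableEq κ]
    (hc : Fintype.card ι = Fintype.card κ) {I : Finset ι} {z : L}
    (hz : z ≠ 0) (hI : I.Nonempty) (hI' : 2 * I.card ≤ Fintype.card ι)
    (ha : ∀ i, a i = if i ∈ I then (2 : ℤ) • z else 0) :
    (I.card = 1 ∧ ∃ M : Finset κ, M.Nonempty ∧ 2 * M.card ≤ Fintype.card κ ∧ ∑ j ∈ M, b j = z) ∨
      ∃ j, b j = z := by
  have hIpos := hI.card_pos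
  have hIc : Iᶜ.Nonempty := by
    rw [← Finset.card_pos, Finset.card_compl]
    omega
  obtain ⟨M, s, hM, hM', hs, H⟩ := h.exists_subset_sum hc hz hI hIc ha
  have hb : ∑ j, b j = (2 * I.card : ℤ) • z := by
    rw [← h.sum_eq, Finset.sum_congr rfl fun i _ => ha i, Finset.sum_ite_mem, Finset.univ_inter,
      Finset.sum_const, mul_comm, mul_smul, natCast_zsmul]
  have hMc := Finset.sum_add_sum_compl M b
  rw [hs, hb] at hMc
  have hMpos := hM.card_pos
  have hMcpos := hM'.card_pos
  have hcard := Finset.card_compl M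
  have H' : ∀ r, r ≤ M.card → r ≤ I.card → I.card - r ≤ Mᶜ.card →
      s = 2 * r + 1 ∨ s = 2 * r - 1 := by
    intro r h1 h2 h3
    obtain ⟨J, hJ, hr⟩ := exists_card_inter_eq M h1 h2 (by omega)
    have := H J hJ
    rwa [hr] at this
  by_cases h1 : I.card = 1
  · left
    refine ⟨h1, ?_⟩
    have h2 := H' 0 (by omega) (by omega) (by omega)
    have h3 := H' 1 (by omega) (by omega) (by omega)
    have hs1 : s = 1 := by omega
    subst hs1
    -- The total of the `b j` is `2 • z`, so `M` and its complement both sum to `z`, and the smaller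
    -- one is taken.
    by_cases hM2 : 2 * M.card ≤ Fintype.card κ
    · exact ⟨M, hM, hM2, by rw [hs, one_smul]⟩
    · refine ⟨Mᶜ, hM', by omega, ?_⟩
      rw [h1, Nat.cast_one, mul_one, two_smul, one_smul] at hMc
      exact add_left_cancel hMc
  right
  by_cases h2 : M.card = 1
  · have h3 := H' 0 (by omega) (by omega) (by omega)
    have h4 := H' 1 (by omega) (by omega) (by omega)
    have hs1 : s = 1 := by omega
    obtain ⟨j, rfl⟩ := Finset.card_eq_one.1 h2
    refine ⟨j, ?_⟩
    rw [Finset.sum_singleton] at hs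
    rw [hs, hs1, one_smul]
  by_cases h3 : Mᶜ.card = 1
  · have h4 := H' (I.card - 1) (by omega) (by omega) (by omega)
    have h5 := H' I.card (by omega) (by omega) (by omega)
    have hs1 : s = 2 * I.card - 1 := by omega
    obtain ⟨j, hj⟩ := Finset.card_eq_one.1 h3
    refine ⟨j, ?_⟩
    rw [hj, Finset.sum_singleton, hs1, sub_smul, one_smul] at hMc
    have : b j = z + ((2 * I.card : ℤ) • z - (2 * I.card : ℤ) • z) := by
      nth_rw 1 [← hMc]
      abel
    rw [this, sub_self, add_zero]
  exfalso
  -- The truncated difference is the smallest possible size of `M ∩ J`. If none of `I`, `M`, `Mᶜ` is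
  -- a singleton, this size plus two also occurs, and no `s` is within one of both doubles.
  have h4 := H' (I.card - Mᶜ.card) (by omega) (by omega) (by omega)
  have h5 := H' (I.card - Mᶜ.card + 2) (by omega) (by omega) (by omega)
  omega

/-- The classification for a nonconstant family which is constant modulo `2`. -/
theorem classification (h : IsMatchingBasis 0 a b) [DecidableEq ι] [DecidableEq κ]
    (hc : Fintype.card ι = Fintype.card κ) (hn : 3 ≤ Fintype.card ι)
    (ha : ∀ i k, ∃ w, a i - a k = 2 • w) (hne : ∃ i k, a i ≠ a k) :
    ∃ (p z : L) (I : Finset ι), I.Nonempty ∧ 2 * I.card ≤ Fintype.card ι ∧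
      (∀ i, a i = p + if i ∈ I then (2 : ℤ) • z else 0) ∧
      ((I.card = 1 ∧ ∃ M : Finset κ, M.Nonempty ∧ 2 * M.card ≤ Fintype.card κ ∧
        ∑ j ∈ M, (b j - p) = z) ∨ ∃ j, b j - p = z) := by
  obtain ⟨i, k, hik⟩ := hne
  obtain ⟨p, q, hpq, hval, I, hI, hIc, hIa⟩ : ∃ p q : L, p ≠ q ∧ (∃ w, q - p = (2 : ℤ) • w) ∧
      ∃ I : Finset ι, I.Nonempty ∧ 2 * I.card ≤ Fintype.card ι ∧
        ∀ i, a i = if i ∈ I then q else p := by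
    have hval : ∀ m, a m = a i ∨ a m = a k := by
      intro m
      rcases two_values (Fintype.card ι - 3) h ha (by omega) (by omega) i k m with h1 | h1 | h1
      · exact absurd h1 hik
      · exact Or.inr h1.symm
      · exact Or.inl h1
    classical
    have hcompl := Finset.card_compl (Finset.univ.filter fun m => a m = a i)
    have hle := Finset.card_le_univ (Finset.univ.filter fun m => a m = a i)
    by_cases hl : 2 * (Finset.univ.filter fun m => a m = a i).card ≤ Fintype.card ι
    · refine ⟨a k, a i, hik.symm, ?_, Finset.univ.filter fun m => a m = a i, ⟨i, by simp⟩, hl, ?_⟩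
      · obtain ⟨w, hw⟩ := ha i k
        exact ⟨w, by rw [hw, two_nsmul, two_zsmul]⟩
      · intro m
        rcases hval m with h1 | h1
        · simp [h1]
        · simp [h1, hik.symm]
    · refine ⟨a i, a k, hik, ?_, (Finset.univ.filter fun m => a m = a i)ᶜ, ⟨k, by simp [hik.symm]⟩,
        by omega, ?_⟩
      · obtain ⟨w, hw⟩ := ha k i
        exact ⟨w, by rw [hw, two_nsmul, two_zsmul]⟩
      · intro m
        rcases hval m with h1 | h1
        · simp [h1]
        · simp [h1, hik.symm]
  obtain ⟨z, hz⟩ := hval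
  have hz0 : z ≠ 0 := by
    rintro rfl
    rw [smul_zero, sub_eq_zero] at hz
    exact hpq hz.symm
  refine ⟨p, z, I, hI, hIc, ?_, ?_⟩
  · intro i
    rw [hIa, ← hz]
    split_ifs <;> simp
  · refine (h.translate hc p).exists_relation hc hz0 hI hIc ?_
    intro i
    rw [hIa, ← hz]
    split_ifs <;> simp

end IsMatchingBasis

end TorusBiquotient

/-! ### Characters of tori and duality -/

namespace TorusBiquotient

open MeasureTheory in
/-- Continuous characters of the circle are powers. -/
theorem exists_zpow_of_continuous (f : Circle →* Circle) (hf : Continuous f) :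
    ∃ n : ℤ, ∀ z, f z = z ^ n := by
  have : Fact (0 < 2 * Real.pi) := ⟨Real.two_pi_pos⟩
  let g : C(AddCircle (2 * Real.pi), ℂ) :=
    ⟨fun x => (f x.toCircle : ℂ), continuous_subtype_val.comp (hf.comp AddCircle.continuous_toCircle)⟩
  have hg : ∀ x, g x = (f x.toCircle : ℂ) := fun _ => rfl
  obtain ⟨n, hn⟩ : ∃ n, fourierCoeff g n ≠ 0 := by
    by_contra! h0
    have h1 := hasSum_fourier_series_of_summable (f := g) (by
      rw [show fourierCoeff g = 0 from funext h0]
      exact summable_zero)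
    simp only [h0, zero_smul] at h1
    have h2 := h1.unique hasSum_zero
    have h3 := congrArg (fun u : C(AddCircle (2 * Real.pi), ℂ) => u 0) h2
    simp [hg] at h3
  refine ⟨n, ?_⟩
  -- Translating the integration variable by `y` multiplies the nonzero `n`-th Fourier coefficient
  -- by this factor.
  have key : ∀ y, (fourier (-n) y * g y : ℂ) = 1 := by
    intro y
    have h1 : fourierCoeff g n = (fourier (-n) y * g y) * fourierCoeff g n := by
      rw [fourierCoeff]
      conv_lhs => rw [← integral_add_right_eq_self _ y]
      rw [← integral_const_mul]
      congr 1
      funext x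
      have : (fourier (-n) (x + y) : ℂ) = fourier (-n) x * fourier (-n) y := by
        simp [fourier_apply, AddCircle.toCircle_add, smul_add]
      rw [this, hg, hg, hg, AddCircle.toCircle_add, map_mul]
      push_cast
      simp only [smul_eq_mul]
      ring
    exact mul_right_cancel₀ hn (h1.symm.trans (one_mul _).symm)
  intro z
  obtain ⟨θ, rfl⟩ := Circle.exp_surjective z
  have h1 := key (θ : AddCircle (2 * Real.pi))
  have hθ : AddCircle.toCircle (θ : AddCircle (2 * Real.pi)) = Circle.exp θ := by
    rw [AddCircle.toCircle_apply_mk, div_self Real.two_pi_pos.ne', one_mul]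
  rw [fourier_apply, hg, hθ, AddCircle.toCircle_zsmul, hθ, ← Circle.coe_mul, Circle.coe_eq_one,
    zpow_neg, inv_mul_eq_one] at h1
  exact h1.symm

variable {k : ℕ}

/-- The character of `(S¹)^k` with weight `v`. -/
noncomputable def chr (v : Fin k → ℤ) : (Fin k → Circle) →* Circle where
  toFun t := ∏ m, t m ^ v m
  map_one' := by simp
  map_mul' s t := by simp [mul_zpow, Finset.prod_mul_distrib]

theorem chr_apply (v : Fin k → ℤ) (t : Fin k → Circle) : chr v t = ∏ m, t m ^ v m := rfl

theorem chr_add (v w : Fin k → ℤ) (t : Fin k → Circle) : chr (v + w) t = chr v t * chr w t := by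
  simp [chr_apply, zpow_add, Finset.prod_mul_distrib]

/-- Evaluation at a point of the torus. -/
noncomputable def evalChr (t : Fin k → Circle) : (Fin k → ℤ) →+ Additive Circle :=
  AddMonoidHom.mk' (fun v => Additive.ofMul (chr v t)) fun v w => by rw [chr_add]; rfl

theorem chr_zero (t : Fin k → Circle) : chr 0 t = 1 := (evalChr t).map_zero

theorem chr_sub (v w : Fin k → ℤ) (t : Fin k → Circle) : chr (v - w) t = chr v t / chr w t :=
  (evalChr t).map_sub v w

theorem chr_zsmul (c : ℤ) (v : Fin k → ℤ) (t : Fin k → Circle) : chr (c • v) t = chr v t ^ c :=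
  (evalChr t).map_zsmul c v

theorem chr_sum {ι : Type*} (s : Finset ι) (v : ι → Fin k → ℤ) (t : Fin k → Circle) :
    chr (∑ i ∈ s, v i) t = ∏ i ∈ s, chr (v i) t :=
  map_sum (evalChr t) v s

theorem exists_chr_of_continuous (f : (Fin k → Circle) →* Circle) (hf : Continuous f) :
    ∃ v, f = chr v := by
  have h : ∀ m, ∃ n : ℤ, ∀ z, f (Pi.mulSingle m z) = z ^ n := fun m =>
    exists_zpow_of_continuous (f.comp (MonoidHom.mulSingle (fun _ => Circle) m))
      (hf.comp (continuous_mulSingle (A := fun _ : Fin k => Circle) m))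
  choose v hv using h
  refine ⟨v, MonoidHom.ext fun t => ?_⟩
  rw [chr_apply, ← Finset.univ_prod_mulSingle t, map_prod]
  refine Finset.prod_congr rfl fun m _ => ?_
  rw [hv, Finset.univ_prod_mulSingle]

theorem exp_chr (v : Fin k → ℤ) (x : Fin k → ℝ) :
    chr v (fun m => Circle.exp (x m)) = Circle.exp (∑ m, v m * x m) := by
  rw [chr_apply]
  have : Circle.exp (∑ m, v m * x m) = ∏ m, Circle.exp (v m * x m) :=
    map_sum Circle.expHom (fun m => (v m : ℝ) * x m) Finset.univ
  rw [this]
  exact Finset.prod_congr rfl fun m _ => (Circle.exp_intCast_mul _ _).symm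

theorem chr_injective {v w : Fin k → ℤ} (h : chr v = chr w) : v = w := by
  rw [← sub_eq_zero]
  by_contra hne
  obtain ⟨m, hm⟩ := Function.ne_iff.1 hne
  -- The angle is chosen so that `chr (v - w)` takes the value `-1` at this point.
  have h1 : chr (v - w) (fun l => Circle.exp (if l = m then Real.pi / (v - w) m else 0)) = 1 := by
    rw [chr_sub, h, div_self']
  rw [exp_chr] at h1
  have h2 : (((v - w) m : ℤ) : ℝ) ≠ 0 := by exact_mod_cast hm
  simp only [mul_ite, mul_zero, Finset.sum_ite_eq', Finset.mem_univ, if_true] at h1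
  rw [mul_div_cancel₀ _ h2] at h1
  exact Circle.exp_pi_ne_one h1

/-- Characters of abstract abelian groups take values in `ℚ/ℤ`; this embedding turns them into
points of the torus. -/
theorem exists_injective_addCircle : ∃ f : AddCircle (1 : ℚ) →+ Additive Circle,
    Function.Injective f := by
  let g : ℚ →+ Additive Circle :=
    Circle.expHom.comp ((AddMonoidHom.mulLeft (2 * Real.pi)).comp (Rat.castHom ℝ).toAddMonoidHom)
  have hg : ∀ q, g q = Additive.ofMul (Circle.exp (2 * Real.pi * q)) := fun _ => rfl
  refine ⟨QuotientAddGroup.lift (AddSubgroup.zmultiples (1 : ℚ)) g ?_, ?_⟩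
  · intro q hq
    obtain ⟨n, rfl⟩ := AddSubgroup.mem_zmultiples_iff.1 hq
    rw [AddMonoidHom.mem_ker, hg]
    have := Circle.exp_two_pi_mul_int n
    simpa using this
  · rw [injective_iff_map_eq_zero]
    intro q hq
    obtain ⟨q, rfl⟩ := QuotientAddGroup.mk_surjective q
    rw [QuotientAddGroup.lift_mk, hg] at hq
    obtain ⟨n, hn⟩ := Circle.exp_eq_one.1 (Additive.ofMul.injective hq)
    rw [QuotientAddGroup.eq_zero_iff, AddSubgroup.mem_zmultiples_iff]
    refine ⟨n, ?_⟩
    rw [mul_comm, mul_left_inj' Real.two_pi_pos.ne'] at hn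
    have : q = n := by exact_mod_cast hn
    simp [this]

/-- Subgroups of the weight lattice are determined by their annihilators in the torus. -/
theorem mem_of_forall_chr_eq_one (M : AddSubgroup (Fin k → ℤ)) {v : Fin k → ℤ}
    (h : ∀ t : Fin k → Circle, (∀ w ∈ M, chr w t = 1) → chr v t = 1) : v ∈ M := by
  by_contra hv
  have hv' : (v : (Fin k → ℤ) ⧸ M) ≠ 0 := by rwa [Ne, QuotientAddGroup.eq_zero_iff]
  obtain ⟨c, hc⟩ := CharacterModule.exists_character_apply_ne_zero_of_ne_zero hv'
  obtain ⟨f, hf⟩ := exists_injective_addCircle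
  let F : (Fin k → ℤ) →+ Additive Circle :=
    f.comp ((c : ((Fin k → ℤ) ⧸ M) →+ AddCircle (1 : ℚ)).comp (QuotientAddGroup.mk' M))
  let t : Fin k → Circle := fun m => (F (Pi.single m 1)).toMul
  have ht : ∀ w, chr w t = (F w).toMul := by
    intro w
    have h1 : w = ∑ m, w m • (Pi.single m 1 : Fin k → ℤ) := by
      ext l
      simp [Finset.sum_apply, Pi.single_apply]
    conv_rhs => rw [h1, map_sum]
    simp only [map_zsmul, chr_apply, t, toMul_sum, toMul_zsmul]
  have h1 := h t (fun w hw => by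
    rw [ht]
    have : (w : (Fin k → ℤ) ⧸ M) = 0 := by rwa [QuotientAddGroup.eq_zero_iff]
    change (f (c (w : (Fin k → ℤ) ⧸ M))).toMul = 1
    rw [this, map_zero, map_zero]
    rfl)
  rw [ht] at h1
  exact hc (hf (by rw [map_zero]; exact h1))

theorem circle_zpow_surjective {n : ℤ} (hn : n ≠ 0) : Function.Surjective fun z : Circle => z ^ n := by
  intro y
  obtain ⟨θ, rfl⟩ := Circle.exp_surjective y
  refine ⟨Circle.exp (θ / n), ?_⟩
  simp only
  rw [← Circle.exp_intCast_mul, mul_div_cancel₀]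
  exact_mod_cast hn

theorem infinite_circle : Infinite Circle := by
  have h1 : Set.InjOn Circle.exp (Set.Ico 0 (2 * Real.pi)) := Circle.exp_injOn_Ico (by simp)
  have h2 := (Set.Ico_infinite Real.two_pi_pos).image h1
  exact Set.infinite_univ_iff.1 (h2.mono (Set.subset_univ _))

/-- If only finitely many points are annihilated by the weights `W`, no cocharacter is. -/
theorem eq_zero_of_finite {ι : Type*} (W : ι → Fin k → ℤ)
    (hW : {t : Fin k → Circle | ∀ i, chr (W i) t = 1}.Finite) (v : Fin k → ℤ)
    (hv : ∀ i, W i ⬝ᵥ v = 0) : v = 0 := by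
  by_contra hne
  obtain ⟨m, hm⟩ := Function.ne_iff.1 hne
  have := infinite_circle
  refine Set.infinite_univ (α := Circle) ((hW.image fun t => t m).subset ?_)
  intro y _
  obtain ⟨s, rfl⟩ := circle_zpow_surjective hm y
  -- The one-parameter subgroup with direction `v` is annihilated by all weights, and its `m`-th
  -- coordinate runs over the whole circle.
  refine ⟨fun l => s ^ v l, fun i => ?_, rfl⟩
  have h1 := hv i
  rw [chr_apply]
  simp only [← zpow_mul]
  rw [dotProduct] at h1
  have h2 : ∀ u : Finset (Fin k), ∏ l ∈ u, s ^ (v l * W i l) = s ^ (∑ l ∈ u, v l * W i l) := by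
    intro u
    induction u using Finset.induction_on with
    | empty => simp
    | insert a u ha ih => rw [Finset.prod_insert ha, Finset.sum_insert ha, zpow_add, ih]
  rw [h2, Finset.sum_congr rfl fun l _ => mul_comm (v l) (W i l), h1, zpow_zero]

/-- An endomorphism of `(S¹)^k` with finite kernel is surjective. -/
theorem exists_chr_eq_of_finite (W : Fin k → Fin k → ℤ)
    (hW : {t : Fin k → Circle | ∀ i, chr (W i) t = 1}.Finite) (y : Fin k → Circle) :
    ∃ t, ∀ i, chr (W i) t = y i := by
  have hdet : (Matrix.of W).det ≠ 0 := by
    intro h0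
    obtain ⟨v, hv, hv0⟩ := Matrix.exists_mulVec_eq_zero_iff.2 h0
    exact hv (eq_zero_of_finite W hW v fun i => congrFun hv0 i)
  have hdet' : ((Matrix.of W).map (Int.castRingHom ℝ)).det ≠ 0 := by
    rw [← RingHom.mapMatrix_apply, ← RingHom.map_det]
    simpa using hdet
  choose θ hθ using fun i => Circle.exp_surjective (y i)
  refine ⟨fun m => Circle.exp ((((Matrix.of W).map (Int.castRingHom ℝ))⁻¹.mulVec θ) m), fun i => ?_⟩
  rw [exp_chr, ← hθ]
  congr 1
  have h1 : ((Matrix.of W).map (Int.castRingHom ℝ)).mulVec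
      (((Matrix.of W).map (Int.castRingHom ℝ))⁻¹.mulVec θ) = θ := by
    rw [Matrix.mulVec_mulVec, Matrix.mul_nonsing_inv _ (Ne.isUnit hdet'), Matrix.one_mulVec]
  exact congrFun h1 i

end TorusBiquotient

/-! ### Simultaneous diagonalization of commuting unitary matrices -/

namespace TorusBiquotient

theorem exists_orthonormalBasis_joint {ι E : Type*} [NormedAddCommGroup E] [InnerProductSpace ℂ E]
    [FiniteDimensional ℂ E] {n : ℕ} (hn : Module.finrank ℂ E = n) (T : ι → E →ₗ[ℂ] E)
    (hT : ∀ i, (T i).IsSymmetric) (hc : ∀ i j, Commute (T i) (T j)) :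
    ∃ (e : OrthonormalBasis (Fin n) ℂ E) (χ : Fin n → ι → ℂ), ∀ m i, T i (e m) = χ m i • e m := by
  classical
  let V : (ι → ℂ) → Submodule ℂ E := fun α => ⨅ j, Module.End.eigenspace (T j) (α j)
  have hV : DirectSum.IsInternal V :=
    LinearMap.IsSymmetric.directSum_isInternal_of_pairwise_commute hT fun i j _ => hc i j
  have hO : OrthogonalFamily ℂ (fun α => V α) fun α => (V α).subtypeₗᵢ :=
    LinearMap.IsSymmetric.orthogonalFamily_iInf_eigenspaces hT
  have hfin : {α | V α ≠ ⊥}.Finite :=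
    WellFoundedGT.finite_ne_bot_of_iSupIndep hV.submodule_iSupIndep
  have : Fintype {α // V α ≠ ⊥} := hfin.fintype
  have hV' : DirectSum.IsInternal fun α : {α // V α ≠ ⊥} => V α :=
    DirectSum.isInternal_ne_bot_iff.2 hV
  have hO' : OrthogonalFamily ℂ (fun α : {α // V α ≠ ⊥} => V α) fun α => (V α).subtypeₗᵢ :=
    hO.comp Subtype.val_injective
  refine ⟨hV'.subordinateOrthonormalBasis hn hO',
    fun m => (hV'.subordinateOrthonormalBasisIndex hn m hO').1, fun m i => ?_⟩
  have h1 := hV'.subordinateOrthonormalBasis_subordinate hn m hO'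
  exact Module.End.mem_eigenspace_iff.1 ((Submodule.mem_iInf _).1 h1 i)

theorem diag_val {n : ℕ} (d : Fin n → Circle) :
    (diag d : Matrix (Fin n) (Fin n) ℂ) = Matrix.diagonal fun i => (d i : ℂ) := rfl

theorem diag_injective {n : ℕ} : Function.Injective (diag : (Fin n → Circle) → U n) := by
  intro d e h
  funext i
  have h1 := congrArg (fun u : U n => (u : Matrix (Fin n) (Fin n) ℂ) i i) h
  simp only [diag_val, Matrix.diagonal_apply_eq] at h1
  exact Circle.ext h1

theorem exists_diag_of_diagonal {n : ℕ} (u : U n) (c : Fin n → ℂ)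
    (h : (u : Matrix (Fin n) (Fin n) ℂ) = Matrix.diagonal c) : ∃ d, u = diag d := by
  have hc : ∀ i, ‖c i‖ = 1 := by
    intro i
    have h1 := Matrix.mem_unitaryGroup_iff.1 u.2
    rw [h, Matrix.star_eq_conjTranspose, Matrix.diagonal_conjTranspose,
      Matrix.diagonal_mul_diagonal] at h1
    have h2 := congrFun (congrFun h1 i) i
    rw [Matrix.diagonal_apply_eq, Matrix.one_apply_eq, Pi.star_apply, Complex.star_def,
      Complex.mul_conj'] at h2
    have h3 : ‖c i‖ ^ 2 = 1 := by exact_mod_cast h2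
    exact (pow_eq_one_iff_of_nonneg (norm_nonneg _) two_ne_zero).1 h3
  have hc' : ∀ i, c i ∈ Submonoid.unitSphere ℂ := fun i => mem_sphere_zero_iff_norm.2 (hc i)
  exact ⟨fun i => ⟨c i, hc' i⟩, Subtype.ext h⟩

/-- A commuting family of unitary matrices is simultaneously diagonalizable. -/
theorem exists_conj_eq_diag {G : Type*} [CommGroup G] {n : ℕ} (ρ : G →* U n) :
    ∃ (P : U n) (d : G →* (Fin n → Circle)), ∀ g, P * ρ g * P⁻¹ = diag (d g) := by
  -- Each unitary `u` is replaced by the Hermitian matrices `u + u*` and `i(u - u*)`. All of these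
  -- commute because `u*` is again in the image of `ρ`; half the first minus `i/2` times the second
  -- recovers `u`.
  let A : G × Bool → Matrix (Fin n) (Fin n) ℂ := fun p =>
    if p.2 then (ρ p.1 : Matrix (Fin n) (Fin n) ℂ) + star (ρ p.1 : Matrix (Fin n) (Fin n) ℂ)
    else Complex.I • ((ρ p.1 : Matrix (Fin n) (Fin n) ℂ) - star (ρ p.1 : Matrix (Fin n) (Fin n) ℂ))
  have hA : ∀ p, (A p).IsHermitian := by
    rintro ⟨g, b⟩
    cases b
    · simp only [A, Matrix.IsHermitian, Bool.false_eq_true, if_false,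
        ← Matrix.star_eq_conjTranspose, star_smul, star_sub, star_star, Complex.star_def,
        Complex.conj_I, neg_smul, ← smul_neg, neg_sub]
    · simp only [A, Matrix.IsHermitian, if_true, ← Matrix.star_eq_conjTranspose, star_add,
        star_star, add_comm]
  have hcomm : ∀ g h, Commute (ρ g : Matrix (Fin n) (Fin n) ℂ) (ρ h) := by
    intro g h
    have : ρ g * ρ h = ρ h * ρ g := by rw [← map_mul, mul_comm, map_mul]
    exact congrArg (fun u : U n => (u : Matrix (Fin n) (Fin n) ℂ)) this
  have hstar : ∀ g, star (ρ g : Matrix (Fin n) (Fin n) ℂ) = ρ g⁻¹ := by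
    intro g
    rw [map_inv]
    rfl
  have hAc : ∀ p q, Commute (A p) (A q) := by
    rintro ⟨g, b⟩ ⟨h, c⟩
    have h1 : ∀ x : Matrix (Fin n) (Fin n) ℂ, (∀ f, Commute (ρ f : Matrix (Fin n) (Fin n) ℂ) x) →
        ∀ p, Commute (A p) x := by
      intro x hx p
      simp only [A, hstar]
      split_ifs
      · exact (hx _).add_left (hx _)
      · exact ((hx _).sub_left (hx _)).smul_left _
    exact h1 _ (fun f => (h1 _ (fun f' => hcomm f' f) _).symm) _
  obtain ⟨e, χ, he⟩ := exists_orthonormalBasis_joint (ι := G × Bool)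
    (E := EuclideanSpace ℂ (Fin n)) (n := n) (by simp) (fun p => Matrix.toEuclideanLin (A p))
    (fun p => Matrix.isSymmetric_toEuclideanLin_iff.2 (hA p)) (fun p q => by
      have := hAc p q
      apply LinearMap.ext
      intro v
      simp only [Module.End.mul_apply, Matrix.toLpLin_apply, Matrix.mulVec_mulVec]
      rw [this.eq])
  let Q : U n := ⟨(EuclideanSpace.basisFun (Fin n) ℂ).toBasis.toMatrix e.toBasis,
    (EuclideanSpace.basisFun (Fin n) ℂ).toMatrix_orthonormalBasis_mem_unitary e⟩
  have hQ : ∀ i j, (Q : Matrix (Fin n) (Fin n) ℂ) i j = e j i := by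
    intro i j
    simp [Q, Module.Basis.toMatrix_apply]
  have key : ∀ g, ∃ d, Q⁻¹ * ρ g * Q = diag d := by
    intro g
    let c : Fin n → ℂ := fun m => (χ m (g, true) - Complex.I * χ m (g, false)) / 2
    refine exists_diag_of_diagonal _ c ?_
    have h1 : (ρ g : Matrix (Fin n) (Fin n) ℂ) = (1 / 2 : ℂ) • (A (g, true) -
        Complex.I • A (g, false)) := by
      simp only [A, if_true, Bool.false_eq_true, if_false, smul_smul, Complex.I_mul_I]
      ext i j
      simp
      ring
    have h2 : (ρ g : Matrix (Fin n) (Fin n) ℂ) * Q = Q * Matrix.diagonal c := by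
      ext i m
      rw [Matrix.mul_diagonal, hQ]
      have h3 : ∀ p, (A p * (Q : Matrix (Fin n) (Fin n) ℂ)) i m = χ m p * e m i := by
        intro p
        have := congrArg (fun v : EuclideanSpace ℂ (Fin n) => v i) (he m p)
        simp only [PiLp.smul_apply, smul_eq_mul, Matrix.toLpLin_apply] at this
        rw [← this, Matrix.mul_apply, Matrix.mulVec, dotProduct]
        simp only [hQ]
      rw [h1, smul_mul_assoc, sub_mul, smul_mul_assoc, Matrix.smul_apply, Matrix.sub_apply,
        Matrix.smul_apply, h3, h3]
      simp only [c, smul_eq_mul]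
      ring
    have h3 : ((Q⁻¹ * ρ g * Q : U n) : Matrix (Fin n) (Fin n) ℂ) =
        star (Q : Matrix (Fin n) (Fin n) ℂ) * ((ρ g : Matrix (Fin n) (Fin n) ℂ) * Q) := by
      rw [← mul_assoc]
      rfl
    rw [h3, h2, ← mul_assoc, Matrix.mem_unitaryGroup_iff'.1 Q.2, one_mul]
  choose d hd using key
  refine ⟨Q⁻¹, MonoidHom.mk' d fun g h => diag_injective ?_, fun g => by
    rw [inv_inv]
    exact hd g⟩
  rw [map_mul, ← hd, ← hd, ← hd, map_mul]
  group

end TorusBiquotient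

/-! ### Fixed points, the ineffective kernel, and freeness of the models -/

namespace TorusBiquotient

variable {n : ℕ}

/-- The inclusion of `SU(n)` into `U(n)`. -/
noncomputable def toU : SU n →* U n :=
  Submonoid.inclusion Matrix.specialUnitaryGroup_le_unitaryGroup

theorem toU_injective : Function.Injective (toU : SU n → U n) :=
  Submonoid.inclusion_injective _

theorem toU_val (s : SU n) : ((toU s : U n) : Matrix (Fin n) (Fin n) ℂ) = s := rfl

theorem toU_act (u : equalDet n) (g : SU n) : toU (act n u g) = u.1.1 * toU g * u.1.2⁻¹ := rfl

theorem toU_inv (s : SU n) : toU s⁻¹ = (toU s)⁻¹ := map_inv toU s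

theorem exists_toU_eq (u : U n) (hu : (u : Matrix (Fin n) (Fin n) ℂ).det = 1) :
    ∃ s : SU n, toU s = u :=
  ⟨⟨u, Matrix.mem_specialUnitaryGroup_iff.2 ⟨u.2, hu⟩⟩, rfl⟩

/-- Scalar unitary matrices. -/
noncomputable def scalar : Circle →* U n :=
  diag.comp (Pi.constMonoidHom (Fin n) Circle)

theorem scalar_eq (c : Circle) : (scalar c : U n) = diag fun _ => c := rfl

theorem scalar_val (c : Circle) : ((scalar c : U n) : Matrix (Fin n) (Fin n) ℂ) = (c : ℂ) • 1 := by
  rw [scalar_eq, diag_val, Matrix.smul_one_eq_diagonal]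

theorem scalar_mul_comm (c : Circle) (u : U n) : scalar c * u = u * scalar c := by
  apply Subtype.ext
  rw [Submonoid.coe_mul, Submonoid.coe_mul, scalar_val, smul_mul_assoc, mul_smul_comm, one_mul,
    mul_one]

theorem scalar_mem_center (c : Circle) : scalar c ∈ Subgroup.center (U n) :=
  Subgroup.mem_center_iff.2 fun u => (scalar_mul_comm c u).symm

theorem norm_det (u : U n) : ‖(u : Matrix (Fin n) (Fin n) ℂ).det‖ = 1 := by
  have h := (Matrix.det_of_mem_unitary u.2).2
  rw [Complex.star_def, Complex.mul_conj'] at h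
  exact (pow_eq_one_iff_of_nonneg (norm_nonneg _) two_ne_zero).1 (by exact_mod_cast h)

/-- Divide by an `n`-th root of the determinant. Since scalars cancel in conjugations, unitary
conjugating matrices may be taken in `SU(n)`. -/
theorem exists_scalar_mul (hn : n ≠ 0) (u : U n) : ∃ (c : Circle) (s : SU n), toU s = scalar c * u := by
  have hd : (u : Matrix (Fin n) (Fin n) ℂ).det ∈ Submonoid.unitSphere ℂ :=
    mem_sphere_zero_iff_norm.2 (norm_det u)
  obtain ⟨c, hc⟩ := circle_zpow_surjective (n := n) (by exact_mod_cast hn)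
    (⟨_, hd⟩ : Circle)⁻¹
  have hc' : (c : ℂ) ^ n * (u : Matrix (Fin n) (Fin n) ℂ).det = 1 := by
    have h1 := congrArg (fun x : Circle => (x : ℂ)) hc
    simp only [zpow_natCast, Circle.coe_pow] at h1
    rw [h1]
    exact inv_mul_cancel₀ (Circle.coe_ne_zero ⟨_, hd⟩)
  obtain ⟨s, hs⟩ := exists_toU_eq (scalar c * u) (by
    rw [Submonoid.coe_mul, scalar_val, smul_mul_assoc, one_mul, Matrix.det_smul, Fintype.card_fin,
      hc'])
  exact ⟨c, s, hs⟩

theorem act_eq_self_iff (u : equalDet n) (g : SU n) :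
    act n u g = g ↔ u.1.1 * toU g = toU g * u.1.2 := by
  rw [← toU_injective.eq_iff, toU_act, mul_inv_eq_iff_eq_mul]

theorem act_eq_one_iff (hn : n ≠ 0) (u : equalDet n) :
    act n u = 1 ↔ u.1.1 = u.1.2 ∧ u.1.1 ∈ Subgroup.center (U n) := by
  constructor
  · intro h
    have h1 : ∀ g : SU n, u.1.1 * toU g = toU g * u.1.2 := fun g => by
      rw [← act_eq_self_iff, h, Equiv.Perm.one_apply]
    have h2 : u.1.1 = u.1.2 := by simpa using h1 1
    refine ⟨h2, Subgroup.mem_center_iff.2 fun v => ?_⟩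
    obtain ⟨c, s, hs⟩ := exists_scalar_mul hn v
    have h3 := h1 s
    rw [← h2, hs, ← mul_assoc, ← scalar_mul_comm, mul_assoc, mul_assoc] at h3
    exact (mul_left_cancel h3).symm
  · rintro ⟨h1, h2⟩
    refine Equiv.ext fun g => ?_
    rw [Equiv.Perm.one_apply, act_eq_self_iff, ← h1]
    exact (Subgroup.mem_center_iff.1 h2 _).symm

/-- Freeness depends only on the group of transformations, hence passes along `Intertwines`. -/
theorem actsFreely_iff (hn : n ≠ 0) (T : Subgroup (equalDet n)) :
    ActsFreely T ↔ ∀ f ∈ T.map (act n), (∃ g, f g = g) → f = 1 := by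
  simp only [ActsFreely, ← act_eq_one_iff hn, Subgroup.mem_map, forall_exists_index, and_imp,
    forall_apply_eq_imp_iff₂]

theorem actsFreely_of_intertwines (hn : n ≠ 0) {F : Equiv.Perm (SU n)}
    {T S : Subgroup (equalDet n)} (h : Intertwines F T S) (hS : ActsFreely S) : ActsFreely T := by
  rw [actsFreely_iff hn] at hS ⊢
  rintro f hf ⟨g, hg⟩
  have h1 := hS (F * f * F⁻¹) (by
    rw [← h]
    exact Subgroup.mem_map.2 ⟨f, hf, rfl⟩) ⟨F g, by simp [hg]⟩
  rw [mul_inv_eq_one] at h1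
  exact mul_left_cancel (h1.trans (mul_one F).symm)

theorem actsFreely_of_actsOnOneSide (hn : n ≠ 0) {T : Subgroup (equalDet n)}
    (h : ActsOnOneSide T) : ActsFreely T := by
  rintro u hu ⟨g, hg⟩
  rw [← act_eq_one_iff hn]
  rcases h with h | h
  · obtain ⟨a, ha⟩ := h u hu
    have h1 : a = 1 := by rw [ha] at hg; exact mul_eq_right.1 hg
    exact Equiv.ext fun g => by rw [ha, h1, one_mul, Equiv.Perm.one_apply]
  · obtain ⟨a, ha⟩ := h u hu
    have h1 : a = 1 := by rw [ha] at hg; exact mul_eq_left.1 hg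
    exact Equiv.ext fun g => by rw [ha, h1, mul_one, Equiv.Perm.one_apply]

/-- Conjugate unitary diagonal matrices have the same entries up to order. -/
theorem exists_perm_of_diag_mul {d e : Fin n → Circle} (g : U n) (h : diag d * g = g * diag e) :
    ∃ σ : Equiv.Perm (Fin n), ∀ j, d (σ j) = e j := by
  have hdet : (g : Matrix (Fin n) (Fin n) ℂ).det ≠ 0 := by
    intro h0
    have := norm_det g
    rw [h0, norm_zero] at this
    exact zero_ne_one this
  rw [Matrix.det_apply] at hdet
  -- A nonzero term of the determinant is a permutation along which no entry of `g` vanishes;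
  -- comparing those entries of the two products equates the eigenvalues.
  obtain ⟨σ, -, hσ⟩ := Finset.exists_ne_zero_of_sum_ne_zero hdet
  refine ⟨σ, fun j => ?_⟩
  have h1 : (g : Matrix (Fin n) (Fin n) ℂ) (σ j) j ≠ 0 := by
    intro h0
    have h2 : ∏ i, (g : Matrix (Fin n) (Fin n) ℂ) (σ i) i = 0 :=
      Finset.prod_eq_zero (Finset.mem_univ j) h0
    exact hσ (by rw [h2, smul_zero])
  have h2 := congrArg (fun u : U n => (u : Matrix (Fin n) (Fin n) ℂ) (σ j) j) h
  simp only [Submonoid.coe_mul, diag_val, Matrix.diagonal_mul, Matrix.mul_diagonal] at h2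
  rw [mul_comm] at h2
  exact Circle.ext (mul_left_cancel₀ h1 h2)

/-- Permutation matrices as unitary matrices. -/
theorem exists_permUnitary (σ : Equiv.Perm (Fin n)) :
    ∃ g : U n, ∀ d : Fin n → Circle, g * diag d * g⁻¹ = diag (d ∘ σ) := by
  have hm : σ.permMatrix ℂ ∈ Matrix.unitaryGroup (Fin n) ℂ := by
    rw [Matrix.mem_unitaryGroup_iff, Matrix.star_eq_conjTranspose, Matrix.conjTranspose_permMatrix,
      ← Matrix.permMatrix_mul, inv_mul_cancel, Matrix.permMatrix_one]
  refine ⟨⟨_, hm⟩, fun d => ?_⟩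
  rw [mul_inv_eq_iff_eq_mul]
  apply Subtype.ext
  ext i j
  simp only [Submonoid.coe_mul, diag_val, Matrix.diagonal_mul, Matrix.mul_diagonal,
    Function.comp_apply, PEquiv.toMatrix_apply, Equiv.toPEquiv_apply, Option.mem_def,
    Option.some.injEq]
  by_cases h : σ i = j
  · simp [h]
  · simp [h]

theorem mem_S₁_iff {ℓ : ℕ} {u : equalDet n} :
    u ∈ S₁ n ℓ ↔ ∃ z w, diag (left₁ n ℓ z) = u.1.1 ∧ diag (right₁ n ℓ z w) = u.1.2 := by
  rw [S₁, Subgroup.mem_subgroupOf, MonoidHom.mem_range]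
  constructor
  · rintro ⟨⟨z, w⟩, h⟩
    exact ⟨z, w, congrArg Prod.fst h, congrArg Prod.snd h⟩
  · rintro ⟨z, w, h1, h2⟩
    exact ⟨(z, w), Prod.ext h1 h2⟩

theorem mem_S₂_iff {ℓ : ℕ} {u : equalDet n} :
    u ∈ S₂ n ℓ ↔ ∃ z w, diag (left₂ n z) = u.1.1 ∧ diag (right₂ n ℓ z w) = u.1.2 := by
  rw [S₂, Subgroup.mem_subgroupOf, MonoidHom.mem_range]
  constructor
  · rintro ⟨⟨z, w⟩, h⟩
    exact ⟨z, w, congrArg Prod.fst h, congrArg Prod.snd h⟩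
  · rintro ⟨z, w, h1, h2⟩
    exact ⟨(z, w), Prod.ext h1 h2⟩

theorem diag_eq_one_of_perm {d e : Fin n → Circle} {σ : Equiv.Perm (Fin n)}
    (hσ : ∀ j, d (σ j) = e j) (hd : ∀ i, d i = 1) :
    diag d = diag e ∧ diag d ∈ Subgroup.center (U n) := by
  have h1 : d = e := funext fun j => by rw [hd, ← hσ, hd]
  refine ⟨by rw [h1], ?_⟩
  rw [show d = 1 from funext hd, map_one]
  exact Subgroup.one_mem _

theorem actsFreely_S₁ (hn : 3 ≤ n) (ℓ : ℕ) : ActsFreely (S₁ n ℓ) := by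
  rintro u hu ⟨g, hg⟩
  obtain ⟨z, w, hL, hR⟩ := mem_S₁_iff.1 hu
  rw [act_eq_self_iff, ← hL, ← hR] at hg
  obtain ⟨σ, hσ⟩ := exists_perm_of_diag_mul _ hg
  rw [← hL, ← hR]
  refine diag_eq_one_of_perm hσ ?_
  have h1 := hσ ⟨n - 1, by omega⟩
  -- The last right entry is `z`, and it has to match a left entry, which is `z ^ 2` or `1`.
  have hz : z = 1 := by
    simp only [left₁, right₁, show ¬ (n - 1 = 0) by omega, show n - 1 + 1 = n by omega, if_false,
      if_true] at h1
    split_ifs at h1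
    · rw [pow_two] at h1
      exact mul_eq_left.1 h1
    · exact h1.symm
  intro i
  simp [left₁, hz]

/-- The relation characteristic of `S₂`. It gives freeness, since any `ℓ` left entries multiply to
`z ^ 2` or `1`, and it restricts the elements counted in part (b). -/
theorem prod_right₂ (hn : 3 ≤ n) {ℓ : ℕ} (h1 : 1 ≤ ℓ) (h2 : 2 * ℓ ≤ n) (z : Circle)
    (w : ℕ → Circle) :
    ∏ j ∈ Finset.univ.filter (fun j : Fin n => (j : ℕ) < ℓ), right₂ n ℓ z w j = z := by
  obtain ⟨m, rfl⟩ : ∃ m, n = m + 1 := ⟨n - 1, by omega⟩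
  obtain ⟨l, rfl⟩ : ∃ l, ℓ = l + 1 := ⟨ℓ - 1, by omega⟩
  rw [Finset.prod_filter, Fin.prod_univ_succ]
  have h3 : ∀ i : Fin m, (if ((i.succ : Fin (m + 1)) : ℕ) < l + 1 then
      right₂ (m + 1) (l + 1) z w i.succ else 1) = if (i : ℕ) < l then w (i + 1) else 1 := by
    intro i
    simp only [Fin.val_succ, add_lt_add_iff_right]
    split_ifs with h
    · simp [right₂, show ¬ ((i : ℕ) + 1 = m) by omega]
    · rfl
  simp only [h3]
  have h4 : ∏ i : Fin m, (if (i : ℕ) < l then w (i + 1) else 1) =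
      ∏ j ∈ Finset.Ico 1 (l + 1), w j := by
    rw [Fin.prod_univ_eq_prod_range (fun i => if i < l then w (i + 1) else 1) m,
      ← Finset.prod_filter, Finset.prod_Ico_eq_prod_range]
    refine Finset.prod_congr ?_ fun j _ => by rw [add_comm]
    ext j
    simp
    omega
  rw [h4]
  simp [right₂]

theorem actsFreely_S₂ (hn : 3 ≤ n) {ℓ : ℕ} (h1 : 1 ≤ ℓ) (h2 : 2 * ℓ ≤ n) :
    ActsFreely (S₂ n ℓ) := by
  rintro u hu ⟨g, hg⟩
  obtain ⟨z, w, hL, hR⟩ := mem_S₂_iff.1 hu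
  rw [act_eq_self_iff, ← hL, ← hR] at hg
  obtain ⟨σ, hσ⟩ := exists_perm_of_diag_mul _ hg
  rw [← hL, ← hR]
  refine diag_eq_one_of_perm hσ ?_
  have hz : z = 1 := by
    have h3 := prod_right₂ hn h1 h2 z w
    rw [Finset.prod_congr rfl fun j _ => (hσ j).symm] at h3
    have h4 : ∀ j, left₂ n z (σ j) = if j = σ.symm ⟨n - 1, by omega⟩ then z ^ 2 else 1 := by
      intro j
      simp only [left₂, Equiv.eq_symm_apply, Fin.ext_iff]
      congr 1
      exact propext ⟨fun h => by omega, fun h => by omega⟩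
    simp only [h4, Finset.prod_ite_eq', Finset.mem_filter, Finset.mem_univ, true_and] at h3
    split_ifs at h3
    · rw [pow_two] at h3
      exact mul_eq_left.1 h3
    · exact h3.symm
  intro i
  simp [left₂, hz]

theorem actsFreely_of_classified (hn : 3 ≤ n) {T : Subgroup (equalDet n)}
    (h : ActsOnOneSide T ∨ ∃ ℓ : ℕ, 1 ≤ ℓ ∧ 2 * ℓ ≤ n ∧
      (IsConjugate T (S₁ n ℓ) ∨ IsConjugate T (S₂ n ℓ))) : ActsFreely T := by
  have hn0 : n ≠ 0 := by omega
  rcases h with h | ⟨ℓ, h1, h2, ⟨a, b, F, -, h⟩ | ⟨a, b, F, -, h⟩⟩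
  · exact actsFreely_of_actsOnOneSide hn0 h
  · exact actsFreely_of_intertwines hn0 h (actsFreely_S₁ hn ℓ)
  · exact actsFreely_of_intertwines hn0 h (actsFreely_S₂ hn h1 h2)

end TorusBiquotient

/-! ### Weights of a torus and the matching condition -/

namespace TorusBiquotient

variable {n k : ℕ}

/-- A parametrization of a torus in `S(U(n) × U(n))` by `(S¹)^k`, diagonal with weights `A`, `B` in
suitable unitary bases. -/
structure IsWeightForm (T : Subgroup (equalDet n)) (P Q : U n) (A B : Fin n → Fin k → ℤ)
    (θ : (Fin k → Circle) →* equalDet n) : Prop where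
  injective : Function.Injective θ
  range : θ.range = T
  left : ∀ t, P * (θ t).1.1 * P⁻¹ = diag fun i => chr (A i) t
  right : ∀ t, Q * (θ t).1.2 * Q⁻¹ = diag fun i => chr (B i) t

theorem exists_weights_of_continuous (ρ : (Fin k → Circle) →* U n) (hρ : Continuous ρ) :
    ∃ (P : U n) (A : Fin n → Fin k → ℤ), ∀ t, P * ρ t * P⁻¹ = diag fun i => chr (A i) t := by
  obtain ⟨P, d, hd⟩ := exists_conj_eq_diag ρ
  have hc : ∀ i, Continuous fun t => d t i := by
    intro i
    refine continuous_induced_rng.2 (show Continuous fun t => ((d t i : Circle) : ℂ) from ?_)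
    have h1 : (fun t => ((d t i : Circle) : ℂ)) =
        fun t => ((P * ρ t * P⁻¹ : U n) : Matrix (Fin n) (Fin n) ℂ) i i := by
      funext t
      rw [hd, diag_val, Matrix.diagonal_apply_eq]
    rw [h1]
    have h2 : Continuous fun t => P * ρ t * P⁻¹ := by fun_prop
    exact (continuous_subtype_val.comp h2).matrix_elem i i
  choose A hA using fun i => exists_chr_of_continuous ((Pi.evalMonoidHom _ i).comp d) (hc i)
  refine ⟨P, A, fun t => ?_⟩
  rw [hd]
  congr 1
  funext i
  rw [← hA]
  rfl

theorem IsTorus.exists_isWeightForm {T : Subgroup (equalDet n)} (hT : IsTorus k T) :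
    ∃ P Q A B θ, IsWeightForm (k := k) T P Q A B θ := by
  obtain ⟨e⟩ := hT
  let θ : (Fin k → Circle) →* equalDet n := T.subtype.comp e.symm.toMulEquiv.toMonoidHom
  have hθ : Continuous θ := continuous_subtype_val.comp e.symm.continuous
  let pL : equalDet n →* U n := (MonoidHom.fst _ _).comp (equalDet n).subtype
  let pR : equalDet n →* U n := (MonoidHom.snd _ _).comp (equalDet n).subtype
  have hpL : Continuous pL := continuous_fst.comp continuous_subtype_val
  have hpR : Continuous pR := continuous_snd.comp continuous_subtype_val
  obtain ⟨P, A, hA⟩ := exists_weights_of_continuous (pL.comp θ) (hpL.comp hθ)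
  obtain ⟨Q, B, hB⟩ := exists_weights_of_continuous (pR.comp θ) (hpR.comp hθ)
  refine ⟨P, Q, A, B, θ, Subtype.val_injective.comp e.symm.injective, ?_, hA, hB⟩
  ext u
  constructor
  · rintro ⟨t, rfl⟩
    exact (e.symm t).2
  · intro hu
    exact ⟨e ⟨u, hu⟩, congrArg Subtype.val (e.symm_apply_apply ⟨u, hu⟩)⟩

theorem det_diag (d : Fin n → Circle) :
    (diag d : Matrix (Fin n) (Fin n) ℂ).det = ((∏ i, d i : Circle) : ℂ) := by
  rw [diag_val, Matrix.det_diagonal]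
  exact (map_prod Circle.coeHom d Finset.univ).symm

theorem det_conj (P u : U n) : ((P * u * P⁻¹ : U n) : Matrix (Fin n) (Fin n) ℂ).det =
    (u : Matrix (Fin n) (Fin n) ℂ).det := by
  have h1 : ((P : Matrix (Fin n) (Fin n) ℂ)).det * ((P⁻¹ : U n) : Matrix (Fin n) (Fin n) ℂ).det = 1 := by
    rw [← Matrix.det_mul, ← Submonoid.coe_mul, mul_inv_cancel, Submonoid.coe_one, Matrix.det_one]
  rw [Submonoid.coe_mul, Submonoid.coe_mul, Matrix.det_mul, Matrix.det_mul]
  linear_combination (u : Matrix (Fin n) (Fin n) ℂ).det * h1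

theorem diag_mul_scalar (c : Circle) (d : Fin n → Circle) :
    (diag fun i => c * d i) = scalar c * diag d := by
  rw [scalar_eq, ← map_mul]
  rfl

namespace IsWeightForm

variable {T : Subgroup (equalDet n)} {P Q : U n} {A B : Fin n → Fin k → ℤ}
  {θ : (Fin k → Circle) →* equalDet n}

theorem sum_eq (h : IsWeightForm T P Q A B θ) : ∑ i, A i = ∑ j, B j := by
  refine chr_injective (MonoidHom.ext fun t => ?_)
  rw [chr_sum, chr_sum]
  apply Circle.ext
  rw [← det_diag, ← det_diag, ← h.left, ← h.right, det_conj, det_conj]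
  exact (θ t).2

/-- A permutation matrix matching the eigenvalues, carried back to the original bases and rescaled
into `SU(n)`, is fixed. -/
theorem exists_fixed (h : IsWeightForm T P Q A B θ) (hn : n ≠ 0) {t : Fin k → Circle}
    (σ : Equiv.Perm (Fin n)) (hσ : ∀ i, chr (A i) t = chr (B (σ i)) t) :
    ∃ g, act n (θ t) g = g := by
  obtain ⟨R, hR⟩ := exists_permUnitary σ
  obtain ⟨c, s, hs⟩ := exists_scalar_mul hn (P⁻¹ * R * Q)
  refine ⟨s, ?_⟩
  rw [act_eq_self_iff, hs]
  have h1 : P * (θ t).1.1 * P⁻¹ = R * (Q * (θ t).1.2 * Q⁻¹) * R⁻¹ := by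
    rw [h.left, h.right, hR]
    congr 1
    funext i
    exact hσ i
  have h2 : (θ t).1.1 * (P⁻¹ * R * Q) = (P⁻¹ * R * Q) * (θ t).1.2 := by
    have h3 : (θ t).1.1 = P⁻¹ * (R * (Q * (θ t).1.2 * Q⁻¹) * R⁻¹) * P := by
      rw [← h1]
      group
    rw [h3]
    group
  rw [← mul_assoc, ← scalar_mul_comm, mul_assoc, h2, ← mul_assoc]

theorem act_eq_one_iff (h : IsWeightForm T P Q A B θ) (hn : n ≠ 0) {t : Fin k → Circle} :
    act n (θ t) = 1 ↔ ∀ i j, chr (A i) t = chr (B j) t := by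
  rw [TorusBiquotient.act_eq_one_iff hn]
  constructor
  · rintro ⟨h1, h2⟩ i j
    have h3 := h.left t
    have h4 := h.right t
    rw [← h1] at h4
    rw [Subgroup.mem_center_iff] at h2
    rw [h2, mul_inv_cancel_right] at h3 h4
    -- the entries of a central diagonal matrix agree
    have h5 : (fun i => chr (A i) t) = fun i => chr (B i) t := diag_injective (h3.symm.trans h4)
    obtain ⟨R, hR⟩ := exists_permUnitary (Equiv.swap i j)
    have h6 := hR fun i => chr (A i) t
    rw [← h3, h2, mul_inv_cancel_right, h3] at h6
    have h7 := congrFun (diag_injective h6) j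
    simp only [Function.comp_apply, Equiv.swap_apply_right] at h7
    rw [← h7]
    exact congrFun h5 j
  · intro h1
    have h0 : 0 < n := Nat.pos_of_ne_zero hn
    have h2 : (fun i => chr (A i) t) = fun _ => chr (A ⟨0, h0⟩) t :=
      funext fun i => (h1 i ⟨0, h0⟩).trans (h1 ⟨0, h0⟩ ⟨0, h0⟩).symm
    have h3 : (fun i => chr (B i) t) = fun _ => chr (A ⟨0, h0⟩) t :=
      funext fun i => (h1 ⟨0, h0⟩ i).symm
    have h4 := h.left t
    have h5 := h.right t
    rw [h2, ← scalar_eq, mul_inv_eq_iff_eq_mul, scalar_mul_comm] at h4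
    rw [h3, ← scalar_eq, mul_inv_eq_iff_eq_mul, scalar_mul_comm] at h5
    rw [mul_left_cancel h4, mul_left_cancel h5]
    exact ⟨rfl, scalar_mem_center _⟩

theorem finite (h : IsWeightForm T P Q A B θ) (hn : n ≠ 0) (hT : HasFiniteKernel T) :
    {t | ∀ i j, chr (A i) t = chr (B j) t}.Finite := by
  refine (hT.preimage h.injective.injOn).subset fun t ht => ?_
  refine ⟨?_, (h.act_eq_one_iff hn).2 ht⟩
  rw [← h.range]
  exact ⟨t, rfl⟩

theorem free (h : IsWeightForm T P Q A B θ) (hn : n ≠ 0) (hT : ActsFreely T) (t : Fin k → Circle)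
    (σ : Equiv.Perm (Fin n)) (hσ : ∀ i, chr (A i) t = chr (B (σ i)) t) :
    ∀ i j, chr (A i) t = chr (B j) t := by
  rw [← h.act_eq_one_iff hn, TorusBiquotient.act_eq_one_iff hn]
  refine hT _ ?_ (h.exists_fixed hn σ hσ)
  rw [← h.range]
  exact ⟨t, rfl⟩

end IsWeightForm

/-- The lattice generated by the differences of two families of weights. -/
def weightLattice (A B : Fin n → Fin k → ℤ) : Submodule ℤ (Fin k → ℤ) :=
  Submodule.span ℤ (Set.range fun p : Fin n × Fin n => A p.1 - B p.2)

theorem sub_mem_weightLattice (A B : Fin n → Fin k → ℤ) (i j : Fin n) :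
    A i - B j ∈ weightLattice A B :=
  Submodule.subset_span ⟨(i, j), rfl⟩

theorem sub_mem_weightLattice_left (A B : Fin n → Fin k → ℤ) (i i' : Fin n) :
    A i - A i' ∈ weightLattice A B := by
  rw [← sub_sub_sub_cancel_right _ _ (B i)]
  exact Submodule.sub_mem _ (sub_mem_weightLattice A B i i) (sub_mem_weightLattice A B i' i)

theorem sub_mem_weightLattice_right (A B : Fin n → Fin k → ℤ) (i j : Fin n) :
    B j - A i ∈ weightLattice A B := by
  rw [← neg_sub]
  exact Submodule.neg_mem _ (sub_mem_weightLattice A B i j)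

/-- The weights of a free torus action of maximal rank, in coordinates centred at `A i₀`. -/
theorem isMatchingBasis_weights {A B : Fin n → Fin k → ℤ} (hn : 3 ≤ n) (hk : k + 1 = n)
    (hsum : ∑ i, A i = ∑ j, B j) (hfin : {t | ∀ i j, chr (A i) t = chr (B j) t}.Finite)
    (hfree : ∀ t (σ : Equiv.Perm (Fin n)), (∀ i, chr (A i) t = chr (B (σ i)) t) →
      ∀ i j, chr (A i) t = chr (B j) t) (i₀ : Fin n) :
    IsMatchingBasis (L := weightLattice A B) 0
      (fun i => ⟨A i - A i₀, sub_mem_weightLattice_left A B i i₀⟩)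
      (fun j => ⟨B j - A i₀, sub_mem_weightLattice_right A B i₀ j⟩) := by
  have hspan : ∀ σ : Equiv.Perm (Fin n), ∀ v ∈ weightLattice A B,
      ∃ c : Fin n → ℤ, ∑ i, c i • (A i - B (σ i)) = v := by
    intro σ v hv
    rw [← Submodule.mem_span_range_iff_exists_fun]
    -- By duality it suffices to test on points `t` annihilated by all `A i - B (σ i)`. Freeness
    -- makes such `t` act trivially, so `t` annihilates the whole weight lattice.
    refine mem_of_forall_chr_eq_one
      (Submodule.span ℤ (Set.range fun i => A i - B (σ i))).toAddSubgroup fun t ht => ?_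
    have h1 := hfree t σ fun i => by
      have := ht _ (Submodule.subset_span ⟨i, rfl⟩)
      rwa [chr_sub, div_eq_one] at this
    refine Submodule.span_induction ?_ ?_ ?_ ?_ hv
    · rintro _ ⟨p, rfl⟩
      rw [chr_sub, div_eq_one]
      exact h1 _ _
    · exact chr_zero t
    · intro x y _ _ hx hy
      rw [chr_add, hx, hy, mul_one]
    · intro c x _ hx
      rw [chr_zsmul, hx, one_zpow]
  refine ⟨?_, fun σ v => ?_, fun σ c hc i l => ?_⟩
  · apply Subtype.ext
    simp only [AddSubmonoidClass.coe_finsetSum, Finset.sum_sub_distrib, hsum]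
  · obtain ⟨c, hc⟩ := hspan σ v v.2
    refine ⟨c, Subtype.ext ?_⟩
    rw [← hc]
    simp
  · have hc' : ∑ i, c i • (A i - B (σ i)) = 0 := by
      have := congrArg Subtype.val hc
      simpa [AddSubmonoidClass.coe_finsetSum] using this
    have hs : ∑ i, (A i - B (σ i)) = 0 := by
      rw [Finset.sum_sub_distrib, Equiv.sum_comp σ, hsum, sub_self]
    rw [Nat.cast_zero, zero_dvd_iff]
    by_contra hne
    -- drop the row `i`; the remaining square matrix is singular
    let e : Fin k ≃ {m // m ≠ i} := Fintype.equivOfCardEq (by simp; omega)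
    let W : Fin k → Fin k → ℤ := fun r => A (e r) - B (σ (e r))
    have hli : l ≠ i := fun h => hne (by rw [h, sub_self])
    -- Subtracting `c i` times the relation `∑ (A m - B (σ m)) = 0` removes the row `i` from the
    -- given relation.
    have hrel : ∑ r, (c (e r) - c i) • W r = 0 := by
      have h1 : ∑ m, (c m - c i) • (A m - B (σ m)) = 0 := by
        simp only [sub_smul, Finset.sum_sub_distrib, ← Finset.smul_sum] at hc' ⊢
        rw [hc', ← Finset.sum_sub_distrib, hs, smul_zero, sub_zero]
      rw [Fintype.sum_eq_add_sum_subtype_ne _ i, sub_self, zero_smul, zero_add] at h1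
      rw [← h1]
      exact Equiv.sum_comp e (fun m : {m // m ≠ i} => (c m - c i) • (A m - B (σ m)))
    have hdet : (Matrix.of W).det = 0 := by
      refine Matrix.exists_vecMul_eq_zero_iff.1 ⟨fun r => c (e r) - c i, ?_, ?_⟩
      · intro h0
        have := congrFun h0 (e.symm ⟨l, hli⟩)
        simp only [Equiv.apply_symm_apply, Pi.zero_apply] at this
        omega
      · rw [← hrel]
        ext m
        simp [Matrix.vecMul, dotProduct, Finset.sum_apply]
    obtain ⟨v, hv, hv0⟩ := Matrix.exists_mulVec_eq_zero_iff.2 hdet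
    have h2 : ∀ m, (A m - B (σ m)) ⬝ᵥ v = 0 := by
      have h3 : ∀ m, m ≠ i → (A m - B (σ m)) ⬝ᵥ v = 0 := by
        intro m hm
        have := congrFun hv0 (e.symm ⟨m, hm⟩)
        simp only [Matrix.mulVec, W, Matrix.of_apply, Equiv.apply_symm_apply, Pi.zero_apply] at this
        exact this
      intro m
      by_cases hm : m = i
      · subst hm
        rw [Fintype.sum_eq_add_sum_subtype_ne _ m] at hs
        rw [eq_neg_of_add_eq_zero_left hs, neg_dotProduct, sum_dotProduct, Finset.sum_eq_zero,
          neg_zero]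
        exact fun m' _ => h3 m' m'.2
      · exact h3 m hm
    -- The vector `v` is orthogonal to the rows of one matching, hence to all differences of
    -- weights, and would generate an infinite ineffective kernel.
    refine hv (eq_zero_of_finite (fun p : Fin n × Fin n => A p.1 - B p.2) ?_ v ?_)
    · refine hfin.subset fun t ht i j => ?_
      have := ht (i, j)
      rwa [chr_sub, div_eq_one] at this
    · rintro ⟨p, q⟩
      obtain ⟨c', hc'⟩ := hspan σ (A p - B q) (sub_mem_weightLattice A B p q)
      simp only
      rw [← hc', sum_dotProduct]
      exact Finset.sum_eq_zero fun m _ => by rw [smul_dotProduct, h2, smul_zero]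

end TorusBiquotient

/-! ### From weights to the normal forms -/

namespace TorusBiquotient

variable {n k : ℕ}

/-- The torus with weights `A`, `B` is, up to scalars, the torus of all pairs
`(diag (l z), diag (r z w))`. -/
def Realizes (A B : Fin n → Fin k → ℤ) (l : Circle → Fin n → Circle)
    (r : Circle → (ℕ → Circle) → Fin n → Circle) : Prop :=
  (∀ t, ∃ c z w, (∀ i, chr (A i) t = c * l z i) ∧ ∀ j, chr (B j) t = c * r z w j) ∧
    ∀ z w, ∃ t c, (∀ i, chr (A i) t = c * l z i) ∧ ∀ j, chr (B j) t = c * r z w j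

theorem intertwines_of_forall {F : Equiv.Perm (SU n)} {T S : Subgroup (equalDet n)}
    {X : Type*} {θ : X → equalDet n} (hθ : ∀ u, u ∈ T ↔ ∃ x, θ x = u)
    (h₁ : ∀ x, ∃ v ∈ S, ∀ g, F (act n (θ x) g) = act n v (F g))
    (h₂ : ∀ v ∈ S, ∃ x, ∀ g, F (act n (θ x) g) = act n v (F g)) : Intertwines F T S := by
  have key : ∀ x v, (∀ g, F (act n (θ x) g) = act n v (F g)) →
      MulAut.conj F (act n (θ x)) = act n v := by
    intro x v h
    rw [MulAut.conj_apply, mul_inv_eq_iff_eq_mul]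
    exact Equiv.ext h
  ext f
  simp only [Subgroup.mem_map, exists_exists_and_eq_and]
  constructor
  · rintro ⟨u, hu, rfl⟩
    obtain ⟨x, rfl⟩ := (hθ u).1 hu
    obtain ⟨v, hv, h⟩ := h₁ x
    exact ⟨v, hv, (key x v h).symm⟩
  · rintro ⟨v, hv, rfl⟩
    obtain ⟨x, h⟩ := h₂ v hv
    exact ⟨θ x, (hθ _).2 ⟨x, rfl⟩, key x v h⟩

theorem scalar_cancel (c : Circle) (X Y Z : U n) :
    (scalar c * X) * Y * (scalar c * Z)⁻¹ = X * Y * Z⁻¹ := by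
  have h1 : (scalar c * X) * Y * (scalar c * Z)⁻¹ = scalar c * (X * Y * Z⁻¹) * (scalar c)⁻¹ := by
    group
  rw [h1, mul_inv_eq_iff_eq_mul, scalar_mul_comm]

theorem exists_conj_scalar (hn : n ≠ 0) {X : Type*} {ρ : X → U n} {α : X → Fin n → Circle} {P : U n}
    (h : ∀ x, P * ρ x * P⁻¹ = diag (α x)) (π : Equiv.Perm (Fin n)) :
    ∃ s : SU n, ∀ x, toU s * ρ x * (toU s)⁻¹ = diag (α x ∘ π) := by
  obtain ⟨R, hR⟩ := exists_permUnitary π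
  obtain ⟨c, s, hs⟩ := exists_scalar_mul hn (R * P)
  refine ⟨s, fun x => ?_⟩
  rw [hs, scalar_cancel, ← hR, ← h]
  group

namespace IsWeightForm

variable {T : Subgroup (equalDet n)} {P Q : U n} {A B : Fin n → Fin k → ℤ}
  {θ : (Fin k → Circle) →* equalDet n} {S : Subgroup (equalDet n)}
  {l : Circle → Fin n → Circle} {r : Circle → (ℕ → Circle) → Fin n → Circle}

theorem isConjugate (h : IsWeightForm T P Q A B θ) (hn : n ≠ 0)
    (hS : ∀ u : equalDet n, u ∈ S ↔ ∃ z w, diag (l z) = u.1.1 ∧ diag (r z w) = u.1.2)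
    (hS' : ∀ z w, (diag (l z), diag (r z w)) ∈ equalDet n) (π ρ : Equiv.Perm (Fin n))
    (hR : Realizes (A ∘ π) (B ∘ ρ) l r) : IsConjugate T S := by
  obtain ⟨s, hs⟩ := exists_conj_scalar hn h.left π
  obtain ⟨q, hq⟩ := exists_conj_scalar hn h.right ρ
  let F : Equiv.Perm (SU n) := (Equiv.mulLeft s).trans (Equiv.mulRight q⁻¹)
  have hF : ∀ g, F g = s * g * q⁻¹ := fun _ => rfl
  refine ⟨s, q⁻¹, F, Or.inl hF, ?_⟩
  have key : ∀ t c z w, (∀ i, chr ((A ∘ π) i) t = c * l z i) →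
      (∀ j, chr ((B ∘ ρ) j) t = c * r z w j) →
      ∀ g, F (act n (θ t) g) = act n ⟨_, hS' z w⟩ (F g) := by
    intro t c z w h1 h2 g
    apply toU_injective
    have h3 : toU s * (θ t).1.1 * (toU s)⁻¹ = scalar c * diag (l z) := by
      rw [hs, ← diag_mul_scalar]
      exact congrArg _ (funext h1)
    have h4 : toU q * (θ t).1.2 * (toU q)⁻¹ = scalar c * diag (r z w) := by
      rw [hq, ← diag_mul_scalar]
      exact congrArg _ (funext h2)
    rw [hF, hF, map_mul, map_mul, toU_act, toU_act, map_mul, map_mul, toU_inv]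
    simp only
    rw [← scalar_cancel c (diag (l z)), ← h3, ← h4]
    group
  refine intertwines_of_forall (θ := θ) (fun u => by rw [← h.range]; rfl) ?_ ?_
  · intro t
    obtain ⟨c, z, w, h1, h2⟩ := hR.1 t
    exact ⟨_, (hS _).2 ⟨z, w, rfl, rfl⟩, key t c z w h1 h2⟩
  · intro v hv
    obtain ⟨z, w, h1, h2⟩ := (hS v).1 hv
    obtain ⟨t, c, h3, h4⟩ := hR.2 z w
    have : v = ⟨_, hS' z w⟩ := Subtype.ext (Prod.ext h1.symm h2.symm)
    exact ⟨t, by rw [this]; exact key t c z w h3 h4⟩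

theorem isConjugate_swap (h : IsWeightForm T P Q A B θ) (hn : n ≠ 0)
    (hS : ∀ u : equalDet n, u ∈ S ↔ ∃ z w, diag (l z) = u.1.1 ∧ diag (r z w) = u.1.2)
    (hS' : ∀ z w, (diag (l z), diag (r z w)) ∈ equalDet n) (π ρ : Equiv.Perm (Fin n))
    (hR : Realizes (B ∘ π) (A ∘ ρ) l r) : IsConjugate T S := by
  obtain ⟨s, hs⟩ := exists_conj_scalar hn h.right π
  obtain ⟨q, hq⟩ := exists_conj_scalar hn h.left ρ
  let F : Equiv.Perm (SU n) :=
    ((Equiv.inv (SU n)).trans (Equiv.mulLeft s)).trans (Equiv.mulRight q⁻¹)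
  have hF : ∀ g, F g = s * g⁻¹ * q⁻¹ := fun _ => rfl
  refine ⟨s, q⁻¹, F, Or.inr hF, ?_⟩
  have key : ∀ t c z w, (∀ i, chr ((B ∘ π) i) t = c * l z i) →
      (∀ j, chr ((A ∘ ρ) j) t = c * r z w j) →
      ∀ g, F (act n (θ t) g) = act n ⟨_, hS' z w⟩ (F g) := by
    intro t c z w h1 h2 g
    apply toU_injective
    have h3 : toU s * (θ t).1.2 * (toU s)⁻¹ = scalar c * diag (l z) := by
      rw [hs, ← diag_mul_scalar]
      exact congrArg _ (funext h1)
    have h4 : toU q * (θ t).1.1 * (toU q)⁻¹ = scalar c * diag (r z w) := by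
      rw [hq, ← diag_mul_scalar]
      exact congrArg _ (funext h2)
    rw [hF, hF, map_mul, map_mul, toU_inv, toU_act, toU_act, map_mul, map_mul, toU_inv, toU_inv]
    simp only
    rw [← scalar_cancel c (diag (l z)), ← h3, ← h4]
    group
  refine intertwines_of_forall (θ := θ) (fun u => by rw [← h.range]; rfl) ?_ ?_
  · intro t
    obtain ⟨c, z, w, h1, h2⟩ := hR.1 t
    exact ⟨_, (hS _).2 ⟨z, w, rfl, rfl⟩, key t c z w h1 h2⟩
  · intro v hv
    obtain ⟨z, w, h1, h2⟩ := (hS v).1 hv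
    obtain ⟨t, c, h3, h4⟩ := hR.2 z w
    have : v = ⟨_, hS' z w⟩ := Subtype.ext (Prod.ext h1.symm h2.symm)
    exact ⟨t, by rw [this]; exact key t c z w h3 h4⟩

theorem eq_scalar_of_const {X : U n} {Y : U n} {c : Circle} (h : X * Y * X⁻¹ = diag fun _ => c) :
    Y = scalar c := by
  rw [mul_inv_eq_iff_eq_mul, ← scalar_eq, scalar_mul_comm] at h
  exact mul_left_cancel h

theorem actsOnOneSide_of_left (h : IsWeightForm T P Q A B θ) (hA : ∀ i k, A i = A k) :
    ActsOnOneSide T := by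
  right
  intro u hu
  rw [← h.range] at hu
  obtain ⟨t, rfl⟩ := hu
  refine ⟨act n (θ t) 1, fun g => toU_injective ?_⟩
  rcases Nat.eq_zero_or_pos n with rfl | h0
  · exact Subsingleton.elim _ _
  have h1 : (θ t).1.1 = scalar (chr (A ⟨0, h0⟩) t) := by
    refine eq_scalar_of_const ((h.left t).trans ?_)
    congr 1
    funext i
    rw [hA i ⟨0, h0⟩]
  rw [map_mul, toU_act, toU_act, h1, map_one, mul_one, scalar_mul_comm, mul_assoc]

theorem actsOnOneSide_of_right (h : IsWeightForm T P Q A B θ) (hB : ∀ i k, B i = B k) :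
    ActsOnOneSide T := by
  left
  intro u hu
  rw [← h.range] at hu
  obtain ⟨t, rfl⟩ := hu
  refine ⟨act n (θ t) 1, fun g => toU_injective ?_⟩
  rcases Nat.eq_zero_or_pos n with rfl | h0
  · exact Subsingleton.elim _ _
  have h1 : (θ t).1.2 = scalar (chr (B ⟨0, h0⟩) t) := by
    refine eq_scalar_of_const ((h.right t).trans ?_)
    congr 1
    funext i
    rw [hB i ⟨0, h0⟩]
  rw [map_mul, toU_act, toU_act, h1, map_one, mul_one, ← map_inv, mul_assoc, mul_assoc,
    scalar_mul_comm]

end IsWeightForm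

/-- Only surjectivity onto the parameters needs an argument. A point where `z` and `w 1, …, w (n -
2)` are trivial has all its eigenvalues equal, so these `k` weights define an endomorphism of the
torus with finite kernel. -/
theorem realizes_of_forall (hk : k + 1 = n) (hk0 : 0 < k) {A B : Fin n → Fin k → ℤ}
    (hfin : {t | ∀ i j, chr (A i) t = chr (B j) t}.Finite) (p z : Fin k → ℤ) (w : ℕ → Fin k → ℤ)
    {l : Circle → Fin n → Circle} {r : Circle → (ℕ → Circle) → Fin n → Circle}
    (hA : ∀ t i, chr (A i) t = chr p t * l (chr z t) i)
    (hB : ∀ t j, chr (B j) t = chr p t * r (chr z t) (fun m => chr (w m) t) j)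
    (hl : ∀ i, l 1 i = 1) (hr : ∀ j, r 1 1 j = 1)
    (hw : ∀ z w w', (∀ m, 1 ≤ m → m + 1 < n → w m = w' m) → r z w = r z w') :
    Realizes A B l r := by
  refine ⟨fun t => ⟨_, _, _, hA t, hB t⟩, fun z' w' => ?_⟩
  -- The unused index `0` of `w` holds the weight `z`, which makes the system square.
  let W : Fin k → Fin k → ℤ := fun m => if (m : ℕ) = 0 then z else w m
  have hW : ∀ (t : Fin k → Circle) (z' : Circle) (w' : ℕ → Circle),
      (∀ m : Fin k, chr (W m) t = if (m : ℕ) = 0 then z' else w' m) →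
      (∀ i, chr (A i) t = chr p t * l z' i) ∧ ∀ j, chr (B j) t = chr p t * r z' w' j := by
    intro t z' w' h
    have hz : chr z t = z' := by simpa [W] using h ⟨0, hk0⟩
    have hwm : ∀ m, 1 ≤ m → m + 1 < n → chr (w m) t = w' m := by
      intro m h1 h2
      simpa [W, show m ≠ 0 by omega] using h ⟨m, by omega⟩
    refine ⟨fun i => by rw [hA, hz], fun j => ?_⟩
    rw [hB, hz, hw z' _ w' hwm]
  obtain ⟨t, ht⟩ := exists_chr_eq_of_finite W (hfin.subset fun t ht i j => by
    obtain ⟨h1, h2⟩ := hW t 1 1 fun m => by rw [ht m]; simp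
    rw [h1, h2, hl, hr]) fun m => if (m : ℕ) = 0 then z' else w' m
  exact ⟨t, chr p t, hW t z' w' ht⟩

theorem right₁_congr {ℓ : ℕ} (z : Circle) {w w' : ℕ → Circle}
    (h : ∀ m, 1 ≤ m → m + 1 < n → w m = w' m) : right₁ n ℓ z w = right₁ n ℓ z w' := by
  funext i
  have h1 : ∏ j ∈ Finset.Ico 1 (n - 1), (w j)⁻¹ = ∏ j ∈ Finset.Ico 1 (n - 1), (w' j)⁻¹ :=
    Finset.prod_congr rfl fun j hj => by
      rw [Finset.mem_Ico] at hj
      rw [h j (by omega) (by omega)]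
  simp only [right₁, h1]
  have hi := i.2
  split_ifs
  · rfl
  · rfl
  · rw [h i (by omega) (by omega)]
  · rw [h i (by omega) (by omega)]

theorem right₂_congr {ℓ : ℕ} (h1 : 1 ≤ ℓ) (h2 : 2 * ℓ ≤ n) (z : Circle) {w w' : ℕ → Circle}
    (h : ∀ m, 1 ≤ m → m + 1 < n → w m = w' m) : right₂ n ℓ z w = right₂ n ℓ z w' := by
  funext i
  have h3 : ∏ j ∈ Finset.Ico 1 ℓ, (w j)⁻¹ = ∏ j ∈ Finset.Ico 1 ℓ, (w' j)⁻¹ :=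
    Finset.prod_congr rfl fun j hj => by
      rw [Finset.mem_Ico] at hj
      rw [h j (by omega) (by omega)]
  have h4 : ∏ j ∈ Finset.Ico ℓ (n - 1), (w j)⁻¹ = ∏ j ∈ Finset.Ico ℓ (n - 1), (w' j)⁻¹ :=
    Finset.prod_congr rfl fun j hj => by
      rw [Finset.mem_Ico] at hj
      rw [h j (by omega) (by omega)]
  simp only [right₂, h3, h4]
  have hi := i.2
  split_ifs
  · rfl
  · rfl
  · rw [h i (by omega) (by omega)]

theorem prod_left₁_eq {ℓ : ℕ} (hn : 3 ≤ n) (h1 : 1 ≤ ℓ) (h2 : 2 * ℓ ≤ n) (z : Circle)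
    (w : ℕ → Circle) : ∏ i, left₁ n ℓ z i = ∏ i, right₁ n ℓ z w i := by
  apply Circle.ext
  rw [← det_diag, ← det_diag]
  exact torusHom₁_mem hn h1 h2 (z, w)

theorem prod_left₂_eq {ℓ : ℕ} (hn : 3 ≤ n) (h1 : 1 ≤ ℓ) (h2 : 2 * ℓ ≤ n) (z : Circle)
    (w : ℕ → Circle) : ∏ i, left₂ n z i = ∏ i, right₂ n ℓ z w i := by
  apply Circle.ext
  rw [← det_diag, ← det_diag]
  exact torusHom₂_mem hn h1 h2 (z, w)

/-- The entries of the models that contain products of the `w̄` are not checked directly: they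
follow from the remaining entries and a known product. -/
theorem eq_of_prod_eq {ι : Type*} {s : Finset ι} {f g : ι → Circle} {a : ι} (ha : a ∈ s)
    (h : ∀ i ∈ s, i ≠ a → f i = g i) (hp : ∏ i ∈ s, f i = ∏ i ∈ s, g i) : f a = g a := by
  classical
  rw [← Finset.mul_prod_erase s f ha, ← Finset.mul_prod_erase s g ha,
    Finset.prod_congr rfl fun i hi => h i (Finset.mem_of_mem_erase hi) (Finset.ne_of_mem_erase hi)]
    at hp
  exact mul_right_cancel hp

theorem card_filter_lt {ℓ : ℕ} (h : ℓ ≤ n) :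
    (Finset.univ.filter fun i : Fin n => (i : ℕ) < ℓ).card = ℓ := by
  rw [Fin.card_filter_val_lt, min_eq_right h]

/-- Weights of the first type realize `S₁`. -/
theorem exists_realizes_S₁ (hn : 3 ≤ n) (hk : k + 1 = n) {A B : Fin n → Fin k → ℤ}
    (hsum : ∑ i, A i = ∑ j, B j)
    (hfin : {t | ∀ i j, chr (A i) t = chr (B j) t}.Finite) {p z : Fin k → ℤ} {I : Finset (Fin n)}
    (hI : I.Nonempty) (hI' : 2 * I.card ≤ n)
    (hA : ∀ i, A i = p + if i ∈ I then (2 : ℤ) • z else 0) {j₀ : Fin n} (hj₀ : B j₀ - p = z) :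
    ∃ π ρ : Equiv.Perm (Fin n),
      Realizes (A ∘ π) (B ∘ ρ) (left₁ n I.card) (right₁ n I.card) := by
  have h1 : 1 ≤ I.card := hI.card_pos
  obtain ⟨π, hπ⟩ := exists_equiv_mem_iff (ι := Fin n) (κ := Fin n) rfl
    (Finset.univ.filter fun i : Fin n => (i : ℕ) < I.card) I (card_filter_lt (by omega)).symm
  obtain ⟨ρ, hρ⟩ := exists_equiv_apply_eq (ι := Fin n) (κ := Fin n) rfl ⟨n - 1, by omega⟩ j₀
  simp only [Finset.mem_filter, Finset.mem_univ, true_and] at hπ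
  -- Read off from the middle entries of the model by solving for `w m`. The value at index `0` and
  -- those beyond `n - 2` play no role.
  let w : ℕ → Fin k → ℤ := fun m => if hm : m < n then
    B (ρ ⟨m, hm⟩) - p - (if m < I.card then (2 : ℤ) • z else 0) else 0
  have hAt : ∀ t i, chr ((A ∘ π) i) t = chr p t * left₁ n I.card (chr z t) i := by
    intro t i
    simp only [Function.comp_apply, hA, left₁, chr_add, ← hπ]
    split_ifs
    · rw [chr_zsmul, zpow_ofNat]
    · rw [chr_zero]
  have hBt' : ∀ t (j : Fin n), (j : ℕ) ≠ 0 → chr ((B ∘ ρ) j) t =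
      chr p t * right₁ n I.card (chr z t) (fun m => chr (w m) t) j := by
    intro t j hj
    simp only [right₁, if_neg hj, Function.comp_apply]
    by_cases hjn : (j : ℕ) + 1 = n
    · have hj' : j = ⟨n - 1, by omega⟩ := Fin.ext (by simp; omega)
      rw [if_pos hjn, hj', hρ, ← hj₀, chr_sub, mul_div_cancel]
    · rw [if_neg hjn]
      simp only [w, j.2, dif_pos, Fin.eta]
      split_ifs
      · rw [chr_sub, chr_sub, chr_zsmul, zpow_ofNat, mul_div_cancel, mul_div_cancel]
      · rw [sub_zero, chr_sub, mul_div_cancel]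
  have hBt : ∀ t j, chr ((B ∘ ρ) j) t =
      chr p t * right₁ n I.card (chr z t) (fun m => chr (w m) t) j := by
    intro t j
    by_cases hj : (j : ℕ) = 0
    · refine eq_of_prod_eq (f := fun j => chr ((B ∘ ρ) j) t) (g := fun j => chr p t *
        right₁ n I.card (chr z t) (fun m => chr (w m) t) j) (Finset.mem_univ j) (fun i _ hi =>
          hBt' t i fun h => hi (Fin.ext (h.trans hj.symm))) ?_
      rw [Finset.prod_mul_distrib, ← prod_left₁_eq hn h1 hI', ← Finset.prod_mul_distrib,
        ← Finset.prod_congr rfl fun i _ => hAt t i]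
      simp only [Function.comp_apply]
      rw [Equiv.prod_comp ρ (fun j => chr (B j) t), Equiv.prod_comp π (fun j => chr (A j) t),
        ← chr_sum, ← chr_sum, hsum]
    · exact hBt' t j hj
  refine ⟨π, ρ, realizes_of_forall hk (by omega) (hfin.subset fun t ht i j => ?_) p z w hAt hBt
    (fun i => by simp [left₁]) (fun j => by simp [right₁]) fun z w w' h => right₁_congr z h⟩
  have := ht (π.symm i) (ρ.symm j)
  simpa using this

/-- Weights of the second type realize `S₂`. -/
theorem exists_realizes_S₂ (hn : 3 ≤ n) (hk : k + 1 = n) {A B : Fin n → Fin k → ℤ}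
    (hsum : ∑ i, A i = ∑ j, B j)
    (hfin : {t | ∀ i j, chr (A i) t = chr (B j) t}.Finite) {p z : Fin k → ℤ} {i₀ : Fin n}
    (hA : ∀ i, A i = p + if i = i₀ then (2 : ℤ) • z else 0) {M : Finset (Fin n)}
    (hM : M.Nonempty) (hM' : 2 * M.card ≤ n) (hMz : ∑ j ∈ M, (B j - p) = z) :
    ∃ π ρ : Equiv.Perm (Fin n),
      Realizes (A ∘ π) (B ∘ ρ) (fun z => left₂ n z) (right₂ n M.card) := by
  have h1 : 1 ≤ M.card := hM.card_pos
  obtain ⟨ρ, hρ⟩ := exists_equiv_mem_iff (ι := Fin n) (κ := Fin n) rfl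
    (Finset.univ.filter fun i : Fin n => (i : ℕ) < M.card) M (card_filter_lt (by omega)).symm
  obtain ⟨π, hπ⟩ := exists_equiv_apply_eq (ι := Fin n) (κ := Fin n) rfl ⟨n - 1, by omega⟩ i₀
  simp only [Finset.mem_filter, Finset.mem_univ, true_and] at hρ
  let w : ℕ → Fin k → ℤ := fun m => if hm : m < n then B (ρ ⟨m, hm⟩) - p else 0
  have hAt : ∀ t i, chr ((A ∘ π) i) t = chr p t * left₂ n (chr z t) i := by
    intro t i
    have hi : π i = i₀ ↔ (i : ℕ) + 1 = n := by
      rw [← hπ, π.injective.eq_iff, Fin.ext_iff]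
      simp only
      omega
    simp only [Function.comp_apply, hA, left₂, chr_add, hi]
    split_ifs
    · rw [chr_zsmul, zpow_ofNat]
    · rw [chr_zero]
  have hBt' : ∀ t (j : Fin n), (j : ℕ) ≠ 0 → (j : ℕ) + 1 ≠ n → chr ((B ∘ ρ) j) t =
      chr p t * right₂ n M.card (chr z t) (fun m => chr (w m) t) j := by
    intro t j hj hjn
    simp only [right₂, if_neg hj, if_neg hjn, Function.comp_apply, w, j.2, dif_pos, Fin.eta]
    rw [chr_sub, mul_div_cancel]
  have hBt'' : ∀ t (j : Fin n), (j : ℕ) = 0 → chr ((B ∘ ρ) j) t =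
      chr p t * right₂ n M.card (chr z t) (fun m => chr (w m) t) j := by
    intro t j hj
    -- The entry at `0` comes from the sum over `M`, which `ρ` places in the first positions. The
    -- last entry will then come from equality of determinants.
    refine eq_of_prod_eq (f := fun j => chr ((B ∘ ρ) j) t) (g := fun j => chr p t *
        right₂ n M.card (chr z t) (fun m => chr (w m) t) j)
        (s := Finset.univ.filter fun i : Fin n => (i : ℕ) < M.card) (by simp; omega)
        (fun i hi hij => hBt' t i (fun h => hij (Fin.ext (h.trans hj.symm))) (by
          simp only [Finset.mem_filter, Finset.mem_univ, true_and] at hi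
          omega)) ?_
    rw [Finset.prod_mul_distrib, prod_right₂ hn h1 hM', Finset.prod_const,
      card_filter_lt (by omega)]
    have h3 : ∏ j ∈ Finset.univ.filter (fun i : Fin n => (i : ℕ) < M.card), chr ((B ∘ ρ) j) t =
        ∏ j ∈ M, chr (B j) t :=
      Finset.prod_equiv ρ (by simp [hρ]) (fun _ _ => rfl)
    rw [h3, ← hMz, chr_sum]
    simp only [chr_sub]
    rw [Finset.prod_div_distrib, Finset.prod_const, mul_div_cancel]
  have hBt : ∀ t j, chr ((B ∘ ρ) j) t =
      chr p t * right₂ n M.card (chr z t) (fun m => chr (w m) t) j := by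
    intro t j
    by_cases hj : (j : ℕ) + 1 = n
    · refine eq_of_prod_eq (f := fun j => chr ((B ∘ ρ) j) t) (g := fun j => chr p t *
        right₂ n M.card (chr z t) (fun m => chr (w m) t) j) (Finset.mem_univ j) (fun i _ hi => ?_) ?_
      · by_cases hi0 : (i : ℕ) = 0
        · exact hBt'' t i hi0
        · exact hBt' t i hi0 fun h => hi (Fin.ext (by omega))
      rw [Finset.prod_mul_distrib, ← prod_left₂_eq hn h1 hM', ← Finset.prod_mul_distrib,
        ← Finset.prod_congr rfl fun i _ => hAt t i]
      simp only [Function.comp_apply]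
      rw [Equiv.prod_comp ρ (fun j => chr (B j) t), Equiv.prod_comp π (fun j => chr (A j) t),
        ← chr_sum, ← chr_sum, hsum]
    · by_cases hj0 : (j : ℕ) = 0
      · exact hBt'' t j hj0
      · exact hBt' t j hj0 hj
  refine ⟨π, ρ, realizes_of_forall hk (by omega) (hfin.subset fun t ht i j => ?_) p z w hAt hBt
    (fun i => by simp [left₂]) (fun j => by simp [right₂]) fun z w w' h => right₂_congr h1 hM' z h⟩
  have := ht (π.symm i) (ρ.symm j)
  simpa using this

/-- The weights of a free torus action whose left weights agree modulo `2`. -/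
theorem exists_realizes (hn : 3 ≤ n) (hk : k + 1 = n) {A B : Fin n → Fin k → ℤ}
    (hsum : ∑ i, A i = ∑ j, B j)
    (hfin : {t | ∀ i j, chr (A i) t = chr (B j) t}.Finite) {L : Submodule ℤ (Fin k → ℤ)}
    {q : Fin k → ℤ} {a b : Fin n → L} (ha : ∀ i, (a i : Fin k → ℤ) = A i - q)
    (hb : ∀ j, (b j : Fin k → ℤ) = B j - q) (h : IsMatchingBasis 0 a b)
    (heven : ∀ i k, ∃ w, a i - a k = 2 • w) (hne : ∃ i k, A i ≠ A k) :
    ∃ ℓ : ℕ, 1 ≤ ℓ ∧ 2 * ℓ ≤ n ∧ ∃ π ρ : Equiv.Perm (Fin n),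
      Realizes (A ∘ π) (B ∘ ρ) (left₁ n ℓ) (right₁ n ℓ) ∨
      Realizes (A ∘ π) (B ∘ ρ) (fun z => left₂ n z) (right₂ n ℓ) := by
  obtain ⟨i, i', hii⟩ := hne
  obtain ⟨p, z, I, hI, hI', hA, hcase⟩ := h.classification rfl (by simpa using hn) heven
    ⟨i, i', fun e => hii (by
      have := congrArg Subtype.val e
      rw [ha, ha] at this
      exact sub_left_injective this)⟩
  rw [Fintype.card_fin] at hI'
  have hA' : ∀ i, A i = (q + p) + if i ∈ I then (2 : ℤ) • (z : Fin k → ℤ) else 0 := by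
    intro i
    have h1 := congrArg Subtype.val (hA i)
    rw [ha, sub_eq_iff_eq_add] at h1
    rw [h1]
    split_ifs <;> simp <;> abel
  rcases hcase with ⟨h1, M, hM, hM', hMz⟩ | ⟨j, hj⟩
  · obtain ⟨i₀, rfl⟩ := Finset.card_eq_one.1 h1
    rw [Fintype.card_fin] at hM'
    obtain ⟨π, ρ, hR⟩ := exists_realizes_S₂ hn hk hsum hfin (p := q + p) (z := z) (i₀ := i₀)
      (fun i => by rw [hA']; simp) hM hM' (by
        rw [← hMz, AddSubmonoidClass.coe_finsetSum]
        refine Finset.sum_congr rfl fun j _ => ?_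
        rw [Submodule.coe_sub, hb]
        abel)
    exact ⟨M.card, hM.card_pos, hM', π, ρ, Or.inr hR⟩
  · obtain ⟨π, ρ, hR⟩ := exists_realizes_S₁ hn hk hsum hfin (p := q + p) (z := z) hI hI' hA'
      (j₀ := j) (by
        rw [← hj, Submodule.coe_sub, hb]
        abel)
    exact ⟨I.card, hI.card_pos, hI', π, ρ, Or.inl hR⟩

theorem classified_of_actsFreely (hn : 3 ≤ n) {T : Subgroup (equalDet n)} (hT : IsTorus (n - 1) T)
    (hK : HasFiniteKernel T) (hfree : ActsFreely T) :
    ActsOnOneSide T ∨ ∃ ℓ : ℕ, 1 ≤ ℓ ∧ 2 * ℓ ≤ n ∧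
      (IsConjugate T (S₁ n ℓ) ∨ IsConjugate T (S₂ n ℓ)) := by
  have hn0 : n ≠ 0 := by omega
  obtain ⟨P, Q, A, B, θ, h⟩ := hT.exists_isWeightForm
  have hk : n - 1 + 1 = n := by omega
  have hfin := h.finite hn0 hK
  have hbasis := isMatchingBasis_weights hn hk h.sum_eq hfin (h.free hn0 hfree) ⟨0, by omega⟩
  by_cases hA : ∀ i k, A i = A k
  · exact Or.inl (h.actsOnOneSide_of_left hA)
  by_cases hB : ∀ i k, B i = B k
  · exact Or.inl (h.actsOnOneSide_of_right hB)
  push Not at hA hB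
  right
  rcases hbasis.even_left_or_even_right rfl (by simpa using hn) with he | he
  · obtain ⟨ℓ, h1, h2, π, ρ, hR | hR⟩ := exists_realizes hn hk h.sum_eq hfin (fun _ => rfl)
      (fun _ => rfl) hbasis he hA
    · exact ⟨ℓ, h1, h2, Or.inl (h.isConjugate hn0 (fun u => mem_S₁_iff)
        (fun z w => torusHom₁_mem hn h1 h2 (z, w)) π ρ hR)⟩
    · exact ⟨ℓ, h1, h2, Or.inr (h.isConjugate hn0 (fun u => mem_S₂_iff)
        (fun z w => torusHom₂_mem hn h1 h2 (z, w)) π ρ hR)⟩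
  -- When the right weights agree modulo 2, the roles of the sides are exchanged and the conjugating
  -- map involves `g ↦ g⁻¹`.
  · have hfin' : {t | ∀ i j, chr (B i) t = chr (A j) t}.Finite :=
      hfin.subset fun t ht i j => (ht j i).symm
    obtain ⟨ℓ, h1, h2, π, ρ, hR | hR⟩ := exists_realizes hn hk h.sum_eq.symm hfin' (fun _ => rfl)
      (fun _ => rfl) hbasis.symm he hB
    · exact ⟨ℓ, h1, h2, Or.inl (h.isConjugate_swap hn0 (fun u => mem_S₁_iff)
        (fun z w => torusHom₁_mem hn h1 h2 (z, w)) π ρ hR)⟩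
    · exact ⟨ℓ, h1, h2, Or.inr (h.isConjugate_swap hn0 (fun u => mem_S₂_iff)
        (fun z w => torusHom₂_mem hn h1 h2 (z, w)) π ρ hR)⟩

end TorusBiquotient

/-! ### Displacement functions and elements of order three -/

namespace TorusBiquotient

variable {n : ℕ}

theorem sum_norm_sq_mul_unitary (M : Matrix (Fin n) (Fin n) ℂ) (u : U n) :
    ∑ i, ∑ j, ‖(M * (u : Matrix (Fin n) (Fin n) ℂ)) i j‖ ^ 2 = ∑ i, ∑ j, ‖M i j‖ ^ 2 := by
  have key : ∀ (A : Matrix (Fin n) (Fin n) ℂ) i,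
      ((∑ j, ‖A i j‖ ^ 2 : ℝ) : ℂ) = (A * A.conjTranspose) i i := by
    intro A i
    rw [Matrix.mul_apply]
    push_cast
    refine Finset.sum_congr rfl fun j _ => ?_
    rw [Matrix.conjTranspose_apply, Complex.star_def, Complex.mul_conj']
  refine Finset.sum_congr rfl fun i _ => ?_
  apply Complex.ofReal_injective
  have h : M * (u : Matrix (Fin n) (Fin n) ℂ) *
      (M * (u : Matrix (Fin n) (Fin n) ℂ)).conjTranspose = M * M.conjTranspose := by
    rw [Matrix.conjTranspose_mul, Matrix.mul_assoc, ← Matrix.mul_assoc _ _ M.conjTranspose,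
      ← Matrix.star_eq_conjTranspose (u : Matrix (Fin n) (Fin n) ℂ),
      Matrix.mem_unitaryGroup_iff.1 u.2, Matrix.one_mul]
  rw [key, key, h]

theorem sum_norm_sq_unitary_mul (u : U n) (M : Matrix (Fin n) (Fin n) ℂ) :
    ∑ i, ∑ j, ‖((u : Matrix (Fin n) (Fin n) ℂ) * M) i j‖ ^ 2 = ∑ i, ∑ j, ‖M i j‖ ^ 2 := by
  have h := sum_norm_sq_mul_unitary M.conjTranspose u⁻¹
  rw [Matrix.UnitaryGroup.inv_val, Matrix.star_eq_conjTranspose, ← Matrix.conjTranspose_mul] at h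
  simp only [Matrix.conjTranspose_apply, norm_star] at h
  rw [Finset.sum_comm, h, Finset.sum_comm]

/-- The squared distance by which `f` moves `g`. -/
noncomputable def displacement (f : Equiv.Perm (SU n)) (g : SU n) : ℝ :=
  ∑ i, ∑ j, ‖(f g).1 i j - g.1 i j‖ ^ 2

theorem displacement_act (u : equalDet n) (g : SU n) :
    displacement (act n u) g = ∑ i, ∑ j, ‖((u.1.1 : Matrix (Fin n) (Fin n) ℂ) *
      (g : Matrix (Fin n) (Fin n) ℂ) - (g : Matrix (Fin n) (Fin n) ℂ) * u.1.2) i j‖ ^ 2 := by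
  have h : (g : Matrix (Fin n) (Fin n) ℂ) * u.1.2 *
      (((u.1.2)⁻¹ : U n) : Matrix (Fin n) (Fin n) ℂ) = g := by
    rw [Matrix.mul_assoc, ← Submonoid.coe_mul, mul_inv_cancel, Submonoid.coe_one, Matrix.mul_one]
  rw [← sum_norm_sq_mul_unitary _ (u.1.2)⁻¹, Matrix.sub_mul, h]
  rfl

theorem sum_norm_sq_diag_sub (d e : Fin n → Circle) :
    ∑ i, ∑ j, ‖(((diag d : U n) : Matrix (Fin n) (Fin n) ℂ) - (diag e : U n)) i j‖ ^ 2 =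
      ∑ i, ‖(d i : ℂ) - e i‖ ^ 2 := by
  refine Finset.sum_congr rfl fun i _ => ?_
  rw [Finset.sum_eq_single i, Matrix.sub_apply, diag_val, diag_val, Matrix.diagonal_apply_eq,
    Matrix.diagonal_apply_eq]
  · intro j _ hj
    rw [Matrix.sub_apply, diag_val, diag_val, Matrix.diagonal_apply_ne _ hj.symm,
      Matrix.diagonal_apply_ne _ hj.symm, sub_zero, norm_zero, zero_pow two_ne_zero]
  · simp

/-- Displacement of an element that conjugates the right factor to a diagonal matrix. -/
theorem displacement_of_conj {u : equalDet n} {g : SU n} {d e : Fin n → Circle}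
    (hd : u.1.1 = diag d) (he : toU g * u.1.2 = diag e * toU g) :
    displacement (act n u) g = ∑ i, ‖(d i : ℂ) - e i‖ ^ 2 := by
  have h := congrArg (fun x : U n => (x : Matrix (Fin n) (Fin n) ℂ)) he
  simp only [Submonoid.coe_mul, toU_val] at h
  rw [displacement_act, h, hd, ← Matrix.sub_mul, ← toU_val g, sum_norm_sq_mul_unitary,
    sum_norm_sq_diag_sub]

theorem displacement_of_right {u : equalDet n} {e : Fin n → Circle}
    (hd : u.1.1 = 1) (he : u.1.2 = diag e) (g : SU n) :
    displacement (act n u) g = ∑ i, ‖(1 : ℂ) - e i‖ ^ 2 := by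
  have h := sum_norm_sq_diag_sub (1 : Fin n → Circle) e
  rw [← sum_norm_sq_unitary_mul (toU g)] at h
  simp only [Pi.one_apply, Circle.coe_one] at h
  rw [displacement_act, hd, he, ← h, Matrix.mul_sub, map_one, Submonoid.coe_one, Matrix.one_mul,
    Matrix.mul_one, toU_val]

/-- The elements of order dividing `3` of the transformation group of `T` that move every point by
the squared distance `6`. -/
def cliffordSix (T : Subgroup (equalDet n)) : Set (Equiv.Perm (SU n)) :=
  {f | f ∈ T.map (act n) ∧ f ^ 3 = 1 ∧ ∀ g, displacement f g = 6}

theorem conj_mem_cliffordSix {F : Equiv.Perm (SU n)} {T S : Subgroup (equalDet n)}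
    (hF : IsFrobeniusIsometry F) (h : Intertwines F T S) {f : Equiv.Perm (SU n)}
    (hf : f ∈ cliffordSix T) : MulAut.conj F f ∈ cliffordSix S := by
  obtain ⟨h1, h2, h3⟩ := hf
  refine ⟨?_, by rw [← map_pow, h2, map_one], fun g => ?_⟩
  · rw [← h]
    exact Subgroup.mem_map.2 ⟨f, h1, rfl⟩
  · obtain ⟨x, rfl⟩ := F.surjective g
    rw [← h3 x]
    refine Eq.trans ?_ (hF (f x) x)
    simp [displacement, MulAut.conj_apply]

theorem add_add_one_of_pow_three {x : ℂ} (h : x ^ 3 = 1) (h1 : x ≠ 1) : x ^ 2 + x + 1 = 0 := by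
  have : (x - 1) * (x ^ 2 + x + 1) = 0 := by linear_combination h
  exact (mul_eq_zero.1 this).resolve_left (sub_ne_zero.2 h1)

-- The reason for working with order three: distinct cube roots of unity are all equally far apart,
-- so a squared displacement between diagonal matrices counts the differing entries.
open scoped Classical in
theorem norm_sub_sq_of_pow_three {x y : Circle} (hx : x ^ 3 = 1) (hy : y ^ 3 = 1) :
    ‖(x : ℂ) - y‖ ^ 2 = if x = y then 0 else 3 := by
  split_ifs with h
  · simp [h]
  have h1 : ‖(x : ℂ) - y‖ = ‖((x / y : Circle) : ℂ) - 1‖ := by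
    rw [Circle.coe_div, div_sub_one y.coe_ne_zero, norm_div, Circle.norm_coe, div_one]
  have h2 : (x / y) ^ 3 = 1 := by rw [div_pow, hx, hy, div_one]
  have h3 : x / y ≠ 1 := fun h3 => h (div_eq_one.1 h3)
  rw [h1]
  generalize x / y = u at h2 h3
  have h4 : (u : ℂ) ^ 3 = 1 := by exact_mod_cast congrArg (fun t : Circle => (t : ℂ)) h2
  have h5 := add_add_one_of_pow_three h4 (fun h => h3 (Circle.ext h))
  have h6 : (starRingEnd ℂ) (u : ℂ) = (u : ℂ) ^ 2 := by
    rw [← Circle.coe_inv_eq_conj, Circle.coe_inv]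
    exact inv_eq_of_mul_eq_one_right (by linear_combination h4)
  apply Complex.ofReal_injective
  push_cast
  rw [← Complex.mul_conj', map_sub, h6, map_one]
  linear_combination h4 - h5

theorem exists_cubeRoot : ∃ ω : Circle, ω ^ 3 = 1 ∧ ω ≠ 1 := by
  refine ⟨Circle.exp (2 * Real.pi / 3), ?_, fun h => ?_⟩
  · rw [← Circle.exp_nsmul]
    convert Circle.exp_two_pi using 2
    simp
    ring
  · have h1 := (Circle.exp_eq_one).1 h
    obtain ⟨m, hm⟩ := h1
    have hpi := Real.pi_ne_zero
    have h2 : (1 : ℝ) = 3 * m := by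
      field_simp at hm
      linarith
    have h3 : (1 : ℤ) = 3 * m := by exact_mod_cast h2
    omega

theorem eq_or_eq_inv_of_pow_three {ω x : Circle} (hω : ω ^ 3 = 1) (hω1 : ω ≠ 1) (hx : x ^ 3 = 1)
    (hx1 : x ≠ 1) : x = ω ∨ x = ω⁻¹ := by
  have c1 : (ω : ℂ) ^ 3 = 1 := by exact_mod_cast congrArg (fun t : Circle => (t : ℂ)) hω
  have c2 : (x : ℂ) ^ 3 = 1 := by exact_mod_cast congrArg (fun t : Circle => (t : ℂ)) hx
  have c3 := add_add_one_of_pow_three c1 (fun h => hω1 (Circle.ext h))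
  have c4 := add_add_one_of_pow_three c2 (fun h => hx1 (Circle.ext h))
  have h : ((x : ℂ) - ω) * (x - ω ^ 2) = 0 := by linear_combination c4 - x * c3 + c1
  rcases mul_eq_zero.1 h with h | h
  · exact Or.inl (Circle.ext (sub_eq_zero.1 h))
  · refine Or.inr (eq_inv_of_mul_eq_one_left (Circle.ext ?_))
    rw [Circle.coe_mul, sub_eq_zero.1 h, Circle.coe_one]
    linear_combination c1

/-- The vector with entries `ω` at `a`, `ω⁻¹` at `b` and `1` elsewhere. -/
noncomputable def rootVector (ω : Circle) (p : Fin n × Fin n) : Fin n → Circle :=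
  Pi.mulSingle p.1 ω * Pi.mulSingle p.2 ω⁻¹

theorem prod_rootVector (ω : Circle) (p : Fin n × Fin n) : ∏ i, rootVector ω p i = 1 := by
  simp only [rootVector, Pi.mul_apply, Finset.prod_mul_distrib, Finset.prod_pi_mulSingle',
    Finset.mem_univ, if_true, mul_inv_cancel]

/-- Right multiplication by the inverse of `diag (rootVector ω p)`. -/
noncomputable def rootElement (ω : Circle) (p : Fin n × Fin n) : equalDet n :=
  ⟨(diag 1, diag (rootVector ω p)), mem_equalDet_diag _ _ (by
    rw [prod_rootVector]
    exact Finset.prod_const_one)⟩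

theorem rootVector_apply_fst {ω : Circle} {a b : Fin n} (h : a ≠ b) :
    rootVector ω (a, b) a = ω := by
  simp [rootVector, h]

theorem rootVector_apply_snd {ω : Circle} {a b : Fin n} (h : a ≠ b) :
    rootVector ω (a, b) b = ω⁻¹ := by
  simp [rootVector, h.symm]

theorem rootVector_apply_of_ne {ω : Circle} {a b i : Fin n} (ha : i ≠ a) (hb : i ≠ b) :
    rootVector ω (a, b) i = 1 := by
  simp [rootVector, ha, hb]

theorem act_rootElement_injOn (hn : n ≠ 0) {ω : Circle} (hω : ω ^ 3 = 1) (hω1 : ω ≠ 1) :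
    Set.InjOn (fun p => act n (rootElement ω p)) {p : Fin n × Fin n | p.1 ≠ p.2} := by
  rintro ⟨a, b⟩ hab ⟨c, d⟩ hcd h
  simp only [Set.mem_ofPred_eq] at hab hcd
  have h1 : act n ((rootElement ω (a, b))⁻¹ * rootElement ω (c, d)) = 1 := by
    rw [map_mul, map_inv, inv_mul_eq_one]
    exact h
  have h2 := ((act_eq_one_iff hn _).1 h1).1
  have h3 : (diag (rootVector ω (a, b)))⁻¹ * diag (rootVector ω (c, d)) = 1 := by
    refine h2.symm.trans ?_
    exact inv_mul_cancel _
  have h4 := diag_injective (inv_mul_eq_one.1 h3)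
  have hωinv : ω ≠ ω⁻¹ := fun e => hω1 (by
    have e2 : ω * ω = 1 := eq_inv_iff_mul_eq_one.1 e
    rwa [pow_succ, pow_two, e2, one_mul] at hω)
  have hac : a = c := by
    by_contra hac
    have h5 := congrFun h4 a
    rw [rootVector_apply_fst hab] at h5
    by_cases had : a = d
    · rw [had, rootVector_apply_snd hcd] at h5
      exact hωinv h5
    · rw [rootVector_apply_of_ne hac had] at h5
      exact hω1 h5
  subst hac
  have hbd : b = d := by
    by_contra hbd
    have h5 := congrFun h4 b
    rw [rootVector_apply_snd hab, rootVector_apply_of_ne hab.symm hbd] at h5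
    exact hω1 (inv_eq_one.1 h5)
  rw [hbd]

/-- At `z = 1` the torus `S₁` acts by right translations with an arbitrary diagonal matrix of
determinant one whose last entry is `1`. For any two distinct positions other than the last, it
therefore contains the corresponding root elements. -/
theorem exists_right₁_eq (hn : 3 ≤ n) {ℓ : ℕ} (h1 : 1 ≤ ℓ) (h2 : 2 * ℓ ≤ n) {d : Fin n → Circle}
    (hd : ∏ i, d i = 1) (hd' : ∀ i : Fin n, (i : ℕ) + 1 = n → d i = 1) :
    ∃ w, right₁ n ℓ 1 w = d := by
  let w : ℕ → Circle := fun m => if hm : m < n then d ⟨m, hm⟩ else 1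
  have hw : ∀ i : Fin n, (i : ℕ) ≠ 0 → right₁ n ℓ 1 w i = d i := by
    intro i hi
    simp only [right₁, if_neg hi, one_pow, one_mul, ite_self, w, i.2, dif_pos, Fin.eta]
    split_ifs with h
    · exact (hd' i h).symm
    · rfl
  refine ⟨w, funext fun i => ?_⟩
  by_cases hi : (i : ℕ) = 0
  · refine eq_of_prod_eq (Finset.mem_univ i) (fun j _ hj =>
      hw j fun h => hj (Fin.ext (h.trans hi.symm))) ?_
    rw [hd, ← prod_left₁_eq hn h1 h2]
    simp [left₁]
  · exact hw i hi

theorem sum_rootVector {ω : Circle} (hω : ω ^ 3 = 1) (hω1 : ω ≠ 1) {a b : Fin n} (h : a ≠ b) :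
    ∑ i, ‖(1 : ℂ) - rootVector ω (a, b) i‖ ^ 2 = 6 := by
  have h1 : ‖(1 : ℂ) - ω‖ ^ 2 = 3 := by
    have := norm_sub_sq_of_pow_three (one_pow 3) hω
    rwa [if_neg hω1.symm, Circle.coe_one] at this
  have h2 : ‖(1 : ℂ) - (ω⁻¹ : Circle)‖ ^ 2 = 3 := by
    have := norm_sub_sq_of_pow_three (one_pow 3) (y := ω⁻¹) (by rw [inv_pow, hω, inv_one])
    rwa [if_neg (fun e : 1 = ω⁻¹ => hω1 (inv_eq_one.1 e.symm)), Circle.coe_one] at this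
  rw [← Finset.sum_subset (Finset.subset_univ {a, b}), Finset.sum_pair h, rootVector_apply_fst h,
    rootVector_apply_snd h, h1, h2]
  · norm_num
  · intro i _ hi
    simp only [Finset.mem_insert, Finset.mem_singleton, not_or] at hi
    simp [rootVector_apply_of_ne hi.1 hi.2]

theorem act_rootElement_mem_cliffordSix_S₁ (hn : 3 ≤ n) {ℓ : ℕ} (h1 : 1 ≤ ℓ) (h2 : 2 * ℓ ≤ n)
    {ω : Circle} (hω : ω ^ 3 = 1) (hω1 : ω ≠ 1) {a b : Fin n} (hab : a ≠ b)
    (ha : (a : ℕ) + 1 ≠ n) (hb : (b : ℕ) + 1 ≠ n) :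
    act n (rootElement ω (a, b)) ∈ cliffordSix (S₁ n ℓ) := by
  refine ⟨Subgroup.mem_map_of_mem _ (mem_S₁_iff.2 ?_), ?_, fun g => ?_⟩
  · obtain ⟨w, hw⟩ := exists_right₁_eq hn h1 h2 (prod_rootVector ω (a, b)) fun i hi =>
      rootVector_apply_of_ne (fun h => ha (h ▸ hi)) fun h => hb (h ▸ hi)
    refine ⟨1, w, ?_, by rw [hw]; rfl⟩
    exact congrArg diag (funext fun i => by simp [left₁])
  · rw [← map_pow]
    have h3 : rootVector ω (a, b) ^ 3 = 1 := by
      rw [rootVector, mul_pow, ← Pi.mulSingle_pow, ← Pi.mulSingle_pow, inv_pow, hω, inv_one,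
        Pi.mulSingle_one, Pi.mulSingle_one, mul_one]
    have h4 : rootElement ω (a, b) ^ 3 = 1 := by
      apply Subtype.ext
      refine Prod.ext ?_ ?_
      · exact (map_pow diag (1 : Fin n → Circle) 3).symm.trans (by rw [one_pow, map_one]; rfl)
      · exact (map_pow diag (rootVector ω (a, b)) 3).symm.trans (by rw [h3, map_one]; rfl)
    rw [h4, map_one]
  · rw [displacement_of_right (u := rootElement ω (a, b)) (map_one diag) rfl,
      sum_rootVector hω hω1 hab]

end TorusBiquotient

/-! ### Counting elements of order three, and equivalence for `ℓ = 1` -/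

namespace TorusBiquotient

variable {n : ℕ}

theorem apply_eq_of_diag_mem_center {d : Fin n → Circle} (h : diag d ∈ Subgroup.center (U n))
    (i j : Fin n) : d i = d j := by
  obtain ⟨g, hg⟩ := exists_permUnitary (Equiv.swap i j)
  have h1 := hg d
  rw [Subgroup.mem_center_iff.1 h g, mul_inv_cancel_right] at h1
  have h2 := congrFun (diag_injective h1) i
  rwa [Function.comp_apply, Equiv.swap_apply_left] at h2

/-- A cube root of unity that can be exchanged with any entry is trivial. -/
theorem eq_one_of_sum_norm_sq_eq (hn : 3 < n) {β : Fin n → Circle} {ζ : Circle}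
    (hβ : ∀ j, β j ^ 3 = 1) (hζ : ζ ^ 3 = 1)
    (h : ∀ k, ∑ j, ‖((if j = k then ζ else 1 : Circle) : ℂ) - β j‖ ^ 2 = 6) : ζ = 1 := by
  classical
  by_contra hζ1
  set a : Fin n → ℝ := fun j => ‖((1 : Circle) : ℂ) - β j‖ ^ 2 with ha
  set b : Fin n → ℝ := fun j => ‖(ζ : ℂ) - β j‖ ^ 2 with hb
  have hab : ∀ j, (a j = 0 ∧ b j = 3) ∨ (a j = 3 ∧ (b j = 0 ∨ b j = 3)) := by
    intro j
    simp only [ha, hb, norm_sub_sq_of_pow_three (one_pow 3) (hβ j),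
      norm_sub_sq_of_pow_three hζ (hβ j)]
    by_cases h1 : 1 = β j
    · left
      rw [← h1]
      simp [hζ1]
    · right
      rw [if_neg h1]
      split_ifs <;> simp
  have hsum : ∀ k, ∑ j, a j + (b k - a k) = 6 := by
    intro k
    rw [← h k, ← Finset.sum_ite_eq' Finset.univ k (fun j => b j - a j) |>.trans (if_pos (Finset.mem_univ k)),
      ← Finset.sum_add_distrib]
    refine Finset.sum_congr rfl fun j _ => ?_
    split_ifs <;> simp [ha, hb]
  have k₀ : Fin n := ⟨0, by omega⟩
  have h₀ := hsum k₀
  have hn' : (4 : ℝ) ≤ n := by exact_mod_cast hn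
  -- By `hsum` the difference `b k - a k` does not depend on `k`. If some `β k` is `1`, all are, and
  -- the sum is `3`. Otherwise every `a k` is `3` and the sum is at least `3n - 3`, which exceeds
  -- `6` because `n > 3`.
  rcases hab k₀ with ⟨h1, h2⟩ | ⟨h1, h2⟩
  · have h3 : ∀ k, a k = 0 := by
      intro k
      have := hsum k
      rcases hab k with h4 | ⟨h4, h5 | h5⟩
      · exact h4.1
      · linarith
      · linarith
    simp only [h3, Finset.sum_const_zero] at h₀
    linarith
  · have h3 : ∀ k, a k = 3 := by
      intro k
      have := hsum k
      rcases hab k with h4 | h4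
      · rcases h2 with h2 | h2 <;> linarith
      · exact h4.1
    simp only [h3, Finset.sum_const, Finset.card_univ, Fintype.card_fin, nsmul_eq_mul] at h₀
    rcases hab k₀ with h4 | ⟨h4, h5 | h5⟩ <;> linarith

/-- The sum `6` means exactly two nontrivial entries, and the full product makes them inverse to
each other. The product over `s` rules out that just one of them lies in `s`. -/
theorem exists_rootVector_eq {ω : Circle} (hω : ω ^ 3 = 1) (hω1 : ω ≠ 1) {β : Fin n → Circle}
    (hβ : ∀ j, β j ^ 3 = 1) (h : ∑ j, ‖(1 : ℂ) - β j‖ ^ 2 = 6) (hprod : ∏ j, β j = 1)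
    {s : Finset (Fin n)} (hs : ∏ j ∈ s, β j = 1) :
    ∃ p ∈ s.offDiag ∪ sᶜ.offDiag, β = rootVector ω p := by
  classical
  have hcard : (Finset.univ.filter fun j => β j ≠ 1).card = 2 := by
    have h1 : ∀ j, ‖(1 : ℂ) - β j‖ ^ 2 = if β j ≠ 1 then 3 else 0 := by
      intro j
      have := norm_sub_sq_of_pow_three (one_pow 3) (hβ j)
      rw [Circle.coe_one] at this
      rw [this]
      by_cases hj : β j = 1
      · simp [hj]
      · rw [if_neg (Ne.symm hj), if_pos hj]
    simp only [h1, ← Finset.sum_filter, Finset.sum_const, nsmul_eq_mul] at h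
    have h2 : ((Finset.univ.filter fun j => β j ≠ 1).card : ℝ) = 2 := by linarith
    exact_mod_cast h2
  obtain ⟨a, b, hab, hfil⟩ := Finset.card_eq_two.1 hcard
  have hmem : ∀ j, β j ≠ 1 ↔ j = a ∨ j = b := by
    intro j
    simpa using Finset.ext_iff.1 hfil j
  have ha := (hmem a).2 (Or.inl rfl)
  have hb := (hmem b).2 (Or.inr rfl)
  have hne : ∀ j, j ≠ a → j ≠ b → β j = 1 := fun j h1 h2 =>
    not_not.1 fun h3 => ((hmem j).1 h3).elim h1 h2
  have hab' : a ∈ s ↔ b ∈ s := by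
    constructor
    · intro has
      by_contra hbs
      rw [Finset.prod_eq_single_of_mem a has fun j hj hja => hne j hja fun e => hbs (e ▸ hj)] at hs
      exact ha hs
    · intro hbs
      by_contra has
      rw [Finset.prod_eq_single_of_mem b hbs fun j hj hjb => hne j (fun e => has (e ▸ hj)) hjb] at hs
      exact hb hs
  have hinv : β a * β b = 1 := by
    rw [← hprod, ← Finset.prod_pair hab]
    refine Finset.prod_subset (Finset.subset_univ _) fun j _ hj => ?_
    simp only [Finset.mem_insert, Finset.mem_singleton, not_or] at hj
    exact hne j hj.1 hj.2
  have key : ∀ c d, c ≠ d → (c ∈ s ↔ d ∈ s) → β c = ω → β d = ω⁻¹ →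
      (∀ j, j ≠ c → j ≠ d → β j = 1) → ∃ p ∈ s.offDiag ∪ sᶜ.offDiag, β = rootVector ω p := by
    intro c d hcd hcds hc hd hj
    refine ⟨(c, d), ?_, funext fun j => ?_⟩
    · simp only [Finset.mem_union, Finset.mem_offDiag, Finset.mem_compl]
      tauto
    · by_cases h1 : j = c
      · rw [h1, rootVector_apply_fst hcd, hc]
      · by_cases h2 : j = d
        · rw [h2, rootVector_apply_snd hcd, hd]
        · rw [rootVector_apply_of_ne h1 h2, hj j h1 h2]
  rcases eq_or_eq_inv_of_pow_three hω hω1 (hβ a) ha with h1 | h1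
  · exact key a b hab hab' h1 (by rw [← h1]; exact eq_inv_of_mul_eq_one_right hinv) hne
  · refine key b a hab.symm hab'.symm ?_ h1 fun j h2 h3 => hne j h3 h2
    rw [h1] at hinv
    exact (inv_mul_eq_one.1 hinv).symm

/-- Evaluating at rescaled permutation matrices turns constancy of the displacement into equations
for every matching of the entries. -/
theorem exists_displacement_eq (hn : n ≠ 0) {u : equalDet n} {d e : Fin n → Circle}
    (hd : u.1.1 = diag d) (he : u.1.2 = diag e) (σ : Equiv.Perm (Fin n)) :
    ∃ g, displacement (act n u) g = ∑ i, ‖(d (σ i) : ℂ) - e i‖ ^ 2 := by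
  obtain ⟨R, hR⟩ := exists_permUnitary σ⁻¹
  obtain ⟨c, g, hg⟩ := exists_scalar_mul hn R
  refine ⟨g, ?_⟩
  rw [displacement_of_conj (e := e ∘ ⇑σ⁻¹) hd]
  · rw [← Equiv.sum_comp σ]
    simp
  · rw [he, hg, ← hR, scalar_mul_comm, mul_assoc, scalar_mul_comm]
    simp only [mul_assoc, inv_mul_cancel_left]

theorem exists_rootElement_of_mem_cliffordSix_S₂ (hn : 3 < n) {ℓ : ℕ} (h1 : 1 ≤ ℓ)
    (h2 : 2 * ℓ ≤ n) {ω : Circle} (hω : ω ^ 3 = 1) (hω1 : ω ≠ 1) {f : Equiv.Perm (SU n)}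
    (hf : f ∈ cliffordSix (S₂ n ℓ)) {s : Finset (Fin n)}
    (hs : s = Finset.univ.filter fun j : Fin n => (j : ℕ) < ℓ) :
    ∃ p ∈ s.offDiag ∪ sᶜ.offDiag, act n (rootElement ω p) = f := by
  obtain ⟨hf1, hf2, hf3⟩ := hf
  obtain ⟨v, hv, rfl⟩ := Subgroup.mem_map.1 hf1
  obtain ⟨z, w, hL, hR⟩ := mem_S₂_iff.1 hv
  have hn0 : n ≠ 0 := by omega
  rw [← map_pow, act_eq_one_iff hn0] at hf2
  obtain ⟨h3, h4⟩ := hf2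
  have hL3 : (v ^ 3).1.1 = diag (left₂ n z ^ 3) := by
    rw [map_pow, hL]
    rfl
  have hR3 : (v ^ 3).1.2 = diag (right₂ n ℓ z w ^ 3) := by
    rw [map_pow, hR]
    rfl
  rw [hL3] at h3 h4
  rw [hR3] at h3
  -- The cube is only known to be central, but the left entry at index `0` is `1`, so the scalar is
  -- `1`.
  have h5 : ∀ i, left₂ n z i ^ 3 = 1 := by
    intro i
    have h6 := apply_eq_of_diag_mem_center h4 i ⟨0, by omega⟩
    rw [Pi.pow_apply, Pi.pow_apply] at h6
    rw [h6]
    simp only [left₂]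
    rw [if_neg (by simp; omega), one_pow]
  have h6 : ∀ i, right₂ n ℓ z w i ^ 3 = 1 := by
    intro i
    rw [← h5 i]
    exact (congrFun (diag_injective h3) i).symm
  have hz3 : z ^ 3 = 1 := by
    rw [← prod_right₂ (by omega) h1 h2 z w, ← Finset.prod_pow]
    exact Finset.prod_eq_one fun i _ => h6 i
  -- The displacement is `6` wherever a transposition moves the single entry `z ^ 2`, which forces
  -- that entry to be trivial. Together with `z ^ 3 = 1` this leaves only right translations.
  have hz2 : z ^ 2 = 1 := by
    refine eq_one_of_sum_norm_sq_eq hn h6 (by rw [← pow_mul, mul_comm, pow_mul, hz3, one_pow])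
      fun k => ?_
    obtain ⟨g, hg⟩ := exists_displacement_eq hn0 hL.symm hR.symm
      (Equiv.swap k ⟨n - 1, by omega⟩)
    rw [← hf3 g, hg]
    refine Finset.sum_congr rfl fun j _ => ?_
    have h7 : left₂ n z (Equiv.swap k ⟨n - 1, by omega⟩ j) = if j = k then z ^ 2 else 1 := by
      simp only [left₂]
      congr 1
      rw [eq_iff_iff, ← Equiv.apply_eq_iff_eq (Equiv.swap k ⟨n - 1, by omega⟩) (x := j),
        Equiv.swap_apply_left, Fin.ext_iff]
      simp only
      omega
    rw [h7]
  have hz : z = 1 := by rwa [pow_succ, hz2, one_mul] at hz3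
  subst hz
  have hL1 : left₂ n 1 = 1 := funext fun i => by simp [left₂]
  have hL' : v.1.1 = 1 := by rw [← hL, hL1, map_one]
  obtain ⟨p, hp, hp'⟩ := exists_rootVector_eq hω hω1 h6
    (by rw [← displacement_of_right hL' hR.symm 1, hf3])
    (by rw [← prod_left₂_eq (by omega) h1 h2, hL1]; exact Finset.prod_const_one)
    (s := s) (by rw [hs, prod_right₂ (by omega) h1 h2])
  refine ⟨p, hp, ?_⟩
  congr 1
  apply Subtype.ext
  exact Prod.ext ((map_one diag).trans hL'.symm) ((congrArg diag hp'.symm).trans hR)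

theorem not_areEquivalentActions (hn : 3 ≤ n) {ℓ : ℕ} (h1 : 2 ≤ ℓ) (h2 : 2 * ℓ ≤ n) :
    ¬ AreEquivalentActions (S₁ n ℓ) (S₂ n ℓ) := by
  classical
  rintro ⟨F, hF, hI⟩
  obtain ⟨ω, hω, hω1⟩ := exists_cubeRoot
  set s := Finset.univ.filter fun j : Fin n => (j : ℕ) < ℓ with hs
  set r := Finset.univ.filter fun j : Fin n => (j : ℕ) < n - 1 with hr
  have hsub : r.offDiag.image (fun p => MulAut.conj F (act n (rootElement ω p))) ⊆
      (s.offDiag ∪ sᶜ.offDiag).image fun p => act n (rootElement ω p) := by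
    intro f hf
    obtain ⟨⟨a, b⟩, hp, rfl⟩ := Finset.mem_image.1 hf
    simp only [hr, Finset.mem_offDiag, Finset.mem_filter, Finset.mem_univ, true_and] at hp
    exact Finset.mem_image.2 (exists_rootElement_of_mem_cliffordSix_S₂ (by omega) (by omega) h2 hω
      hω1 (conj_mem_cliffordSix hF hI (act_rootElement_mem_cliffordSix_S₁ hn (by omega) h2 hω hω1
        hp.2.2 (by omega) (by omega))) hs)
  have hcard := (Finset.card_le_card hsub).trans
    (Finset.card_image_le.trans (Finset.card_union_le _ _))
  rw [Finset.card_image_of_injOn, Finset.offDiag_card, Finset.offDiag_card, Finset.offDiag_card,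
    Finset.card_compl, Fintype.card_fin, card_filter_lt (by omega), card_filter_lt (by omega)]
    at hcard
  -- The counts satisfy `(n-1)(n-2) = ℓ(ℓ-1) + (n-ℓ)(n-ℓ-1) + 2(ℓ-1)(n-ℓ-1)`, and the last term is
  -- positive for `ℓ ≥ 2`. The substitutions remove natural subtraction.
  · obtain ⟨m, rfl⟩ : ∃ m, n = ℓ + ℓ + m := ⟨n - (ℓ + ℓ), by omega⟩
    obtain ⟨l, rfl⟩ : ∃ l, ℓ = l + 2 := ⟨ℓ - 2, by omega⟩
    rw [show l + 2 + (l + 2) + m - 1 = 2 * l + m + 3 by omega,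
      show l + 2 + (l + 2) + m - (l + 2) = l + m + 2 by omega] at hcard
    have e : ∀ x : ℕ, (x + 1) * (x + 1) - (x + 1) = x * (x + 1) := fun x => by
      rw [Nat.sub_eq_iff_eq_add (by nlinarith)]
      ring
    rw [e, e, e] at hcard
    nlinarith
  · intro p hp q hq h
    refine act_rootElement_injOn (by omega) hω hω1 ?_ ?_ ((MulAut.conj F).injective h)
    · exact (Finset.mem_offDiag.1 (Finset.mem_coe.1 hp)).2.2
    · exact (Finset.mem_offDiag.1 (Finset.mem_coe.1 hq)).2.2

/-- Interchanging the first and last coordinates on both sides carries one model to the other with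
the same parameters `z` and `w`; the isometry is conjugation by a rescaled permutation matrix. -/
theorem areEquivalentActions_one (hn : 3 ≤ n) : AreEquivalentActions (S₁ n 1) (S₂ n 1) := by
  set σ : Equiv.Perm (Fin n) := Equiv.swap ⟨0, by omega⟩ ⟨n - 1, by omega⟩ with hσ
  have hσ0 : ∀ i, (σ i : ℕ) = 0 ↔ (i : ℕ) + 1 = n := by
    intro i
    rw [hσ, Equiv.swap_apply_def]
    split_ifs <;> simp_all [Fin.ext_iff] <;> omega
  have hσn : ∀ i, (σ i : ℕ) + 1 = n ↔ (i : ℕ) = 0 := by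
    intro i
    rw [← hσ0, hσ, Equiv.swap_apply_self]
  have hσi : ∀ i : Fin n, (i : ℕ) ≠ 0 → (i : ℕ) + 1 ≠ n → σ i = i := by
    intro i h1 h2
    exact Equiv.swap_apply_of_ne_of_ne (fun h => h1 (by rw [h])) fun h => h2 (by
      rw [h]
      simp only
      omega)
  have hl : ∀ z, left₁ n 1 z ∘ σ = left₂ n z := by
    intro z
    funext i
    simp only [Function.comp_apply, left₁, left₂, Nat.lt_one_iff, hσ0]
  have hr : ∀ z w, right₁ n 1 z w ∘ σ = right₂ n 1 z w := by
    intro z w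
    funext i
    simp only [Function.comp_apply, right₁, right₂, Nat.lt_one_iff, hσ0, hσn]
    by_cases h1 : (i : ℕ) = 0
    · rw [if_neg (by omega), if_pos h1, if_pos h1, Finset.Ico_self, Finset.prod_empty, mul_one]
    · by_cases h2 : (i : ℕ) + 1 = n
      · rw [if_pos h2, if_neg h1, if_pos h2]
      · rw [if_neg h2, if_neg h1, if_neg h2, if_neg h1, if_neg h2, hσi i h1 h2]
  obtain ⟨s, hs⟩ := exists_conj_scalar (n := n) (by omega) (ρ := diag) (α := id) (P := 1)
    (fun d => by simp) σ
  have key : ∀ (u v : equalDet n) z w, diag (left₁ n 1 z) = u.1.1 → diag (right₁ n 1 z w) = u.1.2 →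
      diag (left₂ n z) = v.1.1 → diag (right₂ n 1 z w) = v.1.2 →
      ∀ g, MulAut.conj s (act n u g) = act n v (MulAut.conj s g) := by
    intro u v z w h1 h2 h3 h4 g
    apply toU_injective
    rw [toU_act, MulAut.conj_apply, MulAut.conj_apply, map_mul, map_mul, map_mul, map_mul, toU_act,
      toU_inv, ← h1, ← h2, ← h3, ← h4, ← hl, ← hr]
    have h5 := hs (left₁ n 1 z)
    have h6 := hs (right₁ n 1 z w)
    rw [id] at h5 h6
    rw [← h5, ← h6]
    group
  refine ⟨(MulAut.conj s).toEquiv, fun g h => ?_, ?_⟩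
  · have h1 : ∀ i j, ((MulAut.conj s).toEquiv g).1 i j - ((MulAut.conj s).toEquiv h).1 i j =
        ((toU s : Matrix (Fin n) (Fin n) ℂ) * (((g : Matrix (Fin n) (Fin n) ℂ) - h) *
          (toU s⁻¹ : U n))) i j := by
      intro i j
      rw [Matrix.sub_mul, Matrix.mul_sub, ← Matrix.mul_assoc, ← Matrix.mul_assoc]
      rfl
    simp only [h1]
    rw [sum_norm_sq_unitary_mul, sum_norm_sq_mul_unitary]
    rfl
  · refine intertwines_of_forall (θ := (Subtype.val : S₁ n 1 → equalDet n)) (fun u => by simp) ?_ ?_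
    · rintro ⟨u, hu⟩
      obtain ⟨z, w, h1, h2⟩ := mem_S₁_iff.1 hu
      exact ⟨⟨_, torusHom₂_mem hn le_rfl (by omega) (z, w)⟩, mem_S₂_iff.2 ⟨z, w, rfl, rfl⟩,
        key _ _ z w h1 h2 rfl rfl⟩
    · intro v hv
      obtain ⟨z, w, h1, h2⟩ := mem_S₂_iff.1 hv
      exact ⟨⟨⟨_, torusHom₁_mem hn le_rfl (by omega) (z, w)⟩, mem_S₁_iff.2 ⟨z, w, rfl, rfl⟩⟩,
        key _ _ z w rfl rfl h1 h2⟩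

end TorusBiquotient
theorem mainTheorem4 (n : ℕ) (hn : 3 ≤ n) :
    (∀ T : Subgroup (TorusBiquotient.equalDet n),
      TorusBiquotient.IsTorus (n - 1) T → TorusBiquotient.HasFiniteKernel T →
      (TorusBiquotient.ActsFreely T ↔
        TorusBiquotient.ActsOnOneSide T ∨
        ∃ ℓ : ℕ, 1 ≤ ℓ ∧ 2 * ℓ ≤ n ∧
          (TorusBiquotient.IsConjugate T (TorusBiquotient.S₁ n ℓ) ∨
            TorusBiquotient.IsConjugate T (TorusBiquotient.S₂ n ℓ)))) ∧
    (∀ ℓ : ℕ, 1 ≤ ℓ → 2 * ℓ ≤ n →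
      (TorusBiquotient.AreEquivalentActions
        (TorusBiquotient.S₁ n ℓ) (TorusBiquotient.S₂ n ℓ) ↔ ℓ = 1)) :=
  ⟨fun _ hT hK => ⟨TorusBiquotient.classified_of_actsFreely hn hT hK,
      TorusBiquotient.actsFreely_of_classified hn⟩,
    fun ℓ h1 h2 => ⟨fun h => by
      by_contra hℓ
      exact TorusBiquotient.not_areEquivalentActions hn (by omega) h2 h, by
      rintro rfl
      exact TorusBiquotient.areEquivalentActions_one hn⟩⟩
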